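/- Let $k\ge 1$ and $n\ge d\ge 2k+4$ be integers. Let $C\subset\mathbb R^{d-2}$ be a cyclic $2k$-polytope with vertices $v_1,\dots,v_{n-d+2k},x$ in this order, that is, the image under an affine embedding $\mathbb R^{2k}\to\mathbb R^{d-2}$ of the points $(t_i,t_i^2,\dots,t_i^{2k})$, $t_1<t_2<\dots<t_{n-d+2k+1}$, the last of which gives $x$. Let $T\subset\mathbb R^{d-2}$ be a $(d-2-2k)$-simplex with vertices $v_{n-d+2k+1},\dots,v_{n-1}$ whose relative interior meets the affine hull of $C$ exactly in $x$. Then $P=\mathrm{conv}(C\cup T)$ is the McMullen–Walkup polytope ${\sf MW}(2k,d-2,n-1)$, with vertices $v_1,\dots,v_{n-1}$. Let $1\le a\le n-d+1$ and $v_0'\in\mathbb R^{d-2}$. The $a$-th lexicographic diamond $D_a$ over $P$ is the $(d-1)$-polytope $$D_a=\mathrm{conv}\{p,(w_1,v_1),\dots,(w_{n-1},v_{n-1})\}\subset\mathbb R\times\mathbb R^{d-2},\qquad p=(w_0,v_0'),$$ where $w_0\gg w_1\gg\dots\gg w_{a-1}\gg|w_a|$, $w_a<0$, and $w_{a+1}=\dots=w_{n-1}=0$.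 Here $\gg$ means "more than $R$ times as large", for a sufficiently large constant $R$ depending only on $k,d,n,a$, the points $v_i$ and $v_0'$ (so the condition is $w_i>R|w_{i+1}|$ for $0\le i<a$). We write $v_i$ also for the vertex $(w_i,v_i)$ of $D_a$. A missing face of $D_a$ is a minimal set of vertices that is not the vertex set of a proper face of $D_a$ (the empty set counts as a face). A set of vertices among $v_1,\dots,v_{n-d+2k}$ (the vertices of $C$ other than $x$) is called isolated if it contains no two consecutive vertices $v_i,v_{i+1}$; its blocks are its maximal nonempty subsets of consecutive vertices. The minimum of such a set is its vertex with smallest index. **(Missing faces.)** The missing faces of $D_a$ of size $k+1$ or $k+2$ are exactly the following sets: 1. $\{p\}\cup F'$, where $F'\subseteq\{v_1,\dots,v_{n-d+2k}\}$ is isolated, $|F'|=k+1$ and $\min F'=v_a$; 2. $F\subseteq\{v_1,\dots,v_{n-d+2k}\}$, isolated, with $|F|=k+1$ and $\min F\ne v_a$. **($(d-1)$-faces of the stacked triangulation.)** $D_a$ has exactly one $(k+1)$-stacked triangulation $S(D_a)$, i.e. exactly one triangulation whose vertices are vertices of $D_a$ and which has no interior faces of dimension less than $(d-1)-(k+1)$.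 The sets of $d$ vertices that form the $(d-1)$-simplices of $S(D_a)$ are exactly the sets of the following two types: * (I) $\{p\}\cup G\cup\mathrm{Vert}(T)$, where $G\subseteq\{v_1,\dots,v_{n-d+2k}\}$, $|G|=2k$, and all blocks of $G$ have even size; * (II) $\{v_a\}\cup G\cup\mathrm{Vert}(T)$, where $G\subseteq\{v_{a+1},\dots,v_{n-d+2k}\}$, $|G|=2k$, and all blocks of $G$ have even size. -/

import Mathlib

/-- The point `x(s) = (s, s², …, s^K)` of the moment curve in `ℝ^K`. -/
noncomputable def momentCurve (K : ℕ) (s : ℝ) : EuclideanSpace ℝ (Fin K) :=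
  WithLp.toLp 2 (fun i : Fin K => s ^ ((i : ℕ) + 1))

/-- `v 1, …, v N` is the ordered list of vertices of a McMullen–Walkup polytope `MW(K, D, N)` in
`ℝ^D` (for `2 ≤ K ≤ D < N`; values of `v` at other indices are irrelevant).
The cyclic `K`-polytope `C` has the `N - D + K` vertices `φ (x (t 1)), φ (x (t 2)), …`, for
parameters `t 1 < t 2 < …` and an affine embedding `φ` of `ℝ^K` in `ℝ^D`; its last vertex is called
`x`. The `(D - K)`-simplex `T` has vertices `v (N - D + K), …, v N`, and its relative interior
meets the affine hull of `C` exactly in `x`. The vertices before those of `T` are the vertices of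
`C` other than `x`. -/
def IsMWVertices (K D N : ℕ) (v : ℕ → EuclideanSpace ℝ (Fin D)) : Prop :=
  ∃ (t : ℕ → ℝ) (φ : EuclideanSpace ℝ (Fin K) →ᵃ[ℝ] EuclideanSpace ℝ (Fin D)),
    StrictMonoOn t (Set.Icc 1 (N - D + K)) ∧
    Function.Injective φ ∧
    (∀ i ∈ Set.Ico 1 (N - D + K), v i = φ (momentCurve K (t i))) ∧
    AffineIndependent ℝ (fun i : Set.Icc (N - D + K) N => v i) ∧
    intrinsicInterior ℝ (convexHull ℝ (v '' Set.Icc (N - D + K) N)) ∩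
        (affineSpan ℝ ((fun i => φ (momentCurve K (t i))) '' Set.Icc 1 (N - D + K)) :
          Set (EuclideanSpace ℝ (Fin D))) =
      {φ (momentCurve K (t (N - D + K)))}

/-- The heights `w 0, w 1, …, w (n - 1)` of the `a`-th lexicographic diamond on `n` vertices:
`w 0 ≫ w 1 ≫ ⋯ ≫ w (a - 1) ≫ |w a|`, `w a < 0` and `w (a + 1) = ⋯ = w (n - 1) = 0`,
where `≫` means "more than `R` times as large as". -/
def IsLexHeights (R : ℝ) (n a : ℕ) (w : ℕ → ℝ) : Prop :=
  (∀ i, i < a → R * |w (i + 1)| < w i) ∧ w a < 0 ∧ ∀ i, a < i → i < n → w i = 0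

/-- The points `(w 0, q), (w 1, v 1), (w 2, v 2), …` in `ℝ × E`: the apex (index `0`) and the lifted
vertices of a diamond. -/
def diamondPoint {E : Type*} (w : ℕ → ℝ) (q : E) (v : ℕ → E) (i : ℕ) : ℝ × E :=
  (w i, if i = 0 then q else v i)

section Polytopes

variable {E : Type*} [AddCommGroup E] [Module ℝ E]

/-- The convex hull of the points `V 0, …, V (n - 1)`. -/
def hullOf (V : ℕ → E) (n : ℕ) : Set E :=
  convexHull ℝ (V '' {i | i < n})

variable [TopologicalSpace E]

/-- The set `F` of labels spans a proper (possibly empty) face of the polytope with vertices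
`V 0, …, V (n - 1)`. -/
def IsBoundaryFace (V : ℕ → E) (n : ℕ) (F : Finset ℕ) : Prop :=
  F ⊆ Finset.range n ∧
  IsExposed ℝ (hullOf V n) (convexHull ℝ (V '' (F : Set ℕ))) ∧
  convexHull ℝ (V '' (F : Set ℕ)) ≠ hullOf V n

/-- Missing faces of a simplicial polytope: the minimal sets of vertices (given by their labels)
which are not faces of its boundary complex. -/
def IsMissingFace (V : ℕ → E) (n : ℕ) (F : Finset ℕ) : Prop :=
  F ⊆ Finset.range n ∧ ¬ IsBoundaryFace V n F ∧ ∀ G, G ⊂ F → IsBoundaryFace V n G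

/-- `S` is a triangulation of the `m`-polytope `P` (full-dimensional in an `m`-dimensional space)
whose vertices are vertices of `P`. -/
def IsTriangulationOf (P : Set E) (S : Geometry.SimplicialComplex ℝ E) : Prop :=
  S.space = P ∧ S.vertices ⊆ Set.extremePoints ℝ P

/-- A `j`-stacked triangulation of an `m`-polytope `P` in an `m`-dimensional space: a triangulation
in which every interior face (one that does not lie in the boundary of `P`)
has dimension at least `m - j`. Recall that a face with vertex set `s` has dimension `#s - 1`. -/
def IsStackedTriangulation (m j : ℕ) (P : Set E) (S : Geometry.SimplicialComplex ℝ E) : Prop :=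
  IsTriangulationOf P S ∧
  ∀ s ∈ S.faces, ¬ convexHull ℝ (s : Set E) ⊆ frontier P → m + 1 ≤ s.card + j

end Polytopes

/-- No two elements of `F` are consecutive. -/
def IsIsolated (F : Finset ℕ) : Prop := ∀ i ∈ F, i + 1 ∉ F

/-- A block of `G`: an inclusion-maximal nonempty subset of `G` of consecutive labels. -/
def IsBlock (G B : Finset ℕ) : Prop :=
  Maximal (fun B : Finset ℕ => B ⊆ G ∧ ∃ i j, i ≤ j ∧ B = Finset.Icc i j) B

/-- `G` consists of even blocks: each of its blocks has even size. -/
def HasEvenBlocks (G : Finset ℕ) : Prop := ∀ B, IsBlock G B → Even B.card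

/-!
An affine functional on the space of the diamond is the sum of a multiple `c * w i` of the height
and of an affine functional on the space of the McMullen–Walkup polytope. Restricted to the vertices
of the cyclic polytope, the latter is a polynomial of degree at most `2k` in the parameter `t i`,
and its values on the vertices of the simplex `T` are arbitrary, apart from one linear condition:
their weighted mean is the value of the polynomial at the parameter of `x`. This description
(`IsMomentConfig`) is all that is used of the McMullen–Walkup polytope. As `R` grows, the heights
become lexicographically separated, so that each statement about the signs of a functional, or of
the coefficients of a dependence, is decided by the largest height that occurs, and
otherwise by the unlifted polytope. This gives four facts, for all large `R`:

* the diamond is simplicial (`IsMomentConfig.eventually_linearIndepOn_of_nonneg`);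
* the sets of type (I) and (II) are vertex sets of simplices
  (`IsMomentConfig.eventually_linearIndepOn_of_isStackedFacet`);
* a subset with at most `d - (k + 2)` elements of such a set lies in a supporting hyperplane
  (`IsMomentConfig.eventually_exists_supporting`), so the simplices have no interior faces of low
  dimension;
* each set in the list of missing faces contains the negative part of an affine dependence which is
  positive on all vertices of `T` (`IsMomentConfig.eventually_exists_dependence`). It comes from
  the Radon partition of `2k + 2` points on the moment curve, the last of which is `x`, with `x`
  replaced by the weighted mean of the vertices of `T`.

The last fact shows that the listed sets are not faces, and that the simplices cover the diamond:
among the convex combinations that represent a given point, one with the largest total weight on `T`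
has no listed set in its support (`exists_mem_convexHull_of_dependence`), and a set of vertices that
contains no listed set is contained in a set of type (I) or (II), by Gale evenness
(`exists_isStackedFacet_superset`).

That the simplices intersect properly and that the triangulation is unique both follow from one
property of simplicial polytopes: two simplices without interior faces of low dimension always
intersect in a common face (`IsStackedSimplex.inter_subset_convexHull`). Otherwise their vertices
would contain a Radon partition with at most `d + 1` elements; one of the two parts is so
small that it lies in the boundary, whence the whole partition lies in a facet, which is a simplex.

Finally, faces with at most `d - (k + 2)` vertices of the triangulation lie in the boundary, so that
the missing faces with `k + 1` or `k + 2` vertices of the diamond and those of the triangulation are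
the same (`IsStackedSystem.isMissingFace_iff`).
-/

/-! ### Sets with even blocks -/

theorem HasEvenBlocks.even_card_filter_lt {G : Finset ℕ} (h : HasEvenBlocks G) {j : ℕ}
    (hj : j ∉ G) : ∀ e, e ∉ G → j ≤ e → Even (G.filter (fun i => j < i ∧ i < e)).card := by
  intro e
  induction e using Nat.strong_induction_on with
  | _ e ih =>
    intro he hje
    rcases hje.eq_or_lt with rfl | hlt
    · rw [Finset.filter_false_of_mem (fun i _ => by omega)]
      simp
    -- the last label before `e` that is missing from `G`
    have hne : ((Finset.range e).filter (· ∉ G)).Nonempty := ⟨j, by simp [hlt, hj]⟩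
    obtain ⟨m, hm, hmax⟩ := Finset.exists_max_image _ id hne
    simp only [Finset.mem_filter, Finset.mem_range, id] at hm hmax
    have hjm : j ≤ m := hmax j ⟨hlt, hj⟩
    have hfull : ∀ i, m < i → i < e → i ∈ G := fun i h1 h2 => by
      by_contra h3
      have := hmax i ⟨h2, h3⟩
      omega
    have hev : Even (Finset.Ioo m e).card := by
      by_cases hme : m + 1 = e
      · have : Finset.Ioo m e = ∅ := by ext i; simp; omega
        simp [this]
      have hB : Finset.Ioo m e = Finset.Icc (m + 1) (e - 1) := by ext i; simp; omega
      apply h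
      refine ⟨⟨fun i hi => ?_, m + 1, e - 1, by omega, hB⟩, ?_⟩
      · rw [Finset.mem_Ioo] at hi
        exact hfull i hi.1 hi.2
      rintro B' ⟨hB'G, i, l, hil, rfl⟩ hle x hx
      have h1 : m + 1 ∈ Finset.Icc i l := hle (by simp; omega)
      have h2 : m ∉ Finset.Icc i l := fun h' => hm.2 (hB'G h')
      have h3 : e ∉ Finset.Icc i l := fun h' => he (hB'G h')
      simp only [Finset.mem_Icc, Finset.mem_Ioo] at *
      omega
    have hsplit : G.filter (fun i => j < i ∧ i < e)
        = G.filter (fun i => j < i ∧ i < m) ∪ Finset.Ioo m e := by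
      ext i
      simp only [Finset.mem_filter, Finset.mem_union, Finset.mem_Ioo]
      constructor
      · rintro ⟨h1, h2, h3⟩
        rcases lt_trichotomy i m with h4 | h4 | h4
        · exact Or.inl ⟨h1, h2, h4⟩
        · exact absurd (h4 ▸ h1) hm.2
        · exact Or.inr ⟨h4, h3⟩
      · rintro (⟨h1, h2, h3⟩ | ⟨h1, h2⟩)
        · exact ⟨h1, h2, by omega⟩
        · exact ⟨hfull i h1 h2, by omega, h2⟩
    rw [hsplit, Finset.card_union_of_disjoint]
    · exact (ih m hm.1 hm.2 hjm).add hev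
    · rw [Finset.disjoint_left]
      intro i h1 h2
      simp only [Finset.mem_filter, Finset.mem_Ioo] at h1 h2
      omega

/-- Gale's evenness condition: behind a label missing from a set with even blocks there is an even
number of elements of the set. -/
theorem HasEvenBlocks.even_card_filter {G : Finset ℕ} (h : HasEvenBlocks G) {j : ℕ}
    (hj : j ∉ G) : Even (G.filter (fun i => j < i)).card := by
  have he : G.sup id + j + 1 ∉ G := fun h' => by
    have := Finset.le_sup (f := id) h'
    simp only [id] at this
    omega
  have := h.even_card_filter_lt hj _ he (by omega)
  convert this using 2
  ext i
  have : i ∈ G → i ≤ G.sup id := fun h' => Finset.le_sup (f := id) h'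
  simp only [Finset.mem_filter]
  constructor
  · rintro ⟨h1, h2⟩; have := this h1; exact ⟨h1, h2, by omega⟩
  · rintro ⟨h1, h2, _⟩; exact ⟨h1, h2⟩

theorem hasEvenBlocks_of_even_card_filter {G : Finset ℕ} (h0 : 0 ∉ G)
    (h : ∀ j, j ∉ G → Even (G.filter (fun i => j < i)).card) : HasEvenBlocks G := by
  rintro B ⟨⟨hBG, i, j, hij, rfl⟩, hmax⟩
  have hi : i ∈ G := hBG (by simp [hij])
  have hi0 : i ≠ 0 := fun h' => h0 (h' ▸ hi)
  have h1 : i - 1 ∉ G := fun h' => by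
    have := hmax ⟨fun x hx => ?_, i - 1, j, by omega, rfl⟩
      (Finset.Icc_subset_Icc (by omega) le_rfl)
    · have := this (show i - 1 ∈ Finset.Icc (i - 1) j by simp; omega)
      simp at this; omega
    · by_cases hx' : x = i - 1
      · exact hx' ▸ h'
      · exact hBG (by simp only [Finset.mem_Icc] at *; omega)
  have h2 : j + 1 ∉ G := fun h' => by
    have := hmax ⟨fun x hx => ?_, i, j + 1, by omega, rfl⟩
      (Finset.Icc_subset_Icc le_rfl (by omega))
    · have := this (show j + 1 ∈ Finset.Icc i (j + 1) by simp; omega)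
      simp at this
    · by_cases hx' : x = j + 1
      · exact hx' ▸ h'
      · exact hBG (by simp only [Finset.mem_Icc] at *; omega)
  have hsplit : G.filter (fun x => i - 1 < x)
      = G.filter (fun x => j + 1 < x) ∪ Finset.Icc i j := by
    ext x
    simp only [Finset.mem_filter, Finset.mem_union, Finset.mem_Icc]
    constructor
    · rintro ⟨h3, h4⟩
      by_cases h5 : x ≤ j
      · exact Or.inr ⟨by omega, h5⟩
      · refine Or.inl ⟨h3, ?_⟩
        have : x ≠ j + 1 := fun h' => h2 (h' ▸ h3)
        omega
    · rintro (⟨h3, h4⟩ | h3)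
      · exact ⟨h3, by omega⟩
      · exact ⟨hBG (by simpa using h3), by omega⟩
  have hc := h _ h1
  rw [hsplit, Finset.card_union_of_disjoint, Nat.even_add] at hc
  · exact hc.1 (h _ h2)
  · rw [Finset.disjoint_left]
    intro x h3 h4
    simp only [Finset.mem_filter, Finset.mem_Icc] at h3 h4
    omega

/-- A set of labels in an interval with at least `2k` elements, without an isolated subset of size
`k + 1`, is contained in a set with even blocks of size `2k` in that interval. -/
theorem exists_hasEvenBlocks_superset {lo : ℕ} (hlo : 1 ≤ lo) : ∀ (M k : ℕ) (H : Finset ℕ),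
    H ⊆ Finset.Icc lo M → 2 * k + lo ≤ M + 1 →
    (∀ F ⊆ H, IsIsolated F → F.card ≤ k) →
    ∃ G ⊆ Finset.Icc lo M, H ⊆ G ∧ G.card = 2 * k ∧ HasEvenBlocks G := by
  suffices h : ∀ (M k : ℕ) (H : Finset ℕ),
      H ⊆ Finset.Icc lo M → 2 * k + lo ≤ M + 1 →
      (∀ F ⊆ H, IsIsolated F → F.card ≤ k) →
      ∃ G ⊆ Finset.Icc lo M, H ⊆ G ∧ G.card = 2 * k ∧
        ∀ j, j ∉ G → Even (G.filter (fun i => j < i)).card by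
    intro M k H h1 h2 h3
    obtain ⟨G, g1, g2, g3, g4⟩ := h M k H h1 h2 h3
    refine ⟨G, g1, g2, g3, hasEvenBlocks_of_even_card_filter (fun h0 => ?_) g4⟩
    have := g1 h0
    simp at this
    omega
  intro M
  induction M using Nat.strong_induction_on with
  | _ M ih =>
    intro k H hH hM hF
    rcases k with _ | k
    · refine ⟨∅, by simp, fun x hx => ?_, by simp, by simp⟩
      have := hF {x} (by simpa using hx) (by simp [IsIsolated])
      simp at this
    by_cases hMH : M ∈ H
    · obtain ⟨G, g1, g2, g3, g4⟩ := ih (M - 2) (by omega) k (H \ {M - 1, M}) (fun x hx => by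
          have := hH (Finset.mem_sdiff.1 hx).1
          simp only [Finset.mem_sdiff, Finset.mem_insert, Finset.mem_singleton,
            Finset.mem_Icc] at *
          omega) (by omega) (fun F hFH hFi => by
          have hlt : ∀ x ∈ F, x + 1 < M := fun x hx => by
            have h1 := hFH hx
            have h2 := hH (Finset.mem_sdiff.1 h1).1
            simp only [Finset.mem_sdiff, Finset.mem_insert, Finset.mem_singleton,
              Finset.mem_Icc] at h1 h2
            omega
          have hMF : M ∉ F := fun h => by have := hlt M h; omega
          have := hF (insert M F) (by
            intro x hx
            rcases Finset.mem_insert.1 hx with rfl | hx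
            · exact hMH
            · exact (Finset.mem_sdiff.1 (hFH hx)).1) (by
            intro x hx hx'
            rw [Finset.mem_insert] at hx hx'
            rcases hx with rfl | hx
            · rcases hx' with hx' | hx'
              · omega
              · have := hlt _ hx'; omega
            · rcases hx' with hx' | hx'
              · have := hlt _ hx; omega
              · exact hFi x hx hx')
          rw [Finset.card_insert_of_notMem hMF] at this
          omega)
      have hle : ∀ x ∈ G, x + 2 ≤ M := fun x hx => by
        have := g1 hx; simp only [Finset.mem_Icc] at this; omega
      have h1G : M ∉ G := fun h => by have := hle _ h; omega
      have h2G : M - 1 ∉ insert M G := fun h => by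
        rcases Finset.mem_insert.1 h with h | h
        · omega
        · have := hle _ h; omega
      refine ⟨insert (M - 1) (insert M G), ?_, ?_, ?_, ?_⟩
      · intro x hx
        simp only [Finset.mem_insert, Finset.mem_Icc] at *
        rcases hx with rfl | rfl | hx
        · omega
        · omega
        · have := g1 hx; simp only [Finset.mem_Icc] at this; omega
      · intro x hx
        by_cases h : x ∈ H \ {M - 1, M}
        · simp [g2 h]
        · simp only [Finset.mem_sdiff, Finset.mem_insert, Finset.mem_singleton] at h ⊢
          tauto
      · rw [Finset.card_insert_of_notMem h2G, Finset.card_insert_of_notMem h1G, g3]; omega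
      · intro j hj
        simp only [Finset.mem_insert, not_or] at hj
        rcases lt_or_ge j (M - 1) with hjM | hjM
        · rw [Finset.filter_insert, if_pos hjM, Finset.filter_insert, if_pos (by omega),
            Finset.card_insert_of_notMem, Finset.card_insert_of_notMem]
          · have := g4 j hj.2.2
            rw [add_assoc]
            exact this.add (by decide)
          · exact fun h => h1G (Finset.mem_filter.1 h).1
          · intro h
            exact h2G (Finset.insert_subset_insert _ (Finset.filter_subset _ _) h)
        · rw [Finset.filter_false_of_mem]
          · simp
          · intro i hi
            simp only [Finset.mem_insert] at hi
            rcases hi with rfl | rfl | hi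
            · omega
            · omega
            · have := hle _ hi; omega
    · by_cases hfull : 2 * (k + 1) + lo = M + 1
      · refine ⟨Finset.Icc lo M, subset_rfl, hH, by simp; omega, fun j hj => ?_⟩
        rcases lt_or_ge j lo with h | h
        · rw [Finset.filter_true_of_mem (fun i hi => by simp at hi; omega)]
          rw [Nat.card_Icc]
          exact ⟨k + 1, by omega⟩
        · rw [Finset.filter_false_of_mem (fun i hi => by simp at hi hj; omega)]
          simp
      · obtain ⟨G, g1, g2, g3, g4⟩ := ih (M - 1) (by omega) (k + 1) H (fun x hx => by
          have := hH hx
          have : x ≠ M := fun h => hMH (h ▸ hx)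
          simp only [Finset.mem_Icc] at *
          omega) (by omega) hF
        exact ⟨G, g1.trans (Finset.Icc_subset_Icc le_rfl (by omega)), g2, g3, g4⟩

/-- The missing faces of the complex generated by the sets `{0} ∪ G` and `{a} ∪ G'`, for sets `G` in
`[1, M]` and `G'` in `[a + 1, M]` with even blocks and of size `2k`. -/
def IsSmallMissingFace (k a M : ℕ) (F : Finset ℕ) : Prop :=
  (∃ F' : Finset ℕ, F = insert 0 F' ∧ F' ⊆ Finset.Icc 1 M ∧
      F'.card = k + 1 ∧ IsIsolated F' ∧ IsLeast (F' : Set ℕ) a) ∨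
    (F ⊆ Finset.Icc 1 M ∧ F.card = k + 1 ∧ IsIsolated F ∧ ¬ IsLeast (F : Set ℕ) a)

/-- The facets of the stacked triangulation of the diamond; the labels in `[M + 1, N]` are those of
the vertices of the simplex `T`. -/
def IsStackedFacet (k a M N : ℕ) (Y : Finset ℕ) : Prop :=
  ∃ G : Finset ℕ, G ⊆ Finset.Icc 1 M ∧ G.card = 2 * k ∧ HasEvenBlocks G ∧
    (Y = insert 0 (G ∪ Finset.Icc (M + 1) N) ∨
      ((∀ i ∈ G, a < i) ∧ Y = insert a (G ∪ Finset.Icc (M + 1) N)))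

theorem IsIsolated.mono {F G : Finset ℕ} (hG : IsIsolated G) (h : F ⊆ G) : IsIsolated F :=
  fun i hi hi' => hG i (h hi) (h hi')

theorem IsSmallMissingFace.card_eq {k a M : ℕ} {F : Finset ℕ} (hF : IsSmallMissingFace k a M F) :
    F.card = k + 1 ∨ F.card = k + 2 := by
  rcases hF with ⟨F', rfl, h1, h2, -⟩ | ⟨-, h, -⟩
  · right
    rw [Finset.card_insert_of_notMem (fun h => by simpa using h1 h), h2]
  · exact Or.inl h

theorem IsSmallMissingFace.subset_range {k a M n : ℕ} {F : Finset ℕ}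
    (hF : IsSmallMissingFace k a M F) (hM : M < n) : F ⊆ Finset.range n := by
  have key : ∀ H : Finset ℕ, H ⊆ Finset.Icc 1 M → H ⊆ Finset.range n := fun H hH x hx => by
    have := hH hx
    simp at this ⊢
    omega
  rcases hF with ⟨F', rfl, h, -⟩ | ⟨h, -⟩
  · exact Finset.insert_subset (by simp; omega) (key _ h)
  · exact key _ h

theorem IsSmallMissingFace.eq_of_subset {k a M : ℕ} {F F' : Finset ℕ}
    (hF : IsSmallMissingFace k a M F) (hF' : IsSmallMissingFace k a M F') (h : F ⊆ F') :
    F = F' := by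
  rcases hF' with ⟨H, rfl, h1, h2, h3, h4⟩ | ⟨h1, h2, h3, h4⟩
  · have h0 : 0 ∉ H := fun h => by simpa using h1 h
    rcases hF with ⟨K, rfl, k1, k2, -⟩ | ⟨k1, k2, k3, k4⟩
    · apply Finset.eq_of_subset_of_card_le h
      rw [Finset.card_insert_of_notMem h0, Finset.card_insert_of_notMem, h2, k2]
      exact fun h => by simpa using k1 h
    · have hFH : F ⊆ H := fun x hx => by
        rcases Finset.mem_insert.1 (h hx) with rfl | h'
        · simpa using k1 hx
        · exact h'
      rw [Finset.eq_of_subset_of_card_le hFH (by omega)] at k4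
      exact absurd h4 k4
  · rcases hF with ⟨K, rfl, k1, k2, -⟩ | ⟨k1, k2, k3, k4⟩
    · have := h1 (h (Finset.mem_insert_self 0 K))
      simp at this
    · exact Finset.eq_of_subset_of_card_le h (by omega)

/-- A set of labels containing none of the small missing faces lies in a facet of the
triangulation. -/
theorem exists_isStackedFacet_superset {k a M N : ℕ} (ha : 1 ≤ a) (haM : a + 2 * k ≤ M + 1)
    {H : Finset ℕ} (hH : H ⊆ Finset.range (N + 1))
    (hmiss : ∀ F ⊆ H, ¬ IsSmallMissingFace k a M F) :
    ∃ Y, IsStackedFacet k a M N Y ∧ H ⊆ Y := by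
  set H' := H ∩ Finset.Icc 1 M with hH'
  have hsplit : ∀ x ∈ H, x = 0 ∨ x ∈ H' ∨ x ∈ Finset.Icc (M + 1) N := fun x hx => by
    have := hH hx
    simp only [hH', Finset.mem_inter, Finset.mem_Icc, Finset.mem_range] at *
    by_cases h0 : x = 0
    · exact Or.inl h0
    · by_cases hxM : x ≤ M
      · exact Or.inr (Or.inl ⟨hx, by omega, hxM⟩)
      · exact Or.inr (Or.inr (by omega))
  have hcase : ∀ F ⊆ H', F.card = k + 1 → IsIsolated F →
      0 ∉ H ∧ IsLeast (F : Set ℕ) a := by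
    intro F hF hc hi
    have hFM : F ⊆ Finset.Icc 1 M := hF.trans Finset.inter_subset_right
    have hFH : F ⊆ H := hF.trans Finset.inter_subset_left
    have hl : IsLeast (F : Set ℕ) a := by
      by_contra hl
      exact hmiss F hFH (Or.inr ⟨hFM, hc, hi, hl⟩)
    refine ⟨fun h0 => hmiss (insert 0 F) (Finset.insert_subset h0 hFH)
      (Or.inl ⟨F, rfl, hFM, hc, hi, hl⟩), hl⟩
  by_cases hiso : ∃ F ⊆ H', F.card = k + 1 ∧ IsIsolated F
  · obtain ⟨F, hF, hc, hi⟩ := hiso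
    obtain ⟨h0, haF, hle⟩ := hcase F hF hc hi
    have haF' : a ∈ F := by simpa using haF
    -- a label of `H'` before `a` could take the place of `a` in `F`
    have hge : ∀ x ∈ H', a ≤ x := by
      intro x hx
      by_contra hlt
      push Not at hlt
      have hxF : x ∉ F := fun h => by
        have := hle (Finset.mem_coe.2 h)
        omega
      have := hcase (insert x (F.erase a))
        (Finset.insert_subset hx ((Finset.erase_subset _ _).trans hF)) (by
          rw [Finset.card_insert_of_notMem (fun h => hxF (Finset.mem_of_mem_erase h)),
            Finset.card_erase_of_mem haF', hc]; rfl) (by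
          intro y hy hy'
          simp only [Finset.mem_insert, Finset.mem_erase] at hy hy'
          have hge' : ∀ z ∈ F, a ≤ z := fun z hz => hle (Finset.mem_coe.2 hz)
          rcases hy with rfl | ⟨_, hy⟩
          · rcases hy' with hy' | ⟨h1, h2⟩
            · omega
            · have := hge' _ h2; omega
          · rcases hy' with hy' | ⟨h1, h2⟩
            · have := hge' _ hy; omega
            · exact hi y hy h2)
      have := this.2.1
      simp at this
      omega
    have hH1 : ∀ F' ⊆ H'.erase a, IsIsolated F' → F'.card ≤ k := by
      intro F' hF' hi'
      by_contra hlt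
      push Not at hlt
      obtain ⟨F'', hF'', hc''⟩ := Finset.exists_subset_card_eq hlt
      have := (hcase F'' ((hF''.trans hF').trans (Finset.erase_subset _ _)) hc''
        (hi'.mono hF'')).2.1
      have := hF' (hF'' (Finset.mem_coe.1 this))
      simp at this
    have hH1s : H'.erase a ⊆ Finset.Icc (a + 1) M := fun x hx => by
      have h1 := hge x (Finset.mem_of_mem_erase hx)
      have h2 := (Finset.mem_inter.1 (Finset.mem_of_mem_erase hx)).2
      have h3 := Finset.ne_of_mem_erase hx
      simp only [Finset.mem_Icc] at *
      omega
    have hMa : 2 * k + (a + 1) ≤ M + 1 := by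
      by_contra hlt
      -- otherwise `F` would be an isolated set of size `k + 1` in an interval of length `2k`
      have hsub : F ∪ F.image (· + 1) ⊆ Finset.Icc a (M + 1) := by
        intro x hx
        rcases Finset.mem_union.1 hx with hx | hx
        · have h1 := hle (Finset.mem_coe.2 hx)
          have h2 := (Finset.mem_inter.1 (hF hx)).2
          simp only [Finset.mem_Icc] at *
          omega
        · obtain ⟨y, hy, rfl⟩ := Finset.mem_image.1 hx
          have h1 := hle (Finset.mem_coe.2 hy)
          have h2 := (Finset.mem_inter.1 (hF hy)).2
          simp only [Finset.mem_Icc] at *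
          omega
      have := Finset.card_le_card hsub
      rw [Finset.card_union_of_disjoint, Finset.card_image_of_injective _
        (add_left_injective 1), hc, Nat.card_Icc] at this
      · omega
      · rw [Finset.disjoint_left]
        intro x hx hx'
        obtain ⟨y, hy, rfl⟩ := Finset.mem_image.1 hx'
        exact hi y hy hx
    obtain ⟨G, g1, g2, g3, g4⟩ :=
      exists_hasEvenBlocks_superset (by omega : 1 ≤ a + 1) M k _ hH1s hMa hH1
    refine ⟨_, ⟨G, g1.trans (Finset.Icc_subset_Icc (by omega) le_rfl), g3, g4,
      Or.inr ⟨fun i hi => by have := g1 hi; simp at this; omega, rfl⟩⟩, fun x hx => ?_⟩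
    simp only [Finset.mem_insert, Finset.mem_union]
    rcases hsplit x hx with rfl | h | h
    · exact absurd hx h0
    · by_cases hxa : x = a
      · exact Or.inl hxa
      · exact Or.inr (Or.inl (g2 (Finset.mem_erase.2 ⟨hxa, h⟩)))
    · exact Or.inr (Or.inr h)
  · obtain ⟨G, g1, g2, g3, g4⟩ := exists_hasEvenBlocks_superset le_rfl M k H'
      Finset.inter_subset_right (by omega) (fun F hF hi => by
        by_contra hlt
        push Not at hlt
        obtain ⟨F'', hF'', hc''⟩ := Finset.exists_subset_card_eq hlt
        exact hiso ⟨F'', hF''.trans hF, hc'', hi.mono hF''⟩)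
    refine ⟨_, ⟨G, g1, g3, g4, Or.inl rfl⟩, fun x hx => ?_⟩
    simp only [Finset.mem_insert, Finset.mem_union]
    rcases hsplit x hx with rfl | h | h
    · exact Or.inl rfl
    · exact Or.inr (Or.inl (g2 h))
    · exact Or.inr (Or.inr h)

/-! ### Vector configurations with heights -/

section Heights

variable {A : Type*} [AddCommGroup A] [Module ℝ A]

theorem LinearIndepOn.exists_dual_eq {u : ℕ → A} {B : Finset ℕ}
    (hB : LinearIndepOn ℝ u (B : Set ℕ)) (b : ℕ → ℝ) :
    ∃ f : A →ₗ[ℝ] ℝ, ∀ i ∈ B, f (u i) = b i := by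
  have hB' : LinearIndependent ℝ (fun i : (B : Set ℕ) => u i) := hB
  obtain ⟨f, hf⟩ := LinearMap.exists_extend ((Module.Basis.span hB').constr ℝ fun i => b i)
  refine ⟨f, fun i hi => ?_⟩
  have h1 := (Module.Basis.span hB').constr_basis ℝ (fun i => b i) ⟨i, hi⟩
  rw [← hf] at h1
  rw [LinearMap.comp_apply, Submodule.subtype_apply, Module.Basis.span_apply] at h1
  exact h1

theorem insert_zero_Icc (N : ℕ) : insert 0 (Finset.Icc 1 N) = Finset.range (N + 1) := by
  ext i
  simp
  omega

theorem sum_range_succ_eq_Icc {β : Type*} [AddCommMonoid β] (N : ℕ) (g : ℕ → β) :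
    ∑ i ∈ Finset.range (N + 1), g i = g 0 + ∑ i ∈ Finset.Icc 1 N, g i := by
  rw [← insert_zero_Icc, Finset.sum_insert (by simp)]

theorem abs_sum_mul_le_of_forall {ι : Type*} (s : Finset ι) (b w : ι → ℝ) {ε : ℝ}
    (h : ∀ i ∈ s, |w i| ≤ ε) : |∑ i ∈ s, b i * w i| ≤ (∑ i ∈ s, |b i|) * ε := by
  rw [Finset.sum_mul]
  refine (Finset.abs_sum_le_sum_abs _ _).trans (Finset.sum_le_sum fun i hi => ?_)
  rw [abs_mul]
  exact mul_le_mul_of_nonneg_left (h i hi) (abs_nonneg _)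

/-- A vector lifted to a height that dominates the heights of an independent family is independent
of that lifted family. -/
theorem eventually_linearIndepOn_insert (u : ℕ → A) (B : Finset ℕ) (i₀ : ℕ) (hi₀ : i₀ ∉ B)
    (hB : LinearIndepOn ℝ u (B : Set ℕ)) :
    ∀ᶠ R : ℝ in Filter.atTop, ∀ w : ℕ → ℝ, w i₀ ≠ 0 → (∀ j ∈ B, R * |w j| ≤ |w i₀|) →
      LinearIndepOn ℝ (fun i => (w i, u i)) ((insert i₀ B : Finset ℕ) : Set ℕ) := by
  by_cases hspan : u i₀ ∈ Submodule.span ℝ (u '' (B : Set ℕ))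
  · obtain ⟨β, hβ⟩ := (Submodule.mem_span_image_finset_iff_exists_fun' ℝ).1 hspan
    filter_upwards [Filter.eventually_gt_atTop (0 : ℝ),
      Filter.eventually_gt_atTop (∑ j ∈ B, |β j|)] with R hR0 hR w hw hdom
    rw [linearIndepOn_finset_iff] at hB ⊢
    intro g hg
    rw [Finset.sum_insert hi₀] at hg
    have h1 := congrArg Prod.fst hg
    have h2 := congrArg Prod.snd hg
    simp only [Prod.fst_add, Prod.snd_add, Prod.fst_sum, Prod.snd_sum, Prod.smul_fst,
      Prod.smul_snd, Prod.fst_zero, Prod.snd_zero, smul_eq_mul] at h1 h2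
    have h3 : ∀ j ∈ B, g i₀ * β j + g j = 0 := hB _ (by
      rw [← hβ, Finset.smul_sum, ← Finset.sum_add_distrib] at h2
      rw [← h2]
      exact Finset.sum_congr rfl fun j _ => by rw [add_smul, mul_smul])
    have h4 : g i₀ * (w i₀ - ∑ j ∈ B, β j * w j) = 0 := by
      rw [← h1, mul_sub, Finset.mul_sum, sub_eq_add_neg, ← Finset.sum_neg_distrib]
      congr 1
      refine Finset.sum_congr rfl fun j hj => ?_
      linear_combination - w j * h3 j hj
    have h5 : |∑ j ∈ B, β j * w j| < |w i₀| := by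
      have hw' : 0 < |w i₀| := abs_pos.2 hw
      refine (abs_sum_mul_le_of_forall B β w (ε := |w i₀| / R) fun j hj => ?_).trans_lt ?_
      · rw [le_div_iff₀ hR0, mul_comm]
        exact hdom j hj
      · rw [mul_div_assoc', div_lt_iff₀ hR0]
        nlinarith
    have h6 : g i₀ = 0 := by
      rcases mul_eq_zero.1 h4 with h | h
      · exact h
      · rw [← sub_eq_zero.1 h] at h5
        exact absurd h5 (lt_irrefl _)
    intro i hi
    rcases Finset.mem_insert.1 hi with rfl | hi
    · exact h6
    · simpa [h6] using h3 i hi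
  · refine Filter.Eventually.of_forall fun R w _ _ => ?_
    have : LinearIndepOn ℝ u ((insert i₀ B : Finset ℕ) : Set ℕ) := by
      rw [Finset.coe_insert]
      exact hB.insert hspan
    exact LinearIndependent.of_comp (LinearMap.snd ℝ ℝ A) this

/-- A functional vanishing exactly on an independent family `B` can be tilted so as to vanish
also at the apex `0`, if the height of the apex is large. -/
theorem eventually_exists_tilt (u : ℕ → A) (N : ℕ) (B : Finset ℕ)
    (hB : LinearIndepOn ℝ u (B : Set ℕ)) (hBN : B ⊆ Finset.Icc 1 N) (f₀ : A →ₗ[ℝ] ℝ)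
    (h0 : ∀ i ∈ B, f₀ (u i) = 0) (hpos : ∀ i ∈ Finset.Icc 1 N, i ∉ B → 0 < f₀ (u i)) :
    ∀ᶠ R : ℝ in Filter.atTop, ∀ w : ℕ → ℝ, 0 < w 0 → (∀ i ∈ Finset.Icc 1 N, R * |w i| ≤ w 0) →
      ∃ (c : ℝ) (f : A →ₗ[ℝ] ℝ), (∀ i ∈ insert 0 B, c * w i + f (u i) = 0) ∧
        ∀ i ∈ Finset.Icc 1 N, i ∉ B → 0 < c * w i + f (u i) := by
  choose e he using fun j : ℕ => hB.exists_dual_eq (fun i => if i = j then (1 : ℝ) else 0)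
  set K : ℝ := ∑ i ∈ Finset.range (N + 1), ∑ j ∈ B, |e j (u i)| with hK
  have hK0 : 0 ≤ K := Finset.sum_nonneg fun i _ => Finset.sum_nonneg fun j _ => abs_nonneg _
  have hKi : ∀ i ∈ Finset.range (N + 1), ∑ j ∈ B, |e j (u i)| ≤ K := fun i hi =>
    Finset.single_le_sum (f := fun i => ∑ j ∈ B, |e j (u i)|)
      (fun i _ => Finset.sum_nonneg fun j _ => abs_nonneg _) hi
  have hev : ∀ᶠ R : ℝ in Filter.atTop, ∀ i ∈ Finset.Icc 1 N, i ∉ B →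
      2 * |f₀ (u 0)| * (1 + K) / f₀ (u i) < R := by
    rw [Filter.eventually_all_finset]
    exact fun i _ => (Filter.eventually_gt_atTop _).mono fun R hR _ => hR
  filter_upwards [hev, Filter.eventually_gt_atTop (0 : ℝ), Filter.eventually_ge_atTop (2 * K)] with
    R hR hR0 hRK w hw0 hdom
  have hdom' : ∀ i ∈ Finset.Icc 1 N, |w i| ≤ w 0 / R := fun i hi => by
    rw [le_div_iff₀ hR0, mul_comm]; exact hdom i hi
  set f₁ : A →ₗ[ℝ] ℝ := ∑ j ∈ B, w j • e j with hf₁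
  have hf₁v : ∀ x, f₁ x = ∑ j ∈ B, e j x * w j := fun x => by
    simp [hf₁, LinearMap.sum_apply, mul_comm]
  have hf₁B : ∀ i ∈ B, f₁ (u i) = w i := fun i hi => by
    rw [hf₁v, Finset.sum_congr rfl (fun j _ => by rw [he j i hi])]
    simp [hi]
  have hf₁le : ∀ i ∈ Finset.range (N + 1), |f₁ (u i)| ≤ K * (w 0 / R) := fun i hi => by
    rw [hf₁v]
    refine (abs_sum_mul_le_of_forall B _ w (fun j hj => hdom' j (hBN hj))).trans ?_
    exact mul_le_mul_of_nonneg_right (hKi i hi) (by positivity)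
  have hhalf : K * (w 0 / R) ≤ w 0 / 2 := by
    rw [mul_div_assoc', div_le_div_iff₀ hR0 two_pos]
    nlinarith
  have hden : w 0 / 2 ≤ w 0 - f₁ (u 0) := by
    have := (le_abs_self _).trans (hf₁le 0 (by simp))
    linarith
  have hden0 : 0 < w 0 - f₁ (u 0) := by linarith
  set c : ℝ := -f₀ (u 0) / (w 0 - f₁ (u 0)) with hc
  have hcle : |c| ≤ 2 * |f₀ (u 0)| / w 0 := by
    rw [hc, abs_div, abs_neg, abs_of_pos hden0, div_le_div_iff₀ hden0 hw0]
    nlinarith [abs_nonneg (f₀ (u 0))]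
  refine ⟨c, f₀ - c • f₁, fun i hi => ?_, fun i hi hiB => ?_⟩
  · rcases Finset.mem_insert.1 hi with rfl | hi
    · simp only [LinearMap.sub_apply, LinearMap.smul_apply, smul_eq_mul, hc]
      field_simp
      ring
    · simp [hf₁B i hi, h0 i hi]
  · have hb : |c * (w i - f₁ (u i))| ≤ 2 * |f₀ (u 0)| * (1 + K) / R := by
      rw [abs_mul]
      have h1 : |w i - f₁ (u i)| ≤ (1 + K) * (w 0 / R) := by
        refine (abs_sub _ _).trans ?_
        have := hdom' i hi
        have := hf₁le i (by simp at hi ⊢; omega)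
        linarith
      refine (mul_le_mul hcle h1 (abs_nonneg _) (by positivity)).trans (le_of_eq ?_)
      field_simp
    have h2 : 2 * |f₀ (u 0)| * (1 + K) / R < f₀ (u i) := by
      have := hR i hi hiB
      rw [div_lt_iff₀ (hpos i hi hiB)] at this
      rw [div_lt_iff₀ hR0]
      linarith
    simp only [LinearMap.sub_apply, LinearMap.smul_apply, smul_eq_mul]
    have := (abs_le.1 hb).1
    linarith

/-- If all labels but `a` have nonnegative height and the height of `a` is negative, then a
nonnegative functional which is positive at `a` can be tilted so as to vanish at `a`, provided
that the apex `0` is high enough. -/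
theorem eventually_exists_tilt_of_neg (u : ℕ → A) (N a : ℕ) (B : Finset ℕ) (f₀ : A →ₗ[ℝ] ℝ)
    (h0 : ∀ i ∈ B, f₀ (u i) = 0) (hnonneg : ∀ i ∈ Finset.Icc 1 N, 0 ≤ f₀ (u i))
    (hfa : 0 < f₀ (u a)) :
    ∀ᶠ R : ℝ in Filter.atTop, ∀ w : ℕ → ℝ, w a < 0 → R * |w a| < w 0 → (∀ i ∈ B, w i = 0) →
      (∀ i ∈ Finset.Icc 1 N, i ≠ a → 0 ≤ w i) →
      ∃ (c : ℝ) (f : A →ₗ[ℝ] ℝ), (∀ i ∈ insert a B, c * w i + f (u i) = 0) ∧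
        (∀ i ∈ Finset.Icc 1 N, 0 ≤ c * w i + f (u i)) ∧ 0 < c * w 0 + f (u 0) := by
  filter_upwards [Filter.eventually_gt_atTop (|f₀ (u 0)| / f₀ (u a))] with R hR w hwa hw0 hwB hw
  have hc : 0 < f₀ (u a) / |w a| := div_pos hfa (abs_pos.2 hwa.ne)
  have hca : f₀ (u a) / |w a| * w a + f₀ (u a) = 0 := by
    rw [abs_of_neg hwa, div_neg, neg_mul, div_mul_cancel₀ _ hwa.ne]
    ring
  refine ⟨f₀ (u a) / |w a|, f₀, fun i hi => ?_, fun i hi => ?_, ?_⟩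
  · rcases Finset.mem_insert.1 hi with rfl | hi
    · exact hca
    · rw [hwB i hi, h0 i hi]; simp
  · by_cases hia : i = a
    · rw [hia]; exact hca.ge
    · exact add_nonneg (mul_nonneg hc.le (hw i hi hia)) (hnonneg i hi)
  · have h1 : f₀ (u a) / |w a| * (R * |w a|) < f₀ (u a) / |w a| * w 0 :=
      mul_lt_mul_of_pos_left hw0 hc
    have h2 : f₀ (u a) / |w a| * (R * |w a|) = f₀ (u a) * R := by
      have := abs_pos.2 hwa.ne
      field_simp
    rw [div_lt_iff₀ hfa] at hR
    have := neg_abs_le (f₀ (u 0))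
    linarith

/-- A linear dependence among the vectors with positive label becomes, after a small change and with
the help of the apex `0`, a dependence among the lifted vectors. The coefficient of the apex
makes up for the total height of the original dependence. -/
theorem eventually_exists_lifted_dependence (u : ℕ → A) (N : ℕ) (δ₀ θ : ℕ → ℝ)
    (hδ₀ : ∑ i ∈ Finset.Icc 1 N, δ₀ i • u i = 0)
    (hθ : ∑ i ∈ Finset.Icc 1 N, θ i • u i = u 0) (hθ0 : ∀ i, δ₀ i = 0 → θ i = 0) :
    ∀ᶠ R : ℝ in Filter.atTop, ∀ w : ℕ → ℝ, 0 < w 0 → (∀ i ∈ Finset.Icc 1 N, R * |w i| ≤ w 0) →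
      ∃ δ : ℕ → ℝ, ∑ i ∈ Finset.range (N + 1), δ i • u i = 0 ∧
        ∑ i ∈ Finset.range (N + 1), δ i * w i = 0 ∧
        (∀ i ∈ Finset.Icc 1 N, 0 < δ₀ i → 0 < δ i) ∧
        (∀ i ∈ Finset.Icc 1 N, δ i < 0 → δ₀ i < 0) ∧
        (δ 0 < 0 → 0 < ∑ i ∈ Finset.Icc 1 N, δ₀ i * w i) := by
  set D : ℝ := ∑ i ∈ Finset.Icc 1 N, |δ₀ i| with hD
  set Θ : ℝ := ∑ i ∈ Finset.Icc 1 N, |θ i| with hΘ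
  have hD0 : 0 ≤ D := Finset.sum_nonneg fun i _ => abs_nonneg _
  have hΘ0 : 0 ≤ Θ := Finset.sum_nonneg fun i _ => abs_nonneg _
  have hev : ∀ᶠ R : ℝ in Filter.atTop, ∀ i ∈ Finset.Icc 1 N, 2 * D * |θ i| / |δ₀ i| < R := by
    rw [Filter.eventually_all_finset]
    exact fun i _ => Filter.eventually_gt_atTop _
  filter_upwards [hev, Filter.eventually_gt_atTop (0 : ℝ), Filter.eventually_ge_atTop (2 * Θ)] with
    R hR hR0 hRΘ w hw0 hdom
  have hdom' : ∀ i ∈ Finset.Icc 1 N, |w i| ≤ w 0 / R := fun i hi => by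
    rw [le_div_iff₀ hR0, mul_comm]; exact hdom i hi
  set h : ℝ := ∑ i ∈ Finset.Icc 1 N, δ₀ i * w i with hh
  have hhle : |h| ≤ D * (w 0 / R) := abs_sum_mul_le_of_forall _ _ _ hdom'
  have hθle : |∑ i ∈ Finset.Icc 1 N, θ i * w i| ≤ Θ * (w 0 / R) :=
    abs_sum_mul_le_of_forall _ _ _ hdom'
  have hhalf : Θ * (w 0 / R) ≤ w 0 / 2 := by
    rw [mul_div_assoc', div_le_div_iff₀ hR0 two_pos]
    nlinarith
  set den : ℝ := w 0 - ∑ i ∈ Finset.Icc 1 N, θ i * w i with hden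
  have hden2 : w 0 / 2 ≤ den := by
    have := (le_abs_self _).trans hθle
    linarith
  have hden0 : 0 < den := by linarith
  set s : ℝ := h / den with hs
  have hsle : |s| ≤ 2 * D / R := by
    rw [hs, abs_div, abs_of_pos hden0, div_le_div_iff₀ hden0 hR0]
    have h1 : |h| * R ≤ D * w 0 := by
      calc |h| * R ≤ D * (w 0 / R) * R := mul_le_mul_of_nonneg_right hhle hR0.le
        _ = D * w 0 := by field_simp
    nlinarith
  have hsmall : ∀ i ∈ Finset.Icc 1 N, δ₀ i ≠ 0 → |s * θ i| < |δ₀ i| := fun i hi hne => by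
    have hpos : 0 < |δ₀ i| := abs_pos.2 hne
    have h1 := hR i hi
    rw [div_lt_iff₀ hpos] at h1
    rw [abs_mul]
    calc |s| * |θ i| ≤ 2 * D / R * |θ i| := mul_le_mul_of_nonneg_right hsle (abs_nonneg _)
      _ = 2 * D * |θ i| / R := by ring
      _ < |δ₀ i| := by rw [div_lt_iff₀ hR0]; linarith
  have hne0 : ∀ i ∈ Finset.Icc 1 N, (if i = 0 then -s else δ₀ i + s * θ i) = δ₀ i + s * θ i :=
    fun i hi => if_neg (by simp at hi; omega)
  refine ⟨fun i => if i = 0 then -s else δ₀ i + s * θ i, ?_, ?_, fun i hi hpos => ?_,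
    fun i hi hneg => ?_, fun hneg => ?_⟩
  · have h1 : ∑ i ∈ Finset.Icc 1 N, (if i = 0 then -s else δ₀ i + s * θ i) • u i
        = ∑ i ∈ Finset.Icc 1 N, (δ₀ i + s * θ i) • u i :=
      Finset.sum_congr rfl fun i hi => by rw [hne0 i hi]
    rw [sum_range_succ_eq_Icc, h1]
    simp only [if_true, add_smul, Finset.sum_add_distrib, hδ₀, mul_smul, ← Finset.smul_sum, hθ]
    simp
  · have h1 : ∑ i ∈ Finset.Icc 1 N, (if i = 0 then -s else δ₀ i + s * θ i) * w i
        = ∑ i ∈ Finset.Icc 1 N, (δ₀ i + s * θ i) * w i :=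
      Finset.sum_congr rfl fun i hi => by rw [hne0 i hi]
    rw [sum_range_succ_eq_Icc, h1]
    simp only [if_true, add_mul, Finset.sum_add_distrib, mul_assoc, ← Finset.mul_sum]
    rw [← hh]
    have : s * den = h := div_mul_cancel₀ _ hden0.ne'
    rw [hden] at this
    linear_combination -this
  · simp only [hne0 i hi]
    have h1 := hsmall i hi hpos.ne'
    rw [abs_of_pos hpos] at h1
    have := (abs_lt.1 h1).1
    linarith
  · simp only [hne0 i hi] at hneg
    by_contra hge
    push Not at hge
    rcases hge.eq_or_lt with h0 | h0
    · rw [← h0, hθ0 i h0.symm] at hneg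
      simp at hneg
    · have h1 := hsmall i hi h0.ne'
      rw [abs_of_pos h0] at h1
      have := (abs_lt.1 h1).1
      linarith
  · simp only [if_true] at hneg
    have : 0 < s := by linarith
    rw [hs] at this
    by_contra hle
    push Not at hle
    exact absurd this (not_lt.2 (div_nonpos_of_nonpos_of_nonneg hle hden0.le))

end Heights

/-! ### Functionals and dependences given by polynomials -/

/-- If an even number of the nodes `t j`, `j ∈ J`, lies to the right of `t s`, then
`∏ j ∈ J, (t s - t j)` is positive. -/
theorem prod_sub_pos_of_even {ι : Type*} [LinearOrder ι] {t : ι → ℝ} {S : Set ι}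
    (ht : StrictMonoOn t S) {J : Finset ι} (hJ : ∀ j ∈ J, j ∈ S) {s : ι} (hs : s ∈ S)
    (hsJ : s ∉ J) (heven : Even (J.filter (fun j => s < j)).card) :
    0 < ∏ j ∈ J, (t s - t j) := by
  rw [← Finset.prod_filter_mul_prod_filter_not J (fun j => s < j)]
  refine mul_pos ?_ (Finset.prod_pos fun j hj => ?_)
  · have hneg : ∏ j ∈ J with s < j, (t s - t j) = ∏ j ∈ J with s < j, (t j - t s) := by
      calc _ = ∏ j ∈ J with s < j, (-1) * (t j - t s) :=
            Finset.prod_congr rfl fun j _ => by ring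
        _ = _ := by
            rw [Finset.prod_mul_distrib, Finset.prod_const, heven.neg_one_pow, one_mul]
    rw [hneg]
    refine Finset.prod_pos fun j hj => ?_
    rw [Finset.mem_filter] at hj
    have := ht hs (hJ j hj.1) hj.2
    linarith
  · rw [Finset.mem_filter, not_lt] at hj
    have hne : j ≠ s := fun h => hsJ (h ▸ hj.1)
    have := ht (hJ j hj.1) hs (lt_of_le_of_ne hj.2 hne)
    linarith

/-- A vector configuration with the linear dependences of the (homogenized) vertices
of a McMullen–Walkup polytope: the vectors with label at most `M` come from points on the moment
curve with parameters `t`, and the vectors with label in `[M + 1, N]` come from a simplex; the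
combination with weights `l` of the latter is the point on the moment curve with parameter
`t (M + 1)`. -/
structure IsMomentConfig {A : Type*} [AddCommGroup A] [Module ℝ A] (k M N : ℕ)
    (t l : ℕ → ℝ) (u : ℕ → A) : Prop where
  strictMonoOn : StrictMonoOn t (Set.Icc 1 (M + 1))
  pos : ∀ j ∈ Finset.Icc (M + 1) N, 0 < l j
  indep : ∀ G ⊆ Finset.Icc 1 M, G.card = 2 * k →
    LinearIndepOn ℝ u ((G ∪ Finset.Icc (M + 1) N : Finset ℕ) : Set ℕ)
  span : ∀ G ⊆ Finset.Icc 1 M, G.card = 2 * k →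
    Submodule.span ℝ (u '' ((G ∪ Finset.Icc (M + 1) N : Finset ℕ) : Set ℕ)) = ⊤
  poly : ∀ f : A →ₗ[ℝ] ℝ, ∃ g : Polynomial ℝ, g.natDegree ≤ 2 * k ∧
    (∀ i ∈ Finset.Icc 1 M, f (u i) = g.eval (t i)) ∧
    ∑ j ∈ Finset.Icc (M + 1) N, l j * f (u j) = g.eval (t (M + 1))

namespace IsMomentConfig

variable {A : Type*} [AddCommGroup A] [Module ℝ A] {k M N : ℕ} {t l : ℕ → ℝ} {u : ℕ → A}

theorem injOn (h : IsMomentConfig k M N t l u) {J : Finset ℕ} (hJ : J ⊆ Finset.Icc 1 (M + 1)) :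
    Set.InjOn t (J : Set ℕ) :=
  h.strictMonoOn.injOn.mono fun i hi => by simpa using hJ hi

theorem Icc_subset_Icc_succ {G : Finset ℕ} (hG : G ⊆ Finset.Icc 1 M) :
    G ⊆ Finset.Icc 1 (M + 1) := hG.trans (Finset.Icc_subset_Icc le_rfl (by omega))

/-- A polynomial of degree at most `2k` and compatible values on the simplex determine a
functional. -/
theorem exists_functional (h : IsMomentConfig k M N t l u) (hM : 2 * k ≤ M)
    (g : Polynomial ℝ) (hg : g.natDegree ≤ 2 * k) (b : ℕ → ℝ)
    (hb : ∑ j ∈ Finset.Icc (M + 1) N, l j * b j = g.eval (t (M + 1))) :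
    ∃ f : A →ₗ[ℝ] ℝ, (∀ i ∈ Finset.Icc 1 M, f (u i) = g.eval (t i)) ∧
      ∀ j ∈ Finset.Icc (M + 1) N, f (u j) = b j := by
  have hG : Finset.Icc 1 (2 * k) ⊆ Finset.Icc 1 M := Finset.Icc_subset_Icc le_rfl hM
  obtain ⟨f, hf⟩ := (h.indep _ hG (by simp)).exists_dual_eq
    (fun i => if i ≤ M then g.eval (t i) else b i)
  have hfb : ∀ j ∈ Finset.Icc (M + 1) N, f (u j) = b j := fun j hj => by
    rw [hf j (Finset.mem_union_right _ hj), if_neg (by simp at hj; omega)]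
  obtain ⟨g', hg', h1, h2⟩ := h.poly f
  have hgg : g' = g := by
    have hins : insert (M + 1) (Finset.Icc 1 (2 * k)) ⊆ Finset.Icc 1 (M + 1) :=
      Finset.insert_subset (by simp) (Icc_subset_Icc_succ hG)
    have hc : (insert (M + 1) (Finset.Icc 1 (2 * k))).card = 2 * k + 1 := by
      rw [Finset.card_insert_of_notMem (by simp; omega)]; simp
    have hdeg : ∀ p : Polynomial ℝ, p.natDegree ≤ 2 * k →
        p.degree < (insert (M + 1) (Finset.Icc 1 (2 * k))).card := fun p hp => by
      rw [hc]
      exact Polynomial.degree_le_natDegree.trans_lt (by exact_mod_cast (by omega))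
    refine Polynomial.eq_of_degrees_lt_of_eval_index_eq _ (h.injOn hins) (hdeg _ hg') (hdeg _ hg)
      fun i hi => ?_
    rcases Finset.mem_insert.1 hi with rfl | hi
    · rw [← h2, ← hb]
      exact Finset.sum_congr rfl fun j hj => by rw [hfb j hj]
    · rw [← h1 i (hG hi), hf i (Finset.mem_union_left _ hi),
        if_pos (by have := hG hi; simp at this; omega)]
  exact ⟨f, fun i hi => by rw [h1 i hi, hgg], hfb⟩

/-- The facets of the polytope without `x`: a facet of the cyclic polytope together with
a facet of the simplex. -/
theorem exists_facet_functional (h : IsMomentConfig k M N t l u) (hM : 2 * k ≤ M)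
    {G : Finset ℕ} (hG : G ⊆ Finset.Icc 1 M) (hc : G.card = 2 * k) (heven : HasEvenBlocks G)
    {j : ℕ} (hj : j ∈ Finset.Icc (M + 1) N) :
    ∃ f : A →ₗ[ℝ] ℝ, (∀ i ∈ G ∪ (Finset.Icc (M + 1) N).erase j, f (u i) = 0) ∧
      ∀ i ∈ Finset.Icc 1 N, i ∉ G ∪ (Finset.Icc (M + 1) N).erase j → 0 < f (u i) := by
  set g : Polynomial ℝ := ∏ i ∈ G, (Polynomial.X - Polynomial.C (t i)) with hg
  have hgdeg : g.natDegree ≤ 2 * k := by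
    rw [hg, Polynomial.natDegree_prod_of_monic _ _ fun i _ => Polynomial.monic_X_sub_C _]
    simp [hc]
  have heval : ∀ s, g.eval s = ∏ i ∈ G, (s - t i) := fun s => by
    simp [hg, Polynomial.eval_prod]
  have hGpos : ∀ s ∈ Finset.Icc 1 (M + 1), s ∉ G → 0 < g.eval (t s) := fun s hs hsG => by
    rw [heval]
    exact prod_sub_pos_of_even h.strictMonoOn
      (fun i hi => by simpa using Icc_subset_Icc_succ hG hi) (by simpa using hs) hsG
      (heven.even_card_filter hsG)
  have hx : 0 < g.eval (t (M + 1)) :=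
    hGpos _ (by simp) fun h' => by have := hG h'; simp at this
  obtain ⟨f, hf1, hf2⟩ := h.exists_functional hM g hgdeg
    (fun i => if i = j then g.eval (t (M + 1)) / l j else 0) (by
      have := (h.pos j hj).ne'
      rw [Finset.sum_eq_single j (fun i _ hij => by simp [hij]) (fun h' => absurd hj h')]
      simp only [if_true]
      field_simp)
  refine ⟨f, fun i hi => ?_, fun i hi hi' => ?_⟩
  · rcases Finset.mem_union.1 hi with hi | hi
    · rw [hf1 i (hG hi), heval]
      exact Finset.prod_eq_zero hi (sub_self _)
    · rw [hf2 i (Finset.mem_of_mem_erase hi), if_neg (Finset.ne_of_mem_erase hi)]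
  · rw [Finset.mem_union, not_or, Finset.mem_erase, not_and] at hi'
    by_cases hiM : i ≤ M
    · have hi1 : i ∈ Finset.Icc 1 M := by simp at hi ⊢; omega
      rw [hf1 i hi1]
      exact hGpos i (by simp at hi ⊢; omega) hi'.1
    · have hi1 : i ∈ Finset.Icc (M + 1) N := by simp at hi ⊢; omega
      have hij : i = j := by
        by_contra hij
        exact hi'.2 hij hi1
      rw [hf2 i hi1, if_pos hij]
      exact div_pos hx (h.pos j hj)

/-- The simplex and any `k - 1` further vertices span a face: this is witnessed by the polynomial
`(t (M + 1) - X) * ∏ i ∈ G, (X - t i) ^ 2`. -/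
theorem exists_face_functional (h : IsMomentConfig k M N t l u) (hM : 2 * k ≤ M)
    {G : Finset ℕ} (hG : G ⊆ Finset.Icc 1 M) (hc : G.card + 1 ≤ k) :
    ∃ f : A →ₗ[ℝ] ℝ, (∀ i ∈ G ∪ Finset.Icc (M + 1) N, f (u i) = 0) ∧
      ∀ i ∈ Finset.Icc 1 N, i ∉ G ∪ Finset.Icc (M + 1) N → 0 < f (u i) := by
  set g : Polynomial ℝ := (Polynomial.C (t (M + 1)) - Polynomial.X) *
    ∏ i ∈ G, (Polynomial.X - Polynomial.C (t i)) ^ 2 with hg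
  have hgdeg : g.natDegree ≤ 2 * k := by
    refine Polynomial.natDegree_mul_le.trans ?_
    have h1 : (Polynomial.C (t (M + 1)) - Polynomial.X : Polynomial ℝ).natDegree ≤ 1 :=
      (Polynomial.natDegree_sub_le _ _).trans (by simp)
    have h2 : (∏ i ∈ G, (Polynomial.X - Polynomial.C (t i)) ^ 2).natDegree ≤ 2 * G.card := by
      rw [Polynomial.natDegree_prod_of_monic _ _ fun i _ => (Polynomial.monic_X_sub_C _).pow 2]
      simp [Polynomial.natDegree_pow, mul_comm]
    omega
  have heval : ∀ s, g.eval s = (t (M + 1) - s) * ∏ i ∈ G, (s - t i) ^ 2 := fun s => by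
    simp [hg, Polynomial.eval_prod]
  obtain ⟨f, hf1, hf2⟩ := h.exists_functional hM g hgdeg (fun _ => 0) (by simp [heval])
  refine ⟨f, fun i hi => ?_, fun i hi hi' => ?_⟩
  · rcases Finset.mem_union.1 hi with hi | hi
    · rw [hf1 i (hG hi), heval, Finset.prod_eq_zero hi (by simp), mul_zero]
    · exact hf2 i hi
  · rw [Finset.mem_union, not_or] at hi'
    have hi1 : i ∈ Finset.Icc 1 M := by
      have := hi'.2
      simp only [Finset.mem_Icc] at *
      omega
    rw [hf1 i hi1, heval]
    have hmem : i ∈ Set.Icc 1 (M + 1) := by simpa using Icc_subset_Icc_succ subset_rfl hi1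
    refine mul_pos (sub_pos.2 (h.strictMonoOn hmem (by simp) (by simp at hi1; omega)))
      (Finset.prod_pos fun j hj => ?_)
    have hne : t i ≠ t j := fun he => by
      have := h.strictMonoOn.injOn hmem (by simpa using Icc_subset_Icc_succ hG hj) he
      exact hi'.1 (this ▸ hj)
    exact even_two.pow_pos (sub_ne_zero.2 hne)

/-- A functional which is nonnegative on the simplex and small at `2k + 1` of the other vertices is
small everywhere. -/
theorem exists_bound (h : IsMomentConfig k M N t l u) {G : Finset ℕ} (hG : G ⊆ Finset.Icc 1 M)
    (hc : G.card = 2 * k + 1) (z : A) :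
    ∃ C : ℝ, ∀ (f : A →ₗ[ℝ] ℝ) (ε : ℝ), (∀ j ∈ Finset.Icc (M + 1) N, 0 ≤ f (u j)) →
      (∀ i ∈ G, |f (u i)| ≤ ε) → |f z| ≤ C * ε := by
  obtain ⟨G', hG'G, hG'⟩ := Finset.exists_subset_card_eq (show 2 * k ≤ G.card by omega)
  have hz : z ∈ Submodule.span ℝ (u '' ((G' ∪ Finset.Icc (M + 1) N : Finset ℕ) : Set ℕ)) := by
    rw [h.span G' (hG'G.trans hG) hG']; trivial
  obtain ⟨β, hβ⟩ := (Submodule.mem_span_image_finset_iff_exists_fun' ℝ).1 hz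
  set K : ℝ := ∑ i ∈ G, |(Lagrange.basis G t i).eval (t (M + 1))| with hK
  have hK0 : 0 ≤ K := Finset.sum_nonneg fun i _ => abs_nonneg _
  set K' : ℝ := 1 + ∑ j ∈ Finset.Icc (M + 1) N, K / l j with hK'
  have hterm : ∀ j ∈ Finset.Icc (M + 1) N, 0 ≤ K / l j := fun j hj =>
    div_nonneg hK0 (h.pos j hj).le
  have hsum0 := Finset.sum_nonneg hterm
  refine ⟨(∑ i ∈ G' ∪ Finset.Icc (M + 1) N, |β i|) * K', fun f ε hf hfG => ?_⟩
  have hε : 0 ≤ ε := by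
    obtain ⟨i, hi⟩ := Finset.card_pos.1 (by omega : 0 < G.card)
    exact (abs_nonneg _).trans (hfG i hi)
  obtain ⟨g, hgdeg, hg1, hg2⟩ := h.poly f
  have hgx : g.eval (t (M + 1)) ≤ K * ε := by
    have hdeg : g.degree < G.card := by
      rw [hc]; exact Polynomial.degree_le_natDegree.trans_lt (by exact_mod_cast (by omega))
    rw [Lagrange.eq_interpolate (h.injOn (Icc_subset_Icc_succ hG)) hdeg,
      Lagrange.interpolate_apply, Polynomial.eval_finsetSum]
    refine (le_abs_self _).trans ?_
    have := abs_sum_mul_le_of_forall G (fun i => (Lagrange.basis G t i).eval (t (M + 1)))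
      (fun i => f (u i)) hfG
    refine le_trans (le_of_eq ?_) this
    congr 1
    refine Finset.sum_congr rfl fun i hi => ?_
    rw [hg1 i (hG hi), Polynomial.eval_mul, Polynomial.eval_C, mul_comm]
  have hfle : ∀ i ∈ G' ∪ Finset.Icc (M + 1) N, |f (u i)| ≤ K' * ε := fun i hi => by
    rcases Finset.mem_union.1 hi with hi | hi
    · refine (hfG i (hG'G hi)).trans ?_
      nlinarith
    · rw [abs_of_nonneg (hf i hi)]
      have h1 : l i * f (u i) ≤ K * ε := by
        refine le_trans ?_ hgx
        rw [← hg2]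
        exact Finset.single_le_sum (f := fun j => l j * f (u j))
          (fun j hj => mul_nonneg (h.pos j hj).le (hf j hj)) hi
      have h2 : f (u i) ≤ K / l i * ε := by
        rw [div_mul_eq_mul_div, le_div_iff₀ (h.pos i hi)]
        linarith
      have h3 := Finset.single_le_sum hterm hi
      nlinarith
  rw [← hβ, map_sum]
  simp only [map_smul, smul_eq_mul]
  rw [mul_assoc]
  exact abs_sum_mul_le_of_forall _ _ _ hfle

/-- The Radon partition of `2k + 2` points on the moment curve, the last of which is the point `x`
of the simplex: an isolated set `F` of `k + 1` labels, and the successors of its elements. -/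
theorem exists_dependence (h : IsMomentConfig k M N t l u) (hMN : M ≤ N) {F : Finset ℕ}
    (hF : F ⊆ Finset.Icc 1 M) (hc : F.card = k + 1) (hiso : IsIsolated F) :
    ∃ δ θ : ℕ → ℝ, ∑ i ∈ Finset.Icc 1 N, δ i • u i = 0 ∧
      ∑ i ∈ Finset.Icc 1 N, θ i • u i = u 0 ∧ (∀ i, δ i = 0 → θ i = 0) ∧
      (∀ i, δ i < 0 ↔ i ∈ F) ∧ (∀ j ∈ Finset.Icc (M + 1) N, 0 < δ j) ∧
      ∀ i, δ i ≠ 0 → ∃ f ∈ F, f ≤ i := by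
  have hne : F.Nonempty := Finset.card_pos.1 (by omega)
  obtain ⟨m, hmF, hmax⟩ := F.exists_max_image id hne
  simp only [id] at hmax
  have hFM : ∀ f ∈ F, 1 ≤ f ∧ f ≤ M := fun f hf => by simpa using hF hf
  -- the node paired with a label; the last label is paired with the point of the simplex
  set p : ℕ → ℕ := fun f => if f = m then M + 1 else f + 1 with hp
  have hpm : p m = M + 1 := by simp [hp]
  have hp1 : ∀ f ∈ F, f < p f := fun f hf => by
    have := hFM f hf
    simp only [hp]; split_ifs <;> omega
  have hp2 : ∀ f ∈ F, ∀ f' ∈ F, f < f' → p f < f' := fun f hf f' hf' hlt => by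
    have h1 := hmax f' hf'
    have h2 : f + 1 ≠ f' := fun h => hiso f hf (h ▸ hf')
    simp only [hp]; rw [if_neg (by omega)]; omega
  have hp3 : ∀ f ∈ F, p f ≤ M + 1 := fun f hf => by
    have := hFM f hf
    simp only [hp]; split_ifs <;> omega
  have hpinj : Set.InjOn p (F : Set ℕ) := fun f hf f' hf' he => by
    rw [Finset.mem_coe] at hf hf'
    rcases lt_trichotomy f f' with hlt | rfl | hlt
    · have := hp2 f hf f' hf' hlt; have := hp1 f' hf'; omega
    · rfl
    · have := hp2 f' hf' f hf hlt; have := hp1 f hf; omega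
  have hdisj : Disjoint F (F.image p) := by
    rw [Finset.disjoint_left]
    intro x hx hx'
    obtain ⟨f, hf, rfl⟩ := Finset.mem_image.1 hx'
    rcases lt_or_ge f (p f) with hlt | hge
    · have := hp2 f hf _ hx hlt; omega
    · have := hp1 f hf; omega
  set I := F ∪ F.image p with hI
  have hIc : I.card = 2 * k + 2 := by
    rw [hI, Finset.card_union_of_disjoint hdisj, Finset.card_image_of_injOn hpinj, hc]; omega
  have hIM : I ⊆ Finset.Icc 1 (M + 1) := fun x hx => by
    rcases Finset.mem_union.1 hx with hx | hx
    · have := hFM x hx; simp; omega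
    · obtain ⟨f, hf, rfl⟩ := Finset.mem_image.1 hx
      have := hFM f hf; have := hp1 f hf; have := hp3 f hf; simp; omega
  have hxI : M + 1 ∈ I := Finset.mem_union_right _ (Finset.mem_image.2 ⟨m, hmF, hpm⟩)
  have hlt : ∀ i ∈ I, ∀ j ∈ I, i < j → t i < t j := fun i hi j hj hij =>
    h.strictMonoOn (by simpa using hIM hi) (by simpa using hIM hj) hij
  have hFI : ∀ f ∈ F, f ∈ I := fun f hf => Finset.mem_union_left _ hf
  have hpI : ∀ f ∈ F, p f ∈ I := fun f hf =>
    Finset.mem_union_right _ (Finset.mem_image_of_mem p hf)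
  set ω : ℕ → ℝ := fun i => (∏ j ∈ I.erase i, (t i - t j))⁻¹ with hω
  -- the factors of the paired nodes are multiplied together
  have hprod : ∀ i ∈ I, ∏ j ∈ I.erase i, (t i - t j)
      = ∏ f ∈ F, ((if f = i then 1 else t i - t f) * (if p f = i then 1 else t i - t (p f))) := by
    intro i hi
    rw [Finset.prod_mul_distrib, ← Finset.prod_image (g := p)
      (f := fun j => if j = i then 1 else t i - t j) hpinj, ← Finset.prod_union hdisj,
      ← Finset.mul_prod_erase _ _ hi, if_pos rfl, one_mul]
    exact Finset.prod_congr rfl fun j hj => by rw [if_neg (Finset.ne_of_mem_erase hj)]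
  have hneg : ∀ i ∈ F, ω i < 0 := by
    intro i hi
    rw [hω, inv_lt_zero, hprod i (hFI i hi), ← Finset.mul_prod_erase _ _ hi]
    refine mul_neg_of_neg_of_pos ?_ (Finset.prod_pos fun f hf => ?_)
    · rw [if_pos rfl, one_mul, if_neg (hp1 i hi).ne']
      exact sub_neg.2 (hlt i (hFI i hi) _ (hpI i hi) (hp1 i hi))
    · obtain ⟨hfi, hf⟩ := Finset.mem_erase.1 hf
      rw [if_neg hfi]
      rcases lt_or_gt_of_ne hfi with h1 | h1
      · have h2 := hp2 f hf i hi h1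
        rw [if_neg h2.ne]
        exact mul_pos (sub_pos.2 (hlt f (hFI f hf) i (hFI i hi) h1))
          (sub_pos.2 (hlt _ (hpI f hf) i (hFI i hi) h2))
      · have h2 : i < p f := h1.trans (hp1 f hf)
        rw [if_neg h2.ne']
        exact mul_pos_of_neg_of_neg (sub_neg.2 (hlt i (hFI i hi) f (hFI f hf) h1))
          (sub_neg.2 (hlt i (hFI i hi) _ (hpI f hf) h2))
  have hpos : ∀ e ∈ F, 0 < ω (p e) := by
    intro e he
    rw [hω, inv_pos, hprod _ (hpI e he)]
    refine Finset.prod_pos fun f hf => ?_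
    rcases lt_trichotomy f e with h1 | rfl | h1
    · have h2 := hp2 f hf e he h1
      have h3 := hp1 e he
      rw [if_neg (by omega), if_neg (by omega)]
      exact mul_pos (sub_pos.2 (hlt f (hFI f hf) _ (hpI e he) (by omega)))
        (sub_pos.2 (hlt _ (hpI f hf) _ (hpI e he) (by omega)))
    · have h3 := hp1 f hf
      rw [if_neg (by omega), if_pos rfl, mul_one]
      exact sub_pos.2 (hlt f (hFI f hf) _ (hpI f hf) h3)
    · have h2 := hp2 e he f hf h1
      have h3 := hp1 f hf
      rw [if_neg (by omega), if_neg (by omega)]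
      exact mul_pos_of_neg_of_neg (sub_neg.2 (hlt _ (hpI e he) f (hFI f hf) h2))
        (sub_neg.2 (hlt _ (hpI e he) _ (hpI f hf) (by omega)))
  have hx : 0 < ω (M + 1) := hpm ▸ hpos m hmF
  set δ : ℕ → ℝ := fun i => if i ≤ M then (if i ∈ I then ω i else 0) else
    if i ≤ N then ω (M + 1) * l i else 0 with hδ
  have hsplit : Finset.Icc 1 N = Finset.Icc 1 M ∪ Finset.Icc (M + 1) N := by
    ext i; simp only [Finset.mem_union, Finset.mem_Icc]; omega
  have hsd : Disjoint (Finset.Icc 1 M) (Finset.Icc (M + 1) N) := by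
    rw [Finset.disjoint_left]; intro i h1 h2; simp only [Finset.mem_Icc] at h1 h2; omega
  have hδT : ∀ j ∈ Finset.Icc (M + 1) N, δ j = ω (M + 1) * l j := fun j hj => by
    simp only [Finset.mem_Icc] at hj
    simp only [hδ]; rw [if_neg (by omega), if_pos hj.2]
  have hIe : I.erase (M + 1) ⊆ Finset.Icc 1 M := fun x hx => by
    have h1 := hIM (Finset.mem_of_mem_erase hx)
    have h2 := Finset.ne_of_mem_erase hx
    simp only [Finset.mem_Icc] at *
    omega
  have hdep : ∑ i ∈ Finset.Icc 1 N, δ i • u i = 0 := by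
    rw [← Module.forall_dual_apply_eq_zero_iff ℝ]
    intro f
    obtain ⟨g, hgdeg, hg1, hg2⟩ := h.poly f
    have hdeg : g.degree < I.card := by
      rw [hIc]; exact Polynomial.degree_le_natDegree.trans_lt (by exact_mod_cast (by omega))
    have hL := Lagrange.coeff_eq_sum (h.injOn hIM) hdeg
    rw [Polynomial.coeff_eq_zero_of_natDegree_lt (by omega), ← Finset.add_sum_erase _ _ hxI] at hL
    rw [map_sum, hsplit, Finset.sum_union hsd, hL, add_comm]
    congr 1
    · rw [div_eq_mul_inv, ← hg2, Finset.sum_mul]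
      refine Finset.sum_congr rfl fun j hj => ?_
      rw [map_smul, hδT j hj, smul_eq_mul]
      ring
    · rw [← Finset.sum_subset hIe]
      · refine Finset.sum_congr rfl fun j hj => ?_
        have hjM := hIe hj
        rw [map_smul, hg1 j hjM, smul_eq_mul, div_eq_mul_inv, mul_comm]
        simp only [hδ]
        rw [if_pos (by simp at hjM; omega), if_pos (Finset.mem_of_mem_erase hj)]
      · intro i hi hiI
        have hiM : i ≤ M := by simp at hi; omega
        have : i ∉ I := fun h' => hiI (Finset.mem_erase.2 ⟨by omega, h'⟩)
        simp [hδ, hiM, this]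
  obtain ⟨G', hG'I, hG'⟩ := Finset.exists_subset_card_eq
    (show 2 * k ≤ (I.erase (M + 1)).card by rw [Finset.card_erase_of_mem hxI, hIc]; omega)
  have hz : u 0 ∈ Submodule.span ℝ (u '' ((G' ∪ Finset.Icc (M + 1) N : Finset ℕ) : Set ℕ)) := by
    rw [h.span G' (hG'I.trans hIe) hG']; trivial
  obtain ⟨β, hβ⟩ := (Submodule.mem_span_image_finset_iff_exists_fun' ℝ).1 hz
  have hIω : ∀ i ∈ I, ω i ≠ 0 := fun i hi => by
    rcases Finset.mem_union.1 hi with hi | hi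
    · exact (hneg i hi).ne
    · obtain ⟨f, hf, rfl⟩ := Finset.mem_image.1 hi
      exact (hpos f hf).ne'
  refine ⟨δ, fun i => if i ∈ G' ∪ Finset.Icc (M + 1) N then β i else 0, hdep, ?_,
    fun i hi => ?_, fun i => ⟨fun hi => ?_, fun hi => ?_⟩, fun j hj => ?_, fun i hi => ?_⟩
  · rw [← hβ]
    simp only [ite_smul, zero_smul]
    rw [Finset.sum_ite_mem, Finset.inter_eq_right.2]
    rw [hsplit]
    exact Finset.union_subset_union_left (hG'I.trans hIe)
  · refine if_neg fun hmem => ?_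
    rcases Finset.mem_union.1 hmem with hmem | hmem
    · have h1 := hG'I hmem
      have h2 := hIe h1
      have h3 := Finset.mem_of_mem_erase h1
      simp only [hδ] at hi
      rw [if_pos (by simp at h2; omega), if_pos h3] at hi
      exact hIω i h3 hi
    · rw [hδT i hmem] at hi
      exact (mul_pos hx (h.pos i hmem)).ne' hi
  · simp only [hδ] at hi
    split_ifs at hi with h1 h2 h3
    · rcases Finset.mem_union.1 h2 with h2 | h2
      · exact h2
      · obtain ⟨f, hf, rfl⟩ := Finset.mem_image.1 h2
        exact absurd hi (hpos f hf).not_gt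
    · exact absurd hi (lt_irrefl _)
    · exact absurd hi (mul_pos hx (h.pos i (by simp; omega))).not_gt
    · exact absurd hi (lt_irrefl _)
  · simp only [hδ]
    rw [if_pos (hFM i hi).2, if_pos (hFI i hi)]
    exact hneg i hi
  · rw [hδT j hj]
    exact mul_pos hx (h.pos j hj)
  · simp only [hδ] at hi
    split_ifs at hi with h1 h2 h3
    · rcases Finset.mem_union.1 h2 with h2 | h2
      · exact ⟨i, h2, le_rfl⟩
      · obtain ⟨f, hf, rfl⟩ := Finset.mem_image.1 h2
        exact ⟨f, hf, (hp1 f hf).le⟩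
    · exact absurd rfl hi
    · exact ⟨m, hmF, by have := hFM m hmF; omega⟩
    · exact absurd rfl hi

end IsMomentConfig

/-! ### McMullen–Walkup polytopes -/

theorem mem_convexHull_image_finset_iff {E : Type*} [AddCommGroup E] [Module ℝ E] {V : ℕ → E}
    {F : Finset ℕ} {z : E} : z ∈ convexHull ℝ (V '' (F : Set ℕ)) ↔
      ∃ c : ℕ → ℝ, (∀ i ∈ F, 0 ≤ c i) ∧ ∑ i ∈ F, c i = 1 ∧ ∑ i ∈ F, c i • V i = z := by
  constructor
  · refine fun hz => convexHull_min (t := {z | ∃ c : ℕ → ℝ, (∀ i ∈ F, 0 ≤ c i) ∧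
      ∑ i ∈ F, c i = 1 ∧ ∑ i ∈ F, c i • V i = z}) ?_ ?_ hz
    · rintro _ ⟨i, hi, rfl⟩
      have hi : i ∈ F := hi
      refine ⟨fun j => if j = i then 1 else 0, fun j _ => by positivity, ?_, ?_⟩
      · simp [hi]
      · simp [hi, ite_smul]
    · rintro _ ⟨c, hc0, hc1, rfl⟩ _ ⟨e, he0, he1, rfl⟩ x y hx hy hxy
      refine ⟨fun i => x * c i + y * e i, fun i hi => ?_, ?_, ?_⟩
      · have := hc0 i hi; have := he0 i hi; positivity
      · rw [Finset.sum_add_distrib, ← Finset.mul_sum, ← Finset.mul_sum, hc1, he1]; linarith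
      · simp only [add_smul, Finset.sum_add_distrib, mul_smul, Finset.smul_sum]
  · rintro ⟨c, hc0, hc1, rfl⟩
    exact (convex_convexHull ℝ _).sum_mem hc0 hc1
      fun i hi => subset_convexHull ℝ _ ⟨i, hi, rfl⟩

theorem exists_add_smul_mem_intrinsicInterior {E : Type*} [NormedAddCommGroup E]
    [NormedSpace ℝ E] {s : Set E} {x e : E} (hx : x ∈ intrinsicInterior ℝ s)
    (he : e ∈ (affineSpan ℝ s).direction) : ∃ ε : ℝ, 0 < ε ∧ x + ε • e ∈ intrinsicInterior ℝ s := by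
  obtain ⟨y, hy, rfl⟩ := mem_intrinsicInterior.1 hx
  have hmem : ∀ r : ℝ, (y : E) + r • e ∈ affineSpan ℝ s := fun r => by
    rw [add_comm]
    exact AffineSubspace.vadd_mem_of_mem_direction (Submodule.smul_mem _ r he) y.2
  set c : ℝ → affineSpan ℝ s := fun r => ⟨(y : E) + r • e, hmem r⟩ with hc
  have hcont : Continuous c := by
    apply Continuous.subtype_mk
    fun_prop
  have h0 : c 0 = y := by ext; simp [hc]
  have hev : ∀ᶠ r in nhds (0 : ℝ), c r ∈ interior ((↑) ⁻¹' s : Set (affineSpan ℝ s)) :=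
    hcont.continuousAt.eventually (by rw [h0]; exact isOpen_interior.mem_nhds hy)
  obtain ⟨ε, hε, h⟩ := Metric.eventually_nhds_iff.1 hev
  refine ⟨ε / 2, by positivity, mem_intrinsicInterior.2 ⟨c (ε / 2), h ?_, rfl⟩⟩
  rw [Real.dist_eq, sub_zero, abs_of_pos (by positivity)]
  linarith

/-- A functional on `ℝ^K` is a polynomial of degree at most `K` along the moment curve. -/
theorem exists_polynomial_momentCurve (K : ℕ) (ψ : EuclideanSpace ℝ (Fin K) →ₗ[ℝ] ℝ) (r : ℝ) :
    ∃ g : Polynomial ℝ, g.natDegree ≤ K ∧ ∀ s, r + ψ (momentCurve K s) = g.eval s := by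
  refine ⟨Polynomial.C r + ∑ i : Fin K, Polynomial.C (ψ (EuclideanSpace.single i 1)) *
    Polynomial.X ^ ((i : ℕ) + 1), ?_, fun s => ?_⟩
  · refine (Polynomial.natDegree_add_le _ _).trans (max_le (by simp) ?_)
    exact Polynomial.natDegree_sum_le_of_forall_le _ _ fun i _ =>
      (Polynomial.natDegree_C_mul_X_pow_le _ _).trans (by omega)
  · have h1 : momentCurve K s =
        ∑ i : Fin K, s ^ ((i : ℕ) + 1) • EuclideanSpace.single i (1 : ℝ) := by
      ext j
      simp [momentCurve, Finset.sum_apply, Pi.single_apply]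
    rw [h1, map_sum]
    simp only [map_smul, smul_eq_mul, Polynomial.eval_add, Polynomial.eval_C,
      Polynomial.eval_finsetSum, Polynomial.eval_mul, Polynomial.eval_pow, Polynomial.eval_X]
    congr 1
    exact Finset.sum_congr rfl fun i _ => mul_comm _ _

/-- A combination of differences of points on the moment curve that vanishes gives a relation
between the values of every polynomial of degree at most `K`. -/
theorem sum_mul_eval_sub_eq_zero {K : ℕ} {G : Finset ℕ} {c t : ℕ → ℝ} {τ : ℝ}
    (h : ∑ i ∈ G, c i • (momentCurve K (t i) - momentCurve K τ) = 0)
    (g : Polynomial ℝ) (hg : g.natDegree ≤ K) :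
    ∑ i ∈ G, c i * (g.eval (t i) - g.eval τ) = 0 := by
  have hcoord : ∀ m, m ≤ K → ∑ i ∈ G, c i * (t i ^ m - τ ^ m) = 0 := by
    intro m hm
    rcases m with _ | m
    · simp
    · have := congrArg (fun x : EuclideanSpace ℝ (Fin K) => x ⟨m, by omega⟩) h
      simpa [momentCurve, Finset.sum_apply] using this
  simp only [Polynomial.eval_eq_sum_range' (Nat.lt_succ_of_le hg), ← Finset.sum_sub_distrib,
    ← mul_sub, Finset.mul_sum]
  rw [Finset.sum_comm]
  refine Finset.sum_eq_zero fun m hm => ?_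
  have := hcoord m (by simp at hm; omega)
  calc _ = g.coeff m * ∑ i ∈ G, c i * (t i ^ m - τ ^ m) := by
        rw [Finset.mul_sum]
        exact Finset.sum_congr rfl fun i _ => by ring
    _ = 0 := by rw [this, mul_zero]

theorem AffineIndependent.eq_of_sum_smul_eq {E : Type*} [AddCommGroup E] [Module ℝ E] {v : ℕ → E}
    {I : Finset ℕ} (h : AffineIndependent ℝ (fun i : (I : Set ℕ) => v i)) {c e : ℕ → ℝ}
    (h1 : ∑ i ∈ I, c i = ∑ i ∈ I, e i) (h2 : ∑ i ∈ I, c i • v i = ∑ i ∈ I, e i • v i) :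
    ∀ i ∈ I, c i = e i := by
  rw [affineIndependent_iff] at h
  intro i hi
  have := h Finset.univ (fun i => c i - e i) (by
      have := Finset.sum_coe_sort I (fun i => c i - e i)
      refine Eq.trans this ?_
      rw [Finset.sum_sub_distrib, h1, sub_self]) (by
      have := Finset.sum_coe_sort I (fun i => (c i - e i) • v i)
      refine Eq.trans this ?_
      simp only [sub_smul, Finset.sum_sub_distrib, h2, sub_self]) ⟨i, hi⟩ (Finset.mem_univ _)
  simpa [sub_eq_zero] using this

/-- The homogenized vertices of a McMullen–Walkup polytope, with an arbitrary additional point of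
label `0`. -/
theorem IsMWVertices.exists_isMomentConfig {k D N M : ℕ} (hM : M + 1 + D = N + 2 * k)
    (hD : 2 * k ≤ D) (hDN : D < N) {v : ℕ → EuclideanSpace ℝ (Fin D)}
    (hv : IsMWVertices (2 * k) D N v) (q : EuclideanSpace ℝ (Fin D)) :
    ∃ t l : ℕ → ℝ, IsMomentConfig k M N t l (fun i => ((1 : ℝ), if i = 0 then q else v i)) := by
  obtain ⟨t, φ, ht, hφ, hvφ, hind, hint⟩ := hv
  rw [show N - D + 2 * k = M + 1 by omega] at *
  set x := φ (momentCurve (2 * k) (t (M + 1))) with hx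
  have hsing : x ∈ intrinsicInterior ℝ (convexHull ℝ (v '' Set.Icc (M + 1) N)) ∩
      (affineSpan ℝ ((fun i => φ (momentCurve (2 * k) (t i))) '' Set.Icc 1 (M + 1)) :
        Set (EuclideanSpace ℝ (Fin D))) := by rw [hint]; rfl
  obtain ⟨hxT, hxC⟩ := hsing
  rw [show Set.Icc (M + 1) N = ((Finset.Icc (M + 1) N : Finset ℕ) : Set ℕ) by simp] at *
  set T := Finset.Icc (M + 1) N with hT
  obtain ⟨l, hl0, hl1, hlx⟩ := mem_convexHull_image_finset_iff.1 (intrinsicInterior_subset hxT)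
  have hspanT : affineSpan ℝ (convexHull ℝ (v '' (T : Set ℕ))) = affineSpan ℝ (v '' (T : Set ℕ)) :=
    affineSpan_convexHull _
  have hxaff : x ∈ affineSpan ℝ (v '' (T : Set ℕ)) := by
    rw [← hspanT]
    exact subset_affineSpan ℝ _ (intrinsicInterior_subset hxT)
  have hdirT : ∀ j ∈ T, v j - x ∈ (affineSpan ℝ (v '' (T : Set ℕ))).direction := fun j hj =>
    AffineSubspace.vsub_mem_direction (subset_affineSpan ℝ _ ⟨j, hj, rfl⟩) hxaff
  -- the point `x` lies in the relative interior of the simplex, so its weights are positive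
  have hlpos : ∀ j ∈ T, 0 < l j := by
    intro j hj
    obtain ⟨ε, hε, hmem⟩ := exists_add_smul_mem_intrinsicInterior hxT
      (e := -(v j - x)) (by rw [hspanT]; exact Submodule.neg_mem _ (hdirT j hj))
    obtain ⟨c, hc0, hc1, hcx⟩ :=
      mem_convexHull_image_finset_iff.1 (intrinsicInterior_subset hmem)
    have heq := AffineIndependent.eq_of_sum_smul_eq hind (c := c)
      (e := fun i => (1 + ε) * l i - ε * (if i = j then 1 else 0)) (by
        rw [hc1, Finset.sum_sub_distrib, ← Finset.mul_sum, hl1, ← Finset.mul_sum]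
        simp [hj]) (by
        rw [hcx]
        simp only [sub_smul, Finset.sum_sub_distrib, mul_smul, ← Finset.smul_sum, hlx, ite_smul,
          one_smul, zero_smul, Finset.sum_ite_eq', hj, if_true]
        module) j hj
    simp only [if_true] at heq
    have h1 := hc0 j hj
    by_contra hneg
    have h2 : l j = 0 := le_antisymm (not_lt.1 hneg) (hl0 j hj)
    rw [h2] at heq
    linarith
  -- the directions of the cyclic polytope and of the simplex are independent
  have hdir : ∀ e ∈ (affineSpan ℝ ((fun i => φ (momentCurve (2 * k) (t i))) ''
      Set.Icc 1 (M + 1))).direction, e ∈ (affineSpan ℝ (v '' (T : Set ℕ))).direction → e = 0 := by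
    intro e heC heT
    obtain ⟨ε, hε, hmem⟩ := exists_add_smul_mem_intrinsicInterior hxT
      (e := e) (by rw [hspanT]; exact heT)
    have h1 : x + ε • e ∈ affineSpan ℝ ((fun i => φ (momentCurve (2 * k) (t i))) ''
        Set.Icc 1 (M + 1)) := by
      rw [add_comm x]
      exact AffineSubspace.vadd_mem_of_mem_direction (Submodule.smul_mem _ ε heC) hxC
    have h2 : x + ε • e ∈ ({x} : Set (EuclideanSpace ℝ (Fin D))) := by
      rw [← hint]; exact ⟨hmem, h1⟩
    have h3 : ε • e = 0 := by simpa using h2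
    exact (smul_eq_zero.1 h3).resolve_left hε.ne'
  set u : ℕ → ℝ × EuclideanSpace ℝ (Fin D) := fun i => (1, if i = 0 then q else v i) with hu
  have hui : ∀ i, i ≠ 0 → u i = (1, v i) := fun i hi => by simp [hu, hi]
  have hT0 : ∀ j ∈ T, j ≠ 0 := fun j hj => by simp [hT] at hj; omega
  have hindep : ∀ G ⊆ Finset.Icc 1 M, G.card = 2 * k →
      LinearIndepOn ℝ u ((G ∪ T : Finset ℕ) : Set ℕ) := by
    intro G hG hc
    have hdisj : Disjoint G T := by
      rw [Finset.disjoint_left]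
      intro i h1 h2
      have := hG h1
      simp only [hT, Finset.mem_Icc] at *
      omega
    have hG0 : ∀ i ∈ G, i ≠ 0 ∧ i ∈ Set.Ico 1 (M + 1) := fun i hi => by
      have := hG hi
      simp only [Finset.mem_Icc, Set.mem_Ico] at *
      omega
    rw [linearIndepOn_finset_iff]
    intro g hg
    rw [Finset.sum_union hdisj, Finset.sum_congr rfl (fun i hi => by rw [hui i (hG0 i hi).1]),
      Finset.sum_congr (s₁ := T) rfl (fun i hi => by rw [hui i (hT0 i hi)])] at hg
    have h1 := congrArg Prod.fst hg
    have h2 := congrArg Prod.snd hg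
    simp only [Prod.fst_add, Prod.snd_add, Prod.fst_sum, Prod.snd_sum, Prod.smul_fst,
      Prod.smul_snd, Prod.fst_zero, Prod.snd_zero, smul_eq_mul, mul_one] at h1 h2
    have he : ∑ i ∈ G, g i • (v i - x) = -∑ j ∈ T, g j • (v j - x) := by
      simp only [smul_sub, Finset.sum_sub_distrib, ← Finset.sum_smul]
      rw [eq_neg_of_add_eq_zero_left h1, eq_neg_of_add_eq_zero_left h2]
      module
    have he0 : ∑ i ∈ G, g i • (v i - x) = 0 := by
      apply hdir
      · refine Submodule.sum_mem _ fun i hi => Submodule.smul_mem _ _ ?_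
        refine AffineSubspace.vsub_mem_direction (subset_affineSpan ℝ _ ?_) hxC
        refine ⟨i, ?_, (hvφ i (hG0 i hi).2).symm⟩
        have := (hG0 i hi).2
        simp only [Set.mem_Ico, Set.mem_Icc] at *
        omega
      · rw [he]
        exact Submodule.neg_mem _ (Submodule.sum_mem _ fun j hj =>
          Submodule.smul_mem _ _ (hdirT j hj))
    have hmom : ∑ i ∈ G, g i • (momentCurve (2 * k) (t i) - momentCurve (2 * k) (t (M + 1)))
        = 0 := by
      have hlin : Function.Injective φ.linear := φ.linear_injective_iff.2 hφ
      apply hlin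
      rw [map_zero, ← he0, map_sum]
      refine Finset.sum_congr rfl fun i hi => ?_
      rw [map_smul, hvφ i (hG0 i hi).2, hx, ← vsub_eq_sub, ← vsub_eq_sub, φ.linearMap_vsub]
    have hGz : ∀ i ∈ G, g i = 0 := by
      intro i hi
      set J := insert (M + 1) G with hJ
      have hMG : M + 1 ∉ G := fun h' => by have := hG h'; simp at this
      have hJt : Set.InjOn t (J : Set ℕ) := ht.injOn.mono fun j hj => by
        rcases Finset.mem_insert.1 (Finset.mem_coe.1 hj) with rfl | hj
        · simp
        · have := (hG0 j hj).2
          simp only [Set.mem_Ico, Set.mem_Icc] at *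
          omega
      have hiJ : i ∈ J := Finset.mem_insert_of_mem hi
      have := sum_mul_eval_sub_eq_zero hmom (Lagrange.basis J t i) (by
        rw [Lagrange.natDegree_basis hJt hiJ, hJ, Finset.card_insert_of_notMem hMG, hc]; omega)
      rw [Lagrange.eval_basis_of_ne (show i ≠ M + 1 from fun h' => hMG (h' ▸ hi))
          (Finset.mem_insert_self _ _),
        Finset.sum_eq_single i, Lagrange.eval_basis_self hJt hiJ] at this
      · simpa using this
      · intro j hj hji
        rw [Lagrange.eval_basis_of_ne hji.symm (Finset.mem_insert_of_mem hj)]; simp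
      · exact fun h' => absurd hi h'
    have hTz : ∀ j ∈ T, g j = 0 := by
      rw [Finset.sum_eq_zero hGz, zero_add] at h1
      rw [Finset.sum_eq_zero (fun i hi => by rw [hGz i hi, zero_smul]), zero_add] at h2
      exact AffineIndependent.eq_of_sum_smul_eq hind (e := fun _ => 0) (by simpa using h1)
        (by simpa using h2)
    intro i hi
    rcases Finset.mem_union.1 hi with hi | hi
    · exact hGz i hi
    · exact hTz i hi
  refine ⟨t, l, ht, hlpos, hindep, fun G hG hc => ?_, fun f => ?_⟩
  · have hdisj : Disjoint G T := by
      rw [Finset.disjoint_left]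
      intro i h1 h2
      have := hG h1
      simp only [hT, Finset.mem_Icc] at *
      omega
    have hcard : (G ∪ T).card = D + 1 := by
      rw [Finset.card_union_of_disjoint hdisj, hc, hT, Nat.card_Icc]; omega
    have hLI : LinearIndependent ℝ (fun i : ((G ∪ T : Finset ℕ) : Set ℕ) => u i) := hindep G hG hc
    have := hLI.span_eq_top_of_card_eq_finrank' (by
      have h1 : Fintype.card ((G ∪ T : Finset ℕ) : Set ℕ) = (G ∪ T).card := Fintype.card_coe _
      rw [h1, hcard, Module.finrank_prod, finrank_euclideanSpace_fin, Module.finrank_self,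
        add_comm])
    rw [Set.image_eq_range]
    exact this
  · set ψ : EuclideanSpace ℝ (Fin (2 * k)) →ₗ[ℝ] ℝ :=
      f ∘ₗ LinearMap.inr ℝ ℝ (EuclideanSpace ℝ (Fin D)) ∘ₗ φ.linear with hψ
    obtain ⟨g, hg, hgeval⟩ := exists_polynomial_momentCurve (2 * k) ψ (f (1, φ 0))
    have hfφ : ∀ s, f (1, φ (momentCurve (2 * k) s)) = g.eval s := fun s => by
      rw [← hgeval, hψ, LinearMap.comp_apply, LinearMap.comp_apply, LinearMap.inr_apply, ← map_add]
      congr 1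
      have h1 := φ.map_vadd 0 (momentCurve (2 * k) s)
      rw [vadd_eq_add, add_zero, vadd_eq_add] at h1
      rw [Prod.mk_add_mk, add_zero, h1, add_comm]
    refine ⟨g, hg, fun i hi => ?_, ?_⟩
    · rw [Finset.mem_Icc] at hi
      rw [hui i (by omega), hvφ i ⟨hi.1, by omega⟩, hfφ]
    · rw [← hfφ, ← hx]
      have h1 : ((1 : ℝ), x) = ∑ j ∈ T, l j • u j := by
        rw [Finset.sum_congr rfl (fun j hj => by rw [hui j (hT0 j hj)])]
        ext1
        · simp [Prod.fst_sum, hl1]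
        · simp [Prod.snd_sum, hlx]
      rw [h1, map_sum]
      simp [hT]

/-! ### Lexicographic heights -/

namespace IsLexHeights

variable {R : ℝ} {N a : ℕ} {w : ℕ → ℝ}

theorem pos (h : IsLexHeights R (N + 1) a w) (hR : 0 ≤ R) {i : ℕ} (hi : i < a) : 0 < w i :=
  (mul_nonneg hR (abs_nonneg _)).trans_lt (h.1 i hi)

theorem abs_le_abs (h : IsLexHeights R (N + 1) a w) (hR : 1 ≤ R) {i j : ℕ} (hij : i ≤ j)
    (hj : j ≤ N) : |w j| ≤ |w i| := by
  induction j, hij using Nat.le_induction with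
  | base => exact le_rfl
  | succ j hij ih =>
    refine le_trans ?_ (ih (by omega))
    rcases lt_or_ge j a with hja | hja
    · have h1 := h.1 j hja
      have h2 := le_abs_self (w j)
      nlinarith [abs_nonneg (w (j + 1))]
    · rw [h.2.2 (j + 1) (by omega) (by omega), abs_zero]
      exact abs_nonneg _

/-- Each height up to the `a`-th dominates all later ones. -/
theorem mul_abs_le (h : IsLexHeights R (N + 1) a w) (hR : 1 ≤ R) {i j : ℕ} (hi : i ≤ a)
    (hij : i < j) (hj : j ≤ N) : R * |w j| ≤ |w i| := by
  rcases hi.lt_or_eq with hi | rfl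
  · have h1 := h.1 i hi
    have h2 := h.abs_le_abs hR (show i + 1 ≤ j from hij) hj
    have h3 := le_abs_self (w i)
    nlinarith
  · rw [h.2.2 j hij (by omega), abs_zero, mul_zero]
    exact abs_nonneg _

theorem ne_zero (h : IsLexHeights R (N + 1) a w) (hR : 0 ≤ R) {i : ℕ} (hi : i ≤ a) : w i ≠ 0 := by
  rcases hi.lt_or_eq with hi | rfl
  · exact (h.pos hR hi).ne'
  · exact h.2.1.ne

end IsLexHeights

namespace IsMomentConfig

variable {A : Type*} [AddCommGroup A] [Module ℝ A] {k M N a : ℕ} {t l : ℕ → ℝ} {u : ℕ → A}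

theorem linearIndepOn_of_card_le (h : IsMomentConfig k M N t l u) (hM : 2 * k ≤ M) {B : Finset ℕ}
    (hB : B ⊆ Finset.Icc 1 N) (hc : (B ∩ Finset.Icc 1 M).card ≤ 2 * k) :
    LinearIndepOn ℝ u (B : Set ℕ) := by
  obtain ⟨G, hG1, hG2, hG3⟩ := Finset.exists_subsuperset_card_eq
    (Finset.inter_subset_right : B ∩ Finset.Icc 1 M ⊆ Finset.Icc 1 M) hc (by simpa using hM)
  refine (h.indep G hG2 hG3).mono fun i hi => ?_
  rw [Finset.mem_coe] at hi ⊢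
  by_cases hiM : i ≤ M
  · exact Finset.mem_union_left _ (hG1 (by have := hB hi; simp at this ⊢; exact ⟨hi, by omega⟩))
  · exact Finset.mem_union_right _ (by have := hB hi; simp at this ⊢; omega)

/-- The diamond is simplicial: the lifted vertices on a supporting hyperplane are independent.
The vertices other than the one of smallest label `i₀ ≤ a` include at most `2k` vertices of the
cyclic polytope, as otherwise the functional would be too small at `i₀`, whose height dominates. -/
theorem eventually_linearIndepOn_of_nonneg (h : IsMomentConfig k M N t l u) (hM : 2 * k ≤ M)
    (hMN : M ≤ N) (ha : 1 ≤ a) (haM : a ≤ M) :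
    ∀ᶠ R : ℝ in Filter.atTop, ∀ w : ℕ → ℝ, IsLexHeights R (N + 1) a w →
      ∀ (c : ℝ) (f : A →ₗ[ℝ] ℝ), (∀ i ∈ Finset.range (N + 1), 0 ≤ c * w i + f (u i)) →
        (∃ i ∈ Finset.range (N + 1), c * w i + f (u i) ≠ 0) →
        ∀ Z ⊆ Finset.range (N + 1), (∀ i ∈ Z, c * w i + f (u i) = 0) →
          LinearIndepOn ℝ (fun i => (w i, u i)) (Z : Set ℕ) := by
  have hE1 : ∀ᶠ R : ℝ in Filter.atTop, ∀ B ∈ (Finset.range (N + 1)).powerset,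
      ∀ i₀ ∈ Finset.range (N + 1), i₀ ∉ B → LinearIndepOn ℝ u (B : Set ℕ) →
      ∀ w : ℕ → ℝ, w i₀ ≠ 0 → (∀ j ∈ B, R * |w j| ≤ |w i₀|) →
      LinearIndepOn ℝ (fun i => (w i, u i)) ((insert i₀ B : Finset ℕ) : Set ℕ) := by
    rw [Filter.eventually_all_finset]
    intro B _
    rw [Filter.eventually_all_finset]
    intro i₀ _
    by_cases hi₀ : i₀ ∈ B
    · exact Filter.Eventually.of_forall fun R h' => absurd hi₀ h'
    · by_cases hB : LinearIndepOn ℝ u (B : Set ℕ)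
      · exact (eventually_linearIndepOn_insert u B i₀ hi₀ hB).mono fun R hR _ _ => hR
      · exact Filter.Eventually.of_forall fun R _ h' => absurd h' hB
  have hE2 : ∀ᶠ R : ℝ in Filter.atTop, ∀ G ∈ (Finset.Icc 1 M).powerset, G.card = 2 * k + 1 →
      ∀ i ∈ Finset.range (N + 1), ∃ C < R, ∀ (f : A →ₗ[ℝ] ℝ) (ε : ℝ),
        (∀ j ∈ Finset.Icc (M + 1) N, 0 ≤ f (u j)) → (∀ i ∈ G, |f (u i)| ≤ ε) →
          |f (u i)| ≤ C * ε := by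
    rw [Filter.eventually_all_finset]
    intro G hG
    by_cases hc : G.card = 2 * k + 1
    · have : ∀ᶠ R : ℝ in Filter.atTop, ∀ i ∈ Finset.range (N + 1), ∃ C < R,
          ∀ (f : A →ₗ[ℝ] ℝ) (ε : ℝ), (∀ j ∈ Finset.Icc (M + 1) N, 0 ≤ f (u j)) →
            (∀ i ∈ G, |f (u i)| ≤ ε) → |f (u i)| ≤ C * ε := by
        rw [Filter.eventually_all_finset]
        intro i _
        obtain ⟨C, hC⟩ := h.exists_bound (Finset.mem_powerset.1 hG) hc (u i)
        exact (Filter.eventually_gt_atTop C).mono fun R hR => ⟨C, hR, hC⟩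
      exact this.mono fun R hR _ => hR
    · exact Filter.Eventually.of_forall fun R h' => absurd h' hc
  filter_upwards [hE1, hE2, Filter.eventually_ge_atTop (1 : ℝ)] with R h1 h2 hR w hw c f hnn hne Z
    hZN hZ
  have hR0 : 0 ≤ R := by linarith
  have hT : ∀ j ∈ Finset.Icc (M + 1) N, 0 ≤ f (u j) := fun j hj => by
    simp only [Finset.mem_Icc] at hj
    have := hnn j (by simp; omega)
    rwa [hw.2.2 j (by omega) (by omega), mul_zero, zero_add] at this
  -- a functional of the base that vanishes at `2k + 1` vertices of the cyclic polytope
  have hzero : ∀ G ⊆ Finset.Icc 1 M, G.card = 2 * k + 1 → (∀ i ∈ G, f (u i) = 0) →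
      ∀ i ∈ Finset.range (N + 1), f (u i) = 0 := fun G hG hc hf i hi => by
    obtain ⟨C, -, hC⟩ := h2 G (Finset.mem_powerset.2 hG) hc i hi
    have := hC f 0 hT fun i hi => by rw [hf i hi, abs_zero]
    rw [mul_zero] at this
    exact abs_nonpos_iff.1 this
  have hc0 : (∀ i ∈ Finset.range (N + 1), f (u i) = 0) → c = 0 → False := fun hf hc => by
    obtain ⟨i, hi, hi'⟩ := hne
    exact hi' (by rw [hf i hi, hc, zero_mul, zero_add])
  by_cases hcase : ∃ i ∈ Z, i ≤ a
  · obtain ⟨i₁, hi₁, hi₁a⟩ := hcase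
    obtain ⟨i₀, hi₀, hmin⟩ := Z.exists_min_image id ⟨i₁, hi₁⟩
    simp only [id] at hmin
    have hi₀a : i₀ ≤ a := (hmin i₁ hi₁).trans hi₁a
    have hgt : ∀ j ∈ Z.erase i₀, i₀ < j := fun j hj =>
      lt_of_le_of_ne (hmin j (Finset.mem_of_mem_erase hj)) (Finset.ne_of_mem_erase hj).symm
    have hBN : Z.erase i₀ ⊆ Finset.Icc 1 N := fun j hj => by
      have e1 := hgt j hj
      have e2 := hZN (Finset.mem_of_mem_erase hj)
      simp only [Finset.mem_Icc, Finset.mem_range] at *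
      omega
    have hdom : ∀ j ∈ Z.erase i₀, R * |w j| ≤ |w i₀| := fun j hj =>
      hw.mul_abs_le hR hi₀a (hgt j hj) (Finset.mem_Icc.1 (hBN hj)).2
    have hw0 : 0 < |w i₀| := abs_pos.2 (hw.ne_zero hR0 hi₀a)
    have hcard : (Z.erase i₀ ∩ Finset.Icc 1 M).card ≤ 2 * k := by
      by_contra hlt
      push Not at hlt
      obtain ⟨G, hG, hc⟩ := Finset.exists_subset_card_eq (Nat.succ_le_of_lt hlt)
      have hGM : G ⊆ Finset.Icc 1 M := hG.trans Finset.inter_subset_right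
      have hGZ : G ⊆ Z.erase i₀ := hG.trans Finset.inter_subset_left
      have habs : ∀ i ∈ Z, |f (u i)| = |c| * |w i| := fun i hi => by
        rw [← abs_mul, ← abs_neg (c * w i)]
        congr 1
        have := hZ i hi
        linarith
      obtain ⟨C, hCR, hC⟩ := h2 G (Finset.mem_powerset.2 hGM) hc i₀ (hZN hi₀)
      have hle := hC f (|c| * (|w i₀| / R)) hT fun i hi => by
        rw [habs i (Finset.mem_of_mem_erase (hGZ hi))]
        refine mul_le_mul_of_nonneg_left ?_ (abs_nonneg _)
        rw [le_div_iff₀ (by linarith), mul_comm]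
        exact hdom i (hGZ hi)
      rw [habs i₀ hi₀] at hle
      have hcz : c = 0 := by
        by_contra hcne
        have hc' : 0 < |c| := abs_pos.2 hcne
        have : C * (|c| * (|w i₀| / R)) < |c| * |w i₀| := by
          have hlt : C / R < 1 := by rw [div_lt_one (by linarith)]; exact hCR
          calc C * (|c| * (|w i₀| / R)) = C / R * (|c| * |w i₀|) := by ring
            _ < 1 * (|c| * |w i₀|) := mul_lt_mul_of_pos_right hlt (mul_pos hc' hw0)
            _ = |c| * |w i₀| := one_mul _
        linarith
      exact hc0 (hzero G hGM hc fun i hi => by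
        have := hZ i (Finset.mem_of_mem_erase (hGZ hi))
        rwa [hcz, zero_mul, zero_add] at this) hcz
    have := h1 (Z.erase i₀) (Finset.mem_powerset.2 ((Finset.erase_subset _ _).trans hZN)) i₀
      (hZN hi₀) (Finset.notMem_erase _ _) (h.linearIndepOn_of_card_le hM hBN hcard) w
      (hw.ne_zero hR0 hi₀a) hdom
    rwa [Finset.insert_erase hi₀] at this
  · push Not at hcase
    have hBN : Z ⊆ Finset.Icc 1 N := fun j hj => by
      have e1 := hcase j hj
      have e2 := hZN hj
      simp only [Finset.mem_Icc, Finset.mem_range] at *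
      omega
    have hfZ : ∀ i ∈ Z, f (u i) = 0 := fun i hi => by
      have := hZ i hi
      rwa [hw.2.2 i (hcase i hi) (by have := hBN hi; simp at this; omega), mul_zero,
        zero_add] at this
    have hcard : (Z ∩ Finset.Icc 1 M).card ≤ 2 * k := by
      by_contra hlt
      push Not at hlt
      obtain ⟨G, hG, hc⟩ := Finset.exists_subset_card_eq (Nat.succ_le_of_lt hlt)
      have hf := hzero G (hG.trans Finset.inter_subset_right) hc
        fun i hi => hfZ i (Finset.inter_subset_left (hG hi))
      refine hc0 hf ?_
      have e1 := hnn 0 (by simp)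
      have e2 := hnn a (by simp; omega)
      rw [hf 0 (by simp), add_zero] at e1
      rw [hf a (by simp; omega), add_zero] at e2
      have e3 := hw.pos hR0 (show 0 < a from ha)
      have e4 := hw.2.1
      exact le_antisymm (nonpos_of_mul_nonneg_left e2 e4) (nonneg_of_mul_nonneg_left e1 e3)
    exact LinearIndependent.of_comp (LinearMap.snd ℝ ℝ A) (h.linearIndepOn_of_card_le hM hBN hcard)

/-- The facets of the triangulation are simplices. -/
theorem eventually_linearIndepOn_of_isStackedFacet (h : IsMomentConfig k M N t l u)
    (hMN : M ≤ N) (haM : a ≤ M) :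
    ∀ᶠ R : ℝ in Filter.atTop, ∀ w : ℕ → ℝ, IsLexHeights R (N + 1) a w →
      ∀ Y, IsStackedFacet k a M N Y → LinearIndepOn ℝ (fun i => (w i, u i)) (Y : Set ℕ) := by
  have hE : ∀ᶠ R : ℝ in Filter.atTop, ∀ G ∈ (Finset.Icc 1 M).powerset, ∀ i₀ ∈ ({0, a} : Finset ℕ),
      G.card = 2 * k → i₀ ∉ G ∪ Finset.Icc (M + 1) N →
      ∀ w : ℕ → ℝ, w i₀ ≠ 0 → (∀ j ∈ G ∪ Finset.Icc (M + 1) N, R * |w j| ≤ |w i₀|) →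
      LinearIndepOn ℝ (fun i => (w i, u i))
        ((insert i₀ (G ∪ Finset.Icc (M + 1) N) : Finset ℕ) : Set ℕ) := by
    rw [Filter.eventually_all_finset]
    intro G hG
    rw [Filter.eventually_all_finset]
    intro i₀ _
    by_cases hi₀ : i₀ ∈ G ∪ Finset.Icc (M + 1) N
    · exact Filter.Eventually.of_forall fun R _ h' => absurd hi₀ h'
    · by_cases hc : G.card = 2 * k
      · exact (eventually_linearIndepOn_insert u _ i₀ hi₀
          (h.indep G (Finset.mem_powerset.1 hG) hc)).mono fun R hR _ _ => hR
      · exact Filter.Eventually.of_forall fun R h' => absurd h' hc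
  filter_upwards [hE, Filter.eventually_ge_atTop (1 : ℝ)] with R hE hR w hw Y hY
  have hR0 : 0 ≤ R := by linarith
  obtain ⟨G, hG, hc, -, hY⟩ := hY
  have hle : ∀ j ∈ G ∪ Finset.Icc (M + 1) N, 1 ≤ j ∧ j ≤ N := fun j hj => by
    rcases Finset.mem_union.1 hj with hj | hj
    · have := hG hj; simp at this; omega
    · simp at hj; omega
  rcases hY with rfl | ⟨hGa, rfl⟩
  · refine hE G (Finset.mem_powerset.2 hG) 0 (by simp) hc (fun h' => ?_) w
      (hw.ne_zero hR0 (Nat.zero_le a)) fun j hj => hw.mul_abs_le hR (Nat.zero_le a) (hle j hj).1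
        (hle j hj).2
    have := hle 0 h'
    omega
  · have hlt : ∀ j ∈ G ∪ Finset.Icc (M + 1) N, a < j := fun j hj => by
      rcases Finset.mem_union.1 hj with hj | hj
      · exact hGa j hj
      · simp at hj; omega
    exact hE G (Finset.mem_powerset.2 hG) a (by simp) hc (fun h' => lt_irrefl _ (hlt a h')) w
      hw.2.1.ne fun j hj => hw.mul_abs_le hR le_rfl (hlt j hj) (hle j hj).2

/-- Sets of at most `(N - M) + k - 1` vertices of a simplex of the triangulation lie in the
boundary. -/
theorem eventually_exists_supporting (h : IsMomentConfig k M N t l u) (hk : 1 ≤ k) (hM : 2 * k ≤ M)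
    (hMN : M ≤ N) (ha : 1 ≤ a) (haM : a ≤ M) :
    ∀ᶠ R : ℝ in Filter.atTop, ∀ w : ℕ → ℝ, IsLexHeights R (N + 1) a w →
      ∀ Y, IsStackedFacet k a M N Y → ∀ F ⊆ Y, F.card + 1 + M ≤ k + N →
        ∃ (c : ℝ) (f : A →ₗ[ℝ] ℝ), (∀ i ∈ Finset.range (N + 1), 0 ≤ c * w i + f (u i)) ∧
          (∃ i ∈ Finset.range (N + 1), 0 < c * w i + f (u i)) ∧ ∀ i ∈ F, c * w i + f (u i) = 0 := by
  have hE1 : ∀ᶠ R : ℝ in Filter.atTop, ∀ G ∈ (Finset.Icc 1 M).powerset, G.card + 1 ≤ k →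
      ∀ w : ℕ → ℝ, 0 < w 0 → (∀ i ∈ Finset.Icc 1 N, R * |w i| ≤ w 0) →
      ∃ (c : ℝ) (f : A →ₗ[ℝ] ℝ),
        (∀ i ∈ insert 0 (G ∪ Finset.Icc (M + 1) N), c * w i + f (u i) = 0) ∧
        ∀ i ∈ Finset.Icc 1 N, i ∉ G ∪ Finset.Icc (M + 1) N → 0 < c * w i + f (u i) := by
    rw [Filter.eventually_all_finset]
    intro G hG
    rw [Finset.mem_powerset] at hG
    by_cases hc : G.card + 1 ≤ k
    · obtain ⟨f, hf1, hf2⟩ := h.exists_face_functional hM hG hc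
      have hsub : G ∪ Finset.Icc (M + 1) N ⊆ Finset.Icc 1 N :=
        Finset.union_subset (hG.trans (Finset.Icc_subset_Icc le_rfl hMN))
          (Finset.Icc_subset_Icc (by omega) le_rfl)
      refine (eventually_exists_tilt u N _ ?_ hsub f hf1 hf2).mono fun R hR _ => hR
      refine h.linearIndepOn_of_card_le hM hsub ((Finset.card_le_card (t := G) ?_).trans (by omega))
      intro i hi
      simp only [Finset.mem_inter, Finset.mem_union, Finset.mem_Icc] at hi
      rcases hi with ⟨hi | hi, hi'⟩
      · exact hi
      · omega
    · exact Filter.Eventually.of_forall fun R h' => absurd h' hc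
  have hE2 : ∀ᶠ R : ℝ in Filter.atTop, ∀ G ∈ (Finset.Icc 1 M).powerset,
      ∀ j ∈ Finset.Icc (M + 1) N, G.card = 2 * k ∧ HasEvenBlocks G →
      ∀ w : ℕ → ℝ, 0 < w 0 → (∀ i ∈ Finset.Icc 1 N, R * |w i| ≤ w 0) →
      ∃ (c : ℝ) (f : A →ₗ[ℝ] ℝ),
        (∀ i ∈ insert 0 (G ∪ (Finset.Icc (M + 1) N).erase j), c * w i + f (u i) = 0) ∧
        ∀ i ∈ Finset.Icc 1 N, i ∉ G ∪ (Finset.Icc (M + 1) N).erase j → 0 < c * w i + f (u i) := by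
    rw [Filter.eventually_all_finset]
    intro G hG
    rw [Filter.eventually_all_finset]
    intro j hj
    rw [Finset.mem_powerset] at hG
    by_cases hc : G.card = 2 * k ∧ HasEvenBlocks G
    · obtain ⟨f, hf1, hf2⟩ := h.exists_facet_functional hM hG hc.1 hc.2 hj
      have hsub : G ∪ (Finset.Icc (M + 1) N).erase j ⊆ Finset.Icc 1 N :=
        Finset.union_subset (hG.trans (Finset.Icc_subset_Icc le_rfl hMN))
          ((Finset.erase_subset _ _).trans (Finset.Icc_subset_Icc (by omega) le_rfl))
      refine (eventually_exists_tilt u N _ ?_ hsub f hf1 hf2).mono fun R hR _ => hR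
      exact (h.indep G hG hc.1).mono (by
        exact_mod_cast Finset.union_subset_union_right (Finset.erase_subset _ _))
    · exact Filter.Eventually.of_forall fun R h' => absurd h' hc
  have hE3 : ∀ᶠ R : ℝ in Filter.atTop, ∀ G ∈ (Finset.Icc 1 M).powerset,
      ∀ j ∈ Finset.Icc (M + 1) N, G.card = 2 * k ∧ HasEvenBlocks G ∧ a ∉ G →
      ∀ w : ℕ → ℝ, w a < 0 → R * |w a| < w 0 →
      (∀ i ∈ G ∪ (Finset.Icc (M + 1) N).erase j, w i = 0) →
      (∀ i ∈ Finset.Icc 1 N, i ≠ a → 0 ≤ w i) →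
      ∃ (c : ℝ) (f : A →ₗ[ℝ] ℝ),
        (∀ i ∈ insert a (G ∪ (Finset.Icc (M + 1) N).erase j), c * w i + f (u i) = 0) ∧
        (∀ i ∈ Finset.Icc 1 N, 0 ≤ c * w i + f (u i)) ∧ 0 < c * w 0 + f (u 0) := by
    rw [Filter.eventually_all_finset]
    intro G hG
    rw [Filter.eventually_all_finset]
    intro j hj
    rw [Finset.mem_powerset] at hG
    by_cases hc : G.card = 2 * k ∧ HasEvenBlocks G ∧ a ∉ G
    · obtain ⟨f, hf1, hf2⟩ := h.exists_facet_functional hM hG hc.1 hc.2.1 hj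
      refine (eventually_exists_tilt_of_neg u N a _ f hf1 (fun i hi => ?_) ?_).mono
        fun R hR _ => hR
      · by_cases hi' : i ∈ G ∪ (Finset.Icc (M + 1) N).erase j
        · exact (hf1 i hi').ge
        · exact (hf2 i hi hi').le
      · refine hf2 a (by simp; omega) fun h' => ?_
        rcases Finset.mem_union.1 h' with h' | h'
        · exact hc.2.2 h'
        · have := Finset.mem_of_mem_erase h'
          simp at this
          omega
    · exact Filter.Eventually.of_forall fun R h' => absurd h' hc
  filter_upwards [hE1, hE2, hE3, Filter.eventually_ge_atTop (1 : ℝ)] with R hE1 hE2 hE3 hR w hw Y hY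
    F hFY hcard
  have hR0 : 0 ≤ R := by linarith
  have hw0 : 0 < w 0 := hw.pos hR0 ha
  have hdom : ∀ i ∈ Finset.Icc 1 N, R * |w i| ≤ w 0 := fun i hi => by
    rw [Finset.mem_Icc] at hi
    have := hw.mul_abs_le hR (Nat.zero_le a) hi.1 hi.2
    rwa [abs_of_pos hw0] at this
  have hcases : ∀ i ∈ Finset.range (N + 1), i = 0 ∨ i ∈ Finset.Icc 1 N := fun i hi => by
    simp at hi ⊢; omega
  obtain ⟨G, hG, hc, heven, hY⟩ := hY
  by_cases hTF : Finset.Icc (M + 1) N ⊆ F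
  · have hFN : F ⊆ Finset.range (N + 1) := by
      refine hFY.trans fun i hi => ?_
      have : i = 0 ∨ i = a ∨ i ∈ G ∪ Finset.Icc (M + 1) N := by
        rcases hY with rfl | ⟨-, rfl⟩ <;> rw [Finset.mem_insert] at hi <;> tauto
      rcases this with rfl | rfl | hi
      · simp
      · simp; omega
      · rcases Finset.mem_union.1 hi with hi | hi
        · have := hG hi; simp at this ⊢; omega
        · simp at hi ⊢; omega
    have hcF : (F ∩ Finset.Icc 1 M).card + 1 ≤ k := by
      have hd : Disjoint (F ∩ Finset.Icc 1 M) (Finset.Icc (M + 1) N) := by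
        rw [Finset.disjoint_left]
        intro i h1 h2
        simp only [Finset.mem_inter, Finset.mem_Icc] at h1 h2
        omega
      have := Finset.card_le_card (Finset.union_subset Finset.inter_subset_left hTF :
        (F ∩ Finset.Icc 1 M) ∪ Finset.Icc (M + 1) N ⊆ F)
      rw [Finset.card_union_of_disjoint hd, Nat.card_Icc] at this
      omega
    obtain ⟨c, f, hcf1, hcf2⟩ := hE1 (F ∩ Finset.Icc 1 M)
      (Finset.mem_powerset.2 Finset.inter_subset_right) hcF w hw0 hdom
    refine ⟨c, f, fun i hi => ?_, ?_, fun i hi => hcf1 i ?_⟩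
    · by_cases hi' : i ∈ insert 0 (F ∩ Finset.Icc 1 M ∪ Finset.Icc (M + 1) N)
      · exact (hcf1 i hi').ge
      · rw [Finset.mem_insert, not_or] at hi'
        exact (hcf2 i ((hcases i hi).resolve_left hi'.1) hi'.2).le
    · obtain ⟨i, hi, hi'⟩ := Finset.exists_mem_notMem_of_card_lt_card
        (s := F ∩ Finset.Icc 1 M) (t := Finset.Icc 1 M) (by simp; omega)
      refine ⟨i, by simp at hi ⊢; omega, hcf2 i (by simp at hi ⊢; omega) fun h' => ?_⟩
      rcases Finset.mem_union.1 h' with h' | h'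
      · exact hi' h'
      · simp at hi h'; omega
    · simp only [Finset.mem_insert, Finset.mem_union, Finset.mem_inter]
      rcases hcases i (hFN hi) with rfl | hi'
      · exact Or.inl rfl
      · by_cases hiM : i ≤ M
        · exact Or.inr (Or.inl ⟨hi, by simp at hi' ⊢; omega⟩)
        · exact Or.inr (Or.inr (by simp at hi' ⊢; omega))
  · obtain ⟨j, hjT, hjF⟩ := Finset.not_subset.1 hTF
    have hFe : ∀ i₀, F ⊆ insert i₀ (G ∪ Finset.Icc (M + 1) N) →
        F ⊆ insert i₀ (G ∪ (Finset.Icc (M + 1) N).erase j) := fun i₀ hF i hi => by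
      have hij : i ≠ j := fun h' => hjF (h' ▸ hi)
      have := hF hi
      simp only [Finset.mem_insert, Finset.mem_union, Finset.mem_erase] at this ⊢
      tauto
    have hjG : j ∉ G := fun h' => by
      have := hG h'; simp at this hjT; omega
    rcases hY with rfl | ⟨hGa, rfl⟩
    · obtain ⟨c, f, hcf1, hcf2⟩ := hE2 G (Finset.mem_powerset.2 hG) j hjT ⟨hc, heven⟩ w hw0 hdom
      refine ⟨c, f, fun i hi => ?_, ⟨j, by simp at hjT ⊢; omega, hcf2 j ?_ ?_⟩,
        fun i hi => hcf1 i (hFe 0 hFY hi)⟩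
      · by_cases hi' : i ∈ insert 0 (G ∪ (Finset.Icc (M + 1) N).erase j)
        · exact (hcf1 i hi').ge
        · rw [Finset.mem_insert, not_or] at hi'
          exact (hcf2 i ((hcases i hi).resolve_left hi'.1) hi'.2).le
      · simp at hjT ⊢; omega
      · simp [hjG]
    · have haG : a ∉ G := fun h' => lt_irrefl _ (hGa a h')
      obtain ⟨c, f, hcf1, hcf2, hcf3⟩ := hE3 G (Finset.mem_powerset.2 hG) j hjT ⟨hc, heven, haG⟩ w
        hw.2.1 (by
          have := hw.1 0 ha
          exact (mul_le_mul_of_nonneg_left (hw.abs_le_abs hR (show 0 + 1 ≤ a from ha) (by omega))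
            hR0).trans_lt this) (fun i hi => by
          rcases Finset.mem_union.1 hi with hi | hi
          · exact hw.2.2 i (hGa i hi) (by have := hG hi; simp at this; omega)
          · have := Finset.mem_of_mem_erase hi
            simp at this
            exact hw.2.2 i (by omega) (by omega)) (fun i hi hia => by
          rw [Finset.mem_Icc] at hi
          rcases lt_or_gt_of_ne hia with hlt | hgt
          · exact (hw.pos hR0 hlt).le
          · exact (hw.2.2 i hgt (by omega)).ge)
      refine ⟨c, f, fun i hi => ?_, ⟨0, by simp, hcf3⟩, fun i hi => hcf1 i (hFe a hFY hi)⟩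
      rcases hcases i hi with rfl | hi
      · exact hcf3.le
      · exact hcf2 i hi

/-- Every small missing face contains the negative part of a dependence that is positive on the
simplex.
If the smallest label of `F` is less than `a`, then the height of that vertex dominates and
the apex has to be on the positive side; if it is `a`, then the apex is on the negative side; and if
it is larger, then the apex does not occur. -/
theorem eventually_exists_dependence (h : IsMomentConfig k M N t l u) (hMN : M ≤ N) :
    ∀ᶠ R : ℝ in Filter.atTop, ∀ w : ℕ → ℝ, 1 ≤ a → IsLexHeights R (N + 1) a w →
      ∀ F, IsSmallMissingFace k a M F → ∃ δ : ℕ → ℝ,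
        ∑ i ∈ Finset.range (N + 1), δ i • u i = 0 ∧
        ∑ i ∈ Finset.range (N + 1), δ i * w i = 0 ∧
        (∀ i ∈ Finset.range (N + 1), δ i < 0 → i ∈ F) ∧
        ∀ j ∈ Finset.Icc (M + 1) N, 0 < δ j := by
  have hE : ∀ᶠ R : ℝ in Filter.atTop, ∀ F ∈ (Finset.Icc 1 M).powerset,
      F.card = k + 1 ∧ IsIsolated F → ∀ w : ℕ → ℝ, 1 ≤ a → IsLexHeights R (N + 1) a w →
      ∃ δ : ℕ → ℝ, ∑ i ∈ Finset.range (N + 1), δ i • u i = 0 ∧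
        ∑ i ∈ Finset.range (N + 1), δ i * w i = 0 ∧
        (∀ i ∈ Finset.Icc 1 N, δ i < 0 → i ∈ F) ∧
        (∀ j ∈ Finset.Icc (M + 1) N, 0 < δ j) ∧ (δ 0 < 0 → IsLeast (F : Set ℕ) a) := by
    rw [Filter.eventually_all_finset]
    intro F hF
    rw [Finset.mem_powerset] at hF
    by_cases hc : F.card = k + 1 ∧ IsIsolated F
    · obtain ⟨δ, θ, hδ, hθ, hδθ, hneg, hpos, hsupp⟩ := h.exists_dependence hMN hF hc.1 hc.2
      have hbig : ∀ᶠ R : ℝ in Filter.atTop, ∀ m ∈ F, (∑ i ∈ Finset.Icc 1 N, |δ i|) / |δ m| < R := by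
        rw [Filter.eventually_all_finset]
        exact fun m _ => Filter.eventually_gt_atTop _
      filter_upwards [eventually_exists_lifted_dependence u N δ θ hδ hθ hδθ, hbig,
        Filter.eventually_ge_atTop (1 : ℝ)] with R hlift hbig hR _ w ha hw
      have hR0 : 0 ≤ R := by linarith
      have hw0 : 0 < w 0 := hw.pos hR0 ha
      obtain ⟨δ', h1, h2, h3, h4, h5⟩ := hlift w hw0 fun i hi => by
        rw [Finset.mem_Icc] at hi
        have := hw.mul_abs_le hR (Nat.zero_le a) hi.1 hi.2
        rwa [abs_of_pos hw0] at this
      refine ⟨δ', h1, h2, fun i hi hi' => (hneg i).1 (h4 i hi hi'),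
        fun j hj => h3 j (by simp at hj ⊢; omega) (hpos j hj), fun h0 => ?_⟩
      have hsum := h5 h0
      obtain ⟨m, hmF, hmin⟩ := F.exists_min_image id (Finset.card_pos.1 (by omega))
      simp only [id] at hmin
      have hmN : m ∈ Finset.Icc 1 N := by have := hF hmF; simp at this ⊢; omega
      have hzero : ∀ i, i < m → δ i = 0 := fun i hi => by
        by_contra hne
        obtain ⟨f, hf, hfi⟩ := hsupp i hne
        have := hmin f hf
        omega
      suffices hma : m = a by
        subst hma
        exact ⟨hmF, fun x hx => hmin x hx⟩
      by_contra hma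
      refine absurd hsum (not_lt.2 ?_)
      rcases lt_or_gt_of_ne hma with hlt | hgt
      · have hmneg := (hneg m).2 hmF
        have hwm := hw.pos hR0 hlt
        rw [← Finset.add_sum_erase _ _ hmN]
        have hle := abs_sum_mul_le_of_forall ((Finset.Icc 1 N).erase m) δ
          (fun i => if i < m then 0 else w i) (ε := w m / R) fun i hi => by
            obtain ⟨hne, hi⟩ := Finset.mem_erase.1 hi
            rw [Finset.mem_Icc] at hi
            split_ifs with him
            · rw [abs_zero]; positivity
            · rw [le_div_iff₀ (by linarith), mul_comm]
              have := hw.mul_abs_le hR hlt.le (show m < i by omega) hi.2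
              rwa [abs_of_pos hwm] at this
        have heq : ∑ i ∈ (Finset.Icc 1 N).erase m, δ i * (if i < m then 0 else w i)
            = ∑ i ∈ (Finset.Icc 1 N).erase m, δ i * w i :=
          Finset.sum_congr rfl fun i _ => by
            split_ifs with him
            · rw [hzero i him]; simp
            · rfl
        rw [heq] at hle
        have hD : ∑ i ∈ (Finset.Icc 1 N).erase m, |δ i| ≤ ∑ i ∈ Finset.Icc 1 N, |δ i| :=
          Finset.sum_le_sum_of_subset_of_nonneg (Finset.erase_subset _ _)
            fun i _ _ => abs_nonneg _
        have hb := hbig m hmF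
        rw [abs_of_neg hmneg, div_lt_iff₀ (by linarith)] at hb
        have hle2 : (∑ i ∈ (Finset.Icc 1 N).erase m, |δ i|) * (w m / R) ≤ -δ m * w m := by
          rw [mul_div_assoc', div_le_iff₀ (by linarith)]
          nlinarith
        have := (le_abs_self _).trans (hle.trans hle2)
        linarith
      · refine (Finset.sum_eq_zero fun i hi => ?_).le
        rw [Finset.mem_Icc] at hi
        rcases lt_or_ge i m with him | him
        · rw [hzero i him, zero_mul]
        · rw [hw.2.2 i (by omega) (by omega), mul_zero]
    · exact Filter.Eventually.of_forall fun R h' => absurd h' hc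
  filter_upwards [hE] with R hE w ha hw F hF
  have hcases : ∀ i ∈ Finset.range (N + 1), i = 0 ∨ i ∈ Finset.Icc 1 N := fun i hi => by
    simp at hi ⊢; omega
  rcases hF with ⟨F', rfl, hFM, hc, hiso, -⟩ | ⟨hFM, hc, hiso, hleast⟩
  · obtain ⟨δ, h1, h2, h3, h4, -⟩ := hE F' (Finset.mem_powerset.2 hFM) ⟨hc, hiso⟩ w ha hw
    refine ⟨δ, h1, h2, fun i hi hneg => ?_, h4⟩
    rcases hcases i hi with rfl | hi
    · exact Finset.mem_insert_self _ _
    · exact Finset.mem_insert_of_mem (h3 i hi hneg)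
  · obtain ⟨δ, h1, h2, h3, h4, h5⟩ := hE F (Finset.mem_powerset.2 hFM) ⟨hc, hiso⟩ w ha hw
    refine ⟨δ, h1, h2, fun i hi hneg => ?_, h4⟩
    rcases hcases i hi with rfl | hi
    · exact absurd (h5 hneg) hleast
    · exact h3 i hi hneg

end IsMomentConfig

/-! ### Triangulations of simplicial polytopes -/

section Triangulations

variable {E : Type*} [NormedAddCommGroup E] [NormedSpace ℝ E]

/-- An affine dependence can be replaced by one with at most `dim E + 2` nonzero coefficients, whose
positive and negative parts are contained in those of the given one. -/
theorem exists_affine_dependence_card_le [FiniteDimensional ℝ E] (S : Finset E) :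
    ∀ (r : ℕ) (δ : E → ℝ), (S.filter (fun p => δ p ≠ 0)).card ≤ r →
      (∃ p ∈ S, δ p ≠ 0) → ∑ p ∈ S, δ p = 0 → ∑ p ∈ S, δ p • p = 0 →
      ∃ γ : E → ℝ, (S.filter (fun p => γ p ≠ 0)).card ≤ Module.finrank ℝ E + 2 ∧
        (∃ p ∈ S, γ p ≠ 0) ∧ ∑ p ∈ S, γ p = 0 ∧ ∑ p ∈ S, γ p • p = 0 ∧
        (∀ p ∈ S, 0 < γ p → 0 < δ p) ∧ ∀ p ∈ S, γ p < 0 → δ p < 0 := by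
  classical
  intro r
  induction r with
  | zero =>
    rintro δ hr ⟨p, hp, hp'⟩ _ _
    rw [Nat.le_zero, Finset.card_eq_zero] at hr
    exact absurd (Finset.mem_filter.2 ⟨hp, hp'⟩) (hr ▸ Finset.notMem_empty p)
  | succ r ih =>
    rintro δ hr ⟨p₁, hp₁, hp₁'⟩ h1 h2
    by_cases hsmall : (S.filter (fun p => δ p ≠ 0)).card ≤ Module.finrank ℝ E + 2
    · exact ⟨δ, hsmall, ⟨p₁, hp₁, hp₁'⟩, h1, h2, fun _ _ h => h, fun _ _ h => h⟩
    push Not at hsmall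
    have hp₁S : p₁ ∈ S.filter (fun p => δ p ≠ 0) := Finset.mem_filter.2 ⟨hp₁, hp₁'⟩
    set Q := (S.filter (fun p => δ p ≠ 0)).erase p₁ with hQ
    have hQS : Q ⊆ S := (Finset.erase_subset _ _).trans (Finset.filter_subset _ _)
    have hQδ : ∀ p ∈ Q, δ p ≠ 0 := fun p hp =>
      (Finset.mem_filter.1 (Finset.mem_of_mem_erase hp)).2
    -- a dependence that does not involve `p₁`
    obtain ⟨η, hη1, hη2, hη3⟩ :=
      Module.exists_nontrivial_relation_sum_zero_of_finrank_succ_lt_card (R := ℝ) (t := Q) (by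
        rw [hQ, Finset.card_erase_of_mem hp₁S]; omega)
    obtain ⟨x, hxQ, hmin⟩ := (Q.filter (fun p => η p ≠ 0)).exists_min_image
      (fun p => |δ p| / |η p|) (by
        obtain ⟨x, hx, hx'⟩ := hη3
        exact ⟨x, Finset.mem_filter.2 ⟨hx, hx'⟩⟩)
    obtain ⟨hxQ, hxη⟩ := Finset.mem_filter.1 hxQ
    set τ := δ x / η x with hτ
    set η' : E → ℝ := fun p => if p ∈ Q then η p else 0 with hη'
    have hle : ∀ p, |τ * η' p| ≤ |δ p| := fun p => by
      simp only [hη']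
      split_ifs with hp
      · by_cases hpη : η p = 0
        · simp [hpη]
        · have := hmin p (Finset.mem_filter.2 ⟨hp, hpη⟩)
          rw [hτ, abs_mul, abs_div]
          rwa [le_div_iff₀ (abs_pos.2 hpη)] at this
      · simp
    have hsum1 : ∑ p ∈ S, η' p = 0 := by
      rw [← hη2]
      simp only [hη']
      rw [Finset.sum_ite_mem, Finset.inter_eq_right.2 hQS]
    have hsum2 : ∑ p ∈ S, η' p • p = 0 := by
      rw [← hη1]
      simp only [hη', ite_smul, zero_smul]
      rw [Finset.sum_ite_mem, Finset.inter_eq_right.2 hQS]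
    have hp₁Q : p₁ ∉ Q := Finset.notMem_erase _ _
    obtain ⟨γ, g1, g2, g3, g4, g5, g6⟩ := ih (fun p => δ p - τ * η' p) (by
        have hsub : S.filter (fun p => δ p - τ * η' p ≠ 0) ⊆
            (S.filter (fun p => δ p ≠ 0)).erase x := fun p hp => by
          obtain ⟨hpS, hp⟩ := Finset.mem_filter.1 hp
          refine Finset.mem_erase.2 ⟨fun hpx => hp ?_, Finset.mem_filter.2 ⟨hpS, fun h0 => hp ?_⟩⟩
          · rw [hpx, hτ]
            simp only [hη', hxQ, if_true]
            field_simp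
            ring
          · have := hle p
            rw [h0, abs_zero] at this
            rw [abs_nonpos_iff.1 this, h0, sub_zero]
        have := Finset.card_le_card hsub
        rw [Finset.card_erase_of_mem (Finset.mem_of_mem_erase hxQ)] at this
        omega) ⟨p₁, hp₁, by simpa [hη', hp₁Q] using hp₁'⟩ (by
        rw [Finset.sum_sub_distrib, ← Finset.mul_sum, hsum1, h1]; simp) (by
        simp only [sub_smul, mul_smul, Finset.sum_sub_distrib, ← Finset.smul_sum, hsum2, h2]
        simp)
    refine ⟨γ, g1, g2, g3, g4, fun p hp hpos => ?_, fun p hp hneg => ?_⟩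
    · have h3 := g5 p hp hpos
      have h4 := hle p
      by_contra hneg
      rw [abs_of_nonpos (not_lt.1 hneg)] at h4
      have := (abs_le.1 h4).1
      linarith
    · have h3 := g6 p hp hneg
      have h4 := hle p
      by_contra hpos
      rw [abs_of_nonneg (not_lt.1 hpos)] at h4
      have := (abs_le.1 h4).2
      linarith

/-- The labels in `F` lie on a supporting hyperplane `L = r` of the polytope with vertices
`V 0, …, V (n - 1)`. -/
def IsSupported (V : ℕ → E) (n : ℕ) (F : Finset ℕ) : Prop :=
  ∃ (L : E →ₗ[ℝ] ℝ) (r : ℝ), (∀ i ∈ Finset.range n, r ≤ L (V i)) ∧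
    (∃ i ∈ Finset.range n, r < L (V i)) ∧ ∀ i ∈ F, L (V i) = r

variable {V : ℕ → E} {n : ℕ}

theorem hullOf_eq : hullOf V n = convexHull ℝ (V '' (Finset.range n : Finset ℕ)) := by
  rw [hullOf]
  congr 2
  ext i
  simp

theorem le_of_mem_hullOf {L : E →ₗ[ℝ] ℝ} {r : ℝ} (h : ∀ i ∈ Finset.range n, r ≤ L (V i)) {z : E}
    (hz : z ∈ hullOf V n) : r ≤ L z := by
  have : hullOf V n ⊆ {z | r ≤ L z} := by
    rw [hullOf_eq]
    refine convexHull_min ?_ (convex_halfSpace_ge L.isLinear r)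
    rintro _ ⟨i, hi, rfl⟩
    exact h i hi
  exact this hz

theorem convexHull_subset_hullOf {F : Finset ℕ} (hF : F ⊆ Finset.range n) :
    convexHull ℝ (V '' (F : Set ℕ)) ⊆ hullOf V n := by
  rw [hullOf_eq]
  exact convexHull_mono (Set.image_mono (by exact_mod_cast hF))

theorem mem_hullOf {i : ℕ} (hi : i ∈ Finset.range n) : V i ∈ hullOf V n := by
  rw [hullOf_eq]
  exact subset_convexHull ℝ _ ⟨i, hi, rfl⟩

theorem IsSupported.convexHull_subset_frontier {F : Finset ℕ} (hFn : F ⊆ Finset.range n)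
    (h : IsSupported V n F) : convexHull ℝ (V '' (F : Set ℕ)) ⊆ frontier (hullOf V n) := by
  obtain ⟨L, r, h1, ⟨i, hi, hi'⟩, h3⟩ := h
  intro z hz
  have hLz : L z = r := by
    have : convexHull ℝ (V '' (F : Set ℕ)) ⊆ {z | L z = r} := by
      refine convexHull_min ?_ (convex_hyperplane L.isLinear r)
      rintro _ ⟨j, hj, rfl⟩
      exact h3 j hj
    exact this hz
  refine ⟨subset_closure (convexHull_subset_hullOf hFn hz), fun hint => ?_⟩
  have hcont : Continuous (fun s : ℝ => z - s • (V i - z)) := by fun_prop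
  have hev : ∀ᶠ s in nhds (0 : ℝ), z - s • (V i - z) ∈ interior (hullOf V n) :=
    hcont.continuousAt.eventually (by simpa using isOpen_interior.mem_nhds hint)
  obtain ⟨ε, hε, hs⟩ := Metric.eventually_nhds_iff.1 hev
  have := le_of_mem_hullOf h1 (interior_subset (hs (y := ε / 2) (by
    rw [Real.dist_eq, sub_zero, abs_of_pos (by positivity)]; linarith)))
  rw [map_sub, map_smul, map_sub, hLz, smul_eq_mul] at this
  have : 0 < ε / 2 * (L (V i) - r) := mul_pos (by positivity) (by linarith)
  linarith

theorem exists_supporting_of_mem_frontier (hne : (interior (hullOf V n)).Nonempty) {z : E}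
    (hz : z ∈ frontier (hullOf V n)) :
    ∃ L : E →ₗ[ℝ] ℝ, (∀ i ∈ Finset.range n, L z ≤ L (V i)) ∧
      ∃ i ∈ Finset.range n, L z < L (V i) := by
  have hconv : Convex ℝ (hullOf V n) := convex_convexHull ℝ _
  obtain ⟨f, hf⟩ := geometric_hahn_banach_point_open hconv.interior isOpen_interior hz.2
  have hle : ∀ x ∈ hullOf V n, f z ≤ f x := by
    intro x hx
    have h1 : x ∈ closure (interior (hullOf V n)) := by
      rw [hconv.closure_interior_eq_closure_of_nonempty_interior hne]
      exact subset_closure hx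
    have h2 : closure (interior (hullOf V n)) ⊆ {x | f z ≤ f x} :=
      closure_minimal (fun y hy => (hf y hy).le) (isClosed_le continuous_const f.continuous)
    exact h2 h1
  refine ⟨f, fun i hi => hle _ (mem_hullOf hi), ?_⟩
  by_contra hall
  push Not at hall
  obtain ⟨y, hy⟩ := hne
  have h1 : hullOf V n ⊆ {x | f x ≤ f z} := by
    rw [hullOf_eq]
    refine convexHull_min ?_ (convex_halfSpace_le f.isLinear _)
    rintro _ ⟨i, hi, rfl⟩
    exact hall i hi
  exact absurd (hf y hy) (not_lt.2 (h1 (interior_subset hy)))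

theorem LinearIndepOn.eq_zero_of_sum {Z : Finset ℕ}
    (h : LinearIndepOn ℝ (fun i => ((1 : ℝ), V i)) (Z : Set ℕ)) {c : ℕ → ℝ}
    (h1 : ∑ i ∈ Z, c i = 0) (h2 : ∑ i ∈ Z, c i • V i = 0) : ∀ i ∈ Z, c i = 0 := by
  refine linearIndepOn_finset_iff.1 h c ?_
  ext1
  · simpa [Prod.fst_sum] using h1
  · simpa [Prod.snd_sum] using h2

theorem LinearIndepOn.injOn_of_one_prod {Z : Finset ℕ}
    (h : LinearIndepOn ℝ (fun i => ((1 : ℝ), V i)) (Z : Set ℕ)) : Set.InjOn V (Z : Set ℕ) :=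
  fun i hi j hj hij => h.injOn hi hj (by simp only [hij])

theorem LinearIndepOn.affineIndependent_image [DecidableEq E] {Z : Finset ℕ}
    (h : LinearIndepOn ℝ (fun i => ((1 : ℝ), V i)) (Z : Set ℕ)) :
    AffineIndependent ℝ ((↑) : ↥(Z.image V) → E) := by
  have hinj := h.injOn_of_one_prod
  have key : AffineIndependent ℝ (fun i : (Z : Set ℕ) => V i) := by
    rw [affineIndependent_iff]
    intro s w h1 h2 i hi
    have := linearIndependent_iff'.1 h s w (by
      ext1
      · simpa [Prod.fst_sum] using h1
      · simpa [Prod.snd_sum] using h2) i hi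
    exact this
  have h2 := key.range
  have h3 : Set.range (fun i : (Z : Set ℕ) => V i) = ((Z.image V : Finset E) : Set E) := by
    ext x; simp
  rw [h3] at h2
  exact h2

end Triangulations

/-! ### Stacked triangulations -/

section StackedTriangulations

variable {E : Type*} [NormedAddCommGroup E] [NormedSpace ℝ E] {V : ℕ → E} {n m j : ℕ}

/-- All supporting hyperplanes of the polytope with vertices `V 0, …, V (n - 1)` contain an affinely
independent set of vertices. Affine independence is expressed as linear independence
of the homogenized points. -/
def IsSimplicialHull (V : ℕ → E) (n : ℕ) : Prop :=
  ∀ Z ⊆ Finset.range n, IsSupported V n Z →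
    LinearIndepOn ℝ (fun i => ((1 : ℝ), V i)) (Z : Set ℕ)

/-- A vertex set of a simplex all of whose faces in the interior of the polytope have dimension at
least `m - j`. -/
def IsStackedSimplex (V : ℕ → E) (n m j : ℕ) (s : Finset E) : Prop :=
  AffineIndependent ℝ ((↑) : s → E) ∧ (s : Set E) ⊆ V '' (Finset.range n : Finset ℕ) ∧
    ∀ t ⊆ s, t.Nonempty → ¬ convexHull ℝ (t : Set E) ⊆ frontier (hullOf V n) → m + 1 ≤ t.card + j

/-- For small `j`, two stacked simplices intersect in a common face: otherwise they
contain the parts of a Radon partition of at most `m + 2` vertices. One of the parts is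
so small that it lies in the boundary, and then all vertices of the partition lie in a common
supporting hyperplane, where vertices are affinely independent. -/
theorem IsStackedSimplex.inter_subset_convexHull [FiniteDimensional ℝ E]
    (hsimp : IsSimplicialHull V n) (hne : (interior (hullOf V n)).Nonempty)
    (hm : Module.finrank ℝ E = m) (hj : 2 * j < m) {s t : Finset E}
    (hs : IsStackedSimplex V n m j s) (ht : IsStackedSimplex V n m j t) :
    convexHull ℝ (s : Set E) ∩ convexHull ℝ (t : Set E) ⊆ convexHull ℝ (s ∩ t : Set E) := by
  classical
  rintro z ⟨hzs, hzt⟩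
  by_contra hz
  obtain ⟨c, hc0, hc1, hcz⟩ := Finset.mem_convexHull'.1 hzs
  obtain ⟨e, he0, he1, hez⟩ := Finset.mem_convexHull'.1 hzt
  set c' : E → ℝ := fun p => if p ∈ s then c p else 0 with hc'
  set e' : E → ℝ := fun p => if p ∈ t then e p else 0 with he'
  have hc'1 : ∑ p ∈ s ∪ t, c' p = 1 := by
    simp only [hc']
    rw [Finset.sum_ite_mem, Finset.union_inter_cancel_left, hc1]
  have he'1 : ∑ p ∈ s ∪ t, e' p = 1 := by
    simp only [he']
    rw [Finset.sum_ite_mem, Finset.union_inter_cancel_right, he1]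
  have hc'z : ∑ p ∈ s ∪ t, c' p • p = z := by
    simp only [hc', ite_smul, zero_smul]
    rw [Finset.sum_ite_mem, Finset.union_inter_cancel_left, hcz]
  have he'z : ∑ p ∈ s ∪ t, e' p • p = z := by
    simp only [he', ite_smul, zero_smul]
    rw [Finset.sum_ite_mem, Finset.union_inter_cancel_right, hez]
  have hc'0 : ∀ p, 0 ≤ c' p := fun p => by
    simp only [hc']; split_ifs with h; exacts [hc0 p h, le_rfl]
  have he'0 : ∀ p, 0 ≤ e' p := fun p => by
    simp only [he']; split_ifs with h; exacts [he0 p h, le_rfl]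
  have hneq : ∃ p ∈ s ∪ t, c' p - e' p ≠ 0 := by
    by_contra hall
    push Not at hall
    refine hz ?_
    have hsupp : ∀ p ∈ s, p ∉ t → c p = 0 := fun p hp hpt => by
      have := hall p (Finset.mem_union_left _ hp)
      simpa [hc', he', hp, hpt] using this
    rw [← Finset.coe_inter, Finset.mem_convexHull']
    refine ⟨c, fun p hp => hc0 p (Finset.mem_inter.1 hp).1, ?_, ?_⟩
    · rw [← hc1]
      exact Finset.sum_subset Finset.inter_subset_left fun p hp hp' =>
        hsupp p hp fun h => hp' (Finset.mem_inter.2 ⟨hp, h⟩)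
    · rw [← hcz]
      exact Finset.sum_subset Finset.inter_subset_left fun p hp hp' => by
        rw [hsupp p hp fun h => hp' (Finset.mem_inter.2 ⟨hp, h⟩), zero_smul]
  obtain ⟨γ, g1, ⟨p₀, hp₀, hp₀'⟩, g3, g4, g5, g6⟩ := exists_affine_dependence_card_le (s ∪ t) _
    (fun p => c' p - e' p) le_rfl hneq (by rw [Finset.sum_sub_distrib, hc'1, he'1, sub_self])
    (by simp only [sub_smul, Finset.sum_sub_distrib, hc'z, he'z, sub_self])
  set A := (s ∪ t).filter (fun p => 0 < γ p) with hA
  set B := (s ∪ t).filter (fun p => γ p < 0) with hB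
  have hAs : A ⊆ s := fun p hp => by
    obtain ⟨hp, hp'⟩ := Finset.mem_filter.1 hp
    by_contra hps
    have h1 := g5 p hp hp'
    have h2 := he'0 p
    simp only [hc', hps, if_false] at h1
    linarith
  have hBt : B ⊆ t := fun p hp => by
    obtain ⟨hp, hp'⟩ := Finset.mem_filter.1 hp
    by_contra hpt
    have h1 := g6 p hp hp'
    have h2 := hc'0 p
    simp only [he', hpt, if_false] at h1
    linarith
  have hdisj : Disjoint A B := by
    rw [Finset.disjoint_left]
    intro p h1 h2
    have h3 := (Finset.mem_filter.1 h1).2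
    have h4 := (Finset.mem_filter.1 h2).2
    linarith
  have hABsub : A ∪ B ⊆ s ∪ t :=
    Finset.union_subset (Finset.filter_subset _ _) (Finset.filter_subset _ _)
  have hABzero : ∀ p ∈ s ∪ t, p ∉ A ∪ B → γ p = 0 := fun p hp hp' => by
    simp only [hA, hB, Finset.mem_union, Finset.mem_filter, not_or, not_and, not_lt] at hp hp'
    exact le_antisymm (hp'.1 hp) (hp'.2 hp)
  have hcard : A.card + B.card ≤ m + 2 := by
    rw [← Finset.card_union_of_disjoint hdisj, ← hm]
    refine (Finset.card_le_card fun p hp => ?_).trans g1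
    refine Finset.mem_filter.2 ⟨hABsub hp, ?_⟩
    rcases Finset.mem_union.1 hp with hp | hp
    · exact (Finset.mem_filter.1 hp).2.ne'
    · exact (Finset.mem_filter.1 hp).2.ne
  have hsum : ∑ p ∈ A, γ p = ∑ p ∈ B, -γ p := by
    rw [← Finset.sum_subset hABsub hABzero, Finset.sum_union hdisj] at g3
    rw [Finset.sum_neg_distrib]
    linarith
  have hsumv : ∑ p ∈ A, γ p • p = ∑ p ∈ B, (-γ p) • p := by
    rw [← Finset.sum_subset hABsub (fun p hp hp' => by rw [hABzero p hp hp', zero_smul]),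
      Finset.sum_union hdisj] at g4
    simp only [neg_smul, Finset.sum_neg_distrib]
    exact eq_neg_of_add_eq_zero_left g4
  have hAne : A.Nonempty := by
    by_contra hAe
    rw [Finset.not_nonempty_iff_eq_empty] at hAe
    have hBe : ∀ p ∈ B, -γ p = 0 := by
      rw [hAe, Finset.sum_empty] at hsum
      exact (Finset.sum_eq_zero_iff_of_nonneg fun p hp =>
        (neg_pos.2 (Finset.mem_filter.1 hp).2).le).1 hsum.symm
    refine hp₀' ?_
    by_cases h : p₀ ∈ A ∪ B
    · rw [hAe, Finset.empty_union] at h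
      exact neg_eq_zero.1 (hBe p₀ h)
    · exact hABzero p₀ hp₀ h
  set Λ := ∑ p ∈ A, γ p with hΛ
  have hΛ0 : 0 < Λ := Finset.sum_pos (fun p hp => (Finset.mem_filter.1 hp).2) hAne
  have hBne : B.Nonempty := by
    by_contra hBe
    rw [Finset.not_nonempty_iff_eq_empty] at hBe
    rw [hBe, Finset.sum_empty] at hsum
    exact hΛ0.ne' hsum
  -- the common point of the two parts of the Radon partition
  set y : E := Λ⁻¹ • ∑ p ∈ A, γ p • p with hy
  have hyA : y ∈ convexHull ℝ (A : Set E) := by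
    rw [Finset.mem_convexHull']
    refine ⟨fun p => Λ⁻¹ * γ p, fun p hp => ?_, ?_, ?_⟩
    · exact mul_nonneg (inv_pos.2 hΛ0).le (Finset.mem_filter.1 hp).2.le
    · rw [← Finset.mul_sum, ← hΛ, inv_mul_cancel₀ hΛ0.ne']
    · simp only [mul_smul, ← Finset.smul_sum, hy]
  have hyB : y ∈ convexHull ℝ (B : Set E) := by
    rw [Finset.mem_convexHull']
    refine ⟨fun p => Λ⁻¹ * -γ p, fun p hp => ?_, ?_, ?_⟩
    · exact mul_nonneg (inv_pos.2 hΛ0).le (neg_pos.2 (Finset.mem_filter.1 hp).2).le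
    · rw [← Finset.mul_sum, ← hsum, inv_mul_cancel₀ hΛ0.ne']
    · simp only [mul_smul, ← Finset.smul_sum, hy, hsumv]
  have hyfr : y ∈ frontier (hullOf V n) := by
    by_cases hAfr : convexHull ℝ (A : Set E) ⊆ frontier (hullOf V n)
    · exact hAfr hyA
    · by_cases hBfr : convexHull ℝ (B : Set E) ⊆ frontier (hullOf V n)
      · exact hBfr hyB
      · have h1 := hs.2.2 A hAs hAne hAfr
        have h2 := ht.2.2 B hBt hBne hBfr
        omega
  obtain ⟨L, hL1, hL2⟩ := exists_supporting_of_mem_frontier hne hyfr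
  have hLV : ∀ p ∈ s ∪ t, L y ≤ L p := fun p hp => by
    rcases Finset.mem_union.1 hp with hp | hp
    · obtain ⟨i, hi, rfl⟩ := hs.2.1 hp
      exact hL1 i hi
    · obtain ⟨i, hi, rfl⟩ := ht.2.1 hp
      exact hL1 i hi
  have hface : ∀ (D : Finset E) (g : E → ℝ), D ⊆ s ∪ t → (∀ p ∈ D, 0 < g p) →
      ∑ p ∈ D, g p = Λ → Λ⁻¹ • ∑ p ∈ D, g p • p = y → ∀ p ∈ D, L p = L y := by
    intro D g hD hg hg1 hg2
    have h0 : ∑ p ∈ D, g p * (L p - L y) = 0 := by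
      have h1 : ∑ p ∈ D, g p • p = Λ • y := by
        rw [← hg2, smul_smul, mul_inv_cancel₀ hΛ0.ne', one_smul]
      have h2 := congrArg L h1
      rw [map_sum, map_smul, smul_eq_mul] at h2
      simp only [map_smul, smul_eq_mul] at h2
      simp only [mul_sub, Finset.sum_sub_distrib, h2, ← Finset.sum_mul, hg1, sub_self]
    intro p hp
    have h3 := (Finset.sum_eq_zero_iff_of_nonneg fun p hp =>
      mul_nonneg (hg p hp).le (sub_nonneg.2 (hLV p (hD hp)))).1 h0 p hp
    exact sub_eq_zero.1 ((mul_eq_zero.1 h3).resolve_left (hg p hp).ne')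
  have hLA := hface A γ (Finset.filter_subset _ _) (fun p hp => (Finset.mem_filter.1 hp).2) rfl rfl
  have hLB := hface B (fun p => -γ p) (Finset.filter_subset _ _)
    (fun p hp => neg_pos.2 (Finset.mem_filter.1 hp).2) hsum.symm (by rw [hy, hsumv])
  set Z := (Finset.range n).filter (fun i => L (V i) = L y) with hZ
  have hZind := hsimp Z (Finset.filter_subset _ _) ⟨L, L y, hL1, hL2,
    fun i hi => (Finset.mem_filter.1 hi).2⟩
  have hABZ : A ∪ B ⊆ Z.image V := fun p hp => by
    have hLp : L p = L y := by
      rcases Finset.mem_union.1 hp with hp | hp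
      · exact hLA p hp
      · exact hLB p hp
    have : p ∈ V '' (Finset.range n : Finset ℕ) := by
      rcases Finset.mem_union.1 (hABsub hp) with hp | hp
      · exact hs.2.1 hp
      · exact ht.2.1 hp
    obtain ⟨i, hi, rfl⟩ := this
    exact Finset.mem_image_of_mem _ (Finset.mem_filter.2 ⟨hi, hLp⟩)
  have hABind : AffineIndependent ℝ ((↑) : ↥(A ∪ B) → E) :=
    AffineIndependent.mono hZind.affineIndependent_image (by exact_mod_cast hABZ)
  obtain ⟨p, hp⟩ := hAne
  have := hABind.eq_zero_of_sum_eq_zero_subtype (w := γ)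
    (by rw [Finset.sum_subset hABsub hABzero, g3])
    (by rw [Finset.sum_subset hABsub
      (fun p hp hp' => by rw [hABzero p hp hp', zero_smul]), g4]) p (Finset.mem_union_left _ hp)
  exact (Finset.mem_filter.1 hp).2.ne' this

/-- In a simplicial polytope, a set of vertices on a supporting hyperplane is the vertex set
of a face. -/
theorem IsSupported.exists_exact (hsimp : IsSimplicialHull V n) {F : Finset ℕ}
    (hF : F ⊆ Finset.range n) (h : IsSupported V n F) :
    ∃ (L : E →ₗ[ℝ] ℝ) (r : ℝ), (∀ i ∈ F, L (V i) = r) ∧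
      (∀ i ∈ Finset.range n, i ∉ F → r < L (V i)) ∧ ∃ i ∈ Finset.range n, i ∉ F := by
  obtain ⟨L, r, h1, ⟨i₀, hi₀, hi₀'⟩, h3⟩ := h
  set Z := (Finset.range n).filter (fun i => L (V i) = r) with hZ
  have hZind := hsimp Z (Finset.filter_subset _ _) ⟨L, r, h1, ⟨i₀, hi₀, hi₀'⟩,
    fun i hi => (Finset.mem_filter.1 hi).2⟩
  obtain ⟨g, hg⟩ := hZind.exists_dual_eq (fun i => if i ∈ F then 0 else 1)
  -- the functional is changed slightly in favour of the vertices of the facet outside `F`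
  have hev : ∀ᶠ ε : ℝ in nhdsWithin 0 (Set.Ioi 0), ∀ i ∈ Finset.range n, r < L (V i) →
      0 < L (V i) - r + ε * g (1, V i) := by
    rw [Filter.eventually_all_finset]
    intro i _
    by_cases hi : r < L (V i)
    · have hcont : Continuous (fun ε : ℝ => L (V i) - r + ε * g (1, V i)) := by fun_prop
      have := (hcont.continuousAt (x := (0 : ℝ))).eventually
        (isOpen_Ioi.mem_nhds (show L (V i) - r + 0 * g (1, V i) ∈ Set.Ioi 0 by
          rw [Set.mem_Ioi]; linarith))
      exact (this.filter_mono nhdsWithin_le_nhds).mono fun ε hε _ => hε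
    · exact Filter.Eventually.of_forall fun _ h' => absurd h' hi
  obtain ⟨ε, hε, hε0⟩ := (hev.and self_mem_nhdsWithin).exists
  have hval : ∀ x, (L + ε • (g ∘ₗ LinearMap.inr ℝ ℝ E)) x = L x + ε * g (1, x) - ε * g (1, 0) := by
    intro x
    have : ((1 : ℝ), x) = (1, 0) + (0, x) := by simp
    rw [this, map_add]
    simp
    ring
  refine ⟨L + ε • (g ∘ₗ LinearMap.inr ℝ ℝ E), r - ε * g (1, 0), fun i hi => ?_,
    fun i hi hiF => ?_, i₀, hi₀, fun h' => ?_⟩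
  · have := hg i (Finset.mem_filter.2 ⟨hF hi, h3 i hi⟩)
    rw [if_pos hi] at this
    rw [hval, h3 i hi, this]
    ring
  · rw [hval]
    rcases (h1 i hi).eq_or_lt with heq | hlt
    · have := hg i (Finset.mem_filter.2 ⟨hi, heq.symm⟩)
      rw [if_neg hiF] at this
      rw [← heq, this]
      linarith
    · have := hε i hi hlt
      linarith
  · rw [h3 i₀ h'] at hi₀'
    exact lt_irrefl _ hi₀'

theorem IsSupported.isBoundaryFace [FiniteDimensional ℝ E] (hsimp : IsSimplicialHull V n)
    {F : Finset ℕ} (hF : F ⊆ Finset.range n) (h : IsSupported V n F) : IsBoundaryFace V n F := by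
  obtain ⟨L, r, h1, h2, i₀, hi₀, hi₀F⟩ := h.exists_exact hsimp hF
  have hle : ∀ i ∈ Finset.range n, r ≤ L (V i) := fun i hi => by
    by_cases hiF : i ∈ F
    · exact (h1 i hiF).ge
    · exact (h2 i hi hiF).le
  have hLF : ∀ x ∈ convexHull ℝ (V '' (F : Set ℕ)), L x = r := fun x hx => by
    have : convexHull ℝ (V '' (F : Set ℕ)) ⊆ {z | L z = r} := by
      refine convexHull_min ?_ (convex_hyperplane L.isLinear r)
      rintro _ ⟨i, hi, rfl⟩
      exact h1 i hi
    exact this hx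
  refine ⟨hF, fun ⟨x₀, hx₀⟩ => ⟨-LinearMap.toContinuousLinearMap L, ?_⟩, fun heq => ?_⟩
  · ext x
    simp only [Set.mem_ofPred_eq, neg_apply,
      LinearMap.coe_toContinuousLinearMap', neg_le_neg_iff]
    constructor
    · intro hx
      refine ⟨convexHull_subset_hullOf hF hx, fun y hy => ?_⟩
      rw [hLF x hx]
      exact le_of_mem_hullOf hle hy
    · rintro ⟨hx, hmax⟩
      have hLx : L x = r := le_antisymm
        ((hmax x₀ (convexHull_subset_hullOf hF hx₀)).trans (hLF x₀ hx₀).le)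
        (le_of_mem_hullOf hle hx)
      rw [hullOf_eq] at hx
      obtain ⟨c, hc0, hc1, hcx⟩ := mem_convexHull_image_finset_iff.1 hx
      have h0 : ∑ i ∈ Finset.range n, c i * (L (V i) - r) = 0 := by
        rw [← hcx, map_sum] at hLx
        simp only [map_smul, smul_eq_mul] at hLx
        simp only [mul_sub, Finset.sum_sub_distrib, hLx, ← Finset.sum_mul, hc1, one_mul, sub_self]
      have hzero : ∀ i ∈ Finset.range n, i ∉ F → c i = 0 := fun i hi hiF => by
        have := (Finset.sum_eq_zero_iff_of_nonneg fun i hi =>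
          mul_nonneg (hc0 i hi) (sub_nonneg.2 (hle i hi))).1 h0 i hi
        exact (mul_eq_zero.1 this).resolve_right (sub_pos.2 (h2 i hi hiF)).ne'
      refine mem_convexHull_image_finset_iff.2 ⟨c, fun i hi => hc0 i (hF hi), ?_, ?_⟩
      · rw [← hc1]; exact Finset.sum_subset hF hzero
      · rw [← hcx]
        exact Finset.sum_subset hF fun i hi hiF => by rw [hzero i hi hiF, zero_smul]
  · have := hLF (V i₀) (heq ▸ mem_hullOf hi₀)
    exact (h2 i₀ hi₀ hi₀F).ne' this

theorem IsBoundaryFace.isSupported {F : Finset ℕ} (h : IsBoundaryFace V n F) (hne : F.Nonempty) :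
    IsSupported V n F := by
  obtain ⟨hF, hexp, hneq⟩ := h
  obtain ⟨i₁, hi₁⟩ := hne
  have hV : ∀ i ∈ F, V i ∈ convexHull ℝ (V '' (F : Set ℕ)) := fun i hi =>
    subset_convexHull ℝ _ ⟨i, hi, rfl⟩
  obtain ⟨l, hl⟩ := hexp ⟨_, hV i₁ hi₁⟩
  have hmax : ∀ i ∈ F, ∀ y ∈ hullOf V n, l y ≤ l (V i) := fun i hi => by
    have := hV i hi
    rw [hl] at this
    exact this.2
  refine ⟨-(l : E →ₗ[ℝ] ℝ), -l (V i₁), fun i hi => ?_, ?_, fun i hi => ?_⟩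
  · simpa using hmax i₁ hi₁ _ (mem_hullOf hi)
  · by_contra hall
    push Not at hall
    refine hneq (Set.Subset.antisymm (convexHull_subset_hullOf hF) ?_)
    rw [hullOf_eq]
    refine convexHull_min ?_ (convex_convexHull ℝ _)
    rintro _ ⟨i, hi, rfl⟩
    rw [hl]
    refine ⟨mem_hullOf hi, fun y hy => (hmax i₁ hi₁ y hy).trans ?_⟩
    have := hall i hi
    simpa using this
  · have h1 := hmax i hi _ (mem_hullOf (hF hi₁))
    have h2 := hmax i₁ hi₁ _ (mem_hullOf (hF hi))
    simp only [LinearMap.neg_apply, ContinuousLinearMap.coe_coe, neg_inj]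
    exact le_antisymm h2 h1

theorem IsSupported.mem_extremePoints [FiniteDimensional ℝ E] (hsimp : IsSimplicialHull V n)
    {i : ℕ} (hi : i ∈ Finset.range n) (h : IsSupported V n {i}) :
    V i ∈ (hullOf V n).extremePoints ℝ := by
  have h1 := (h.isBoundaryFace hsimp (by simpa using hi)).2.1
  rw [Finset.coe_singleton, Set.image_singleton, convexHull_singleton] at h1
  exact h1.isExtreme.mem_extremePoints

/-- A simplex that meets the faces of a complex properly and is covered by that complex is one
of its faces: a face that contains the barycentre has to contain all vertices. -/
theorem exists_superset_of_inter_subset_convexHull [DecidableEq E] {s : Finset E} (hs : s.Nonempty)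
    (hind : AffineIndependent ℝ ((↑) : s → E)) {T : Set (Finset E)}
    (hcov : ∀ z ∈ convexHull ℝ (s : Set E), ∃ t ∈ T, z ∈ convexHull ℝ (t : Set E))
    (hinter : ∀ t ∈ T, convexHull ℝ (s : Set E) ∩ convexHull ℝ (t : Set E) ⊆
      convexHull ℝ (s ∩ t : Set E)) : ∃ t ∈ T, s ⊆ t := by
  have hc : (0 : ℝ) < s.card := by exact_mod_cast Finset.card_pos.2 hs
  have hsum : ∑ _p ∈ s, (s.card : ℝ)⁻¹ = 1 := by
    rw [Finset.sum_const, nsmul_eq_mul, mul_inv_cancel₀ hc.ne']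
  have hz : ∑ p ∈ s, (s.card : ℝ)⁻¹ • p ∈ convexHull ℝ (s : Set E) :=
    Finset.mem_convexHull'.2 ⟨fun _ => (s.card : ℝ)⁻¹, fun _ _ => (inv_pos.2 hc).le, hsum, rfl⟩
  obtain ⟨t, ht, hzt⟩ := hcov _ hz
  refine ⟨t, ht, fun p hp => ?_⟩
  have h1 := hinter t ht ⟨hz, hzt⟩
  rw [← Finset.coe_inter, Finset.mem_convexHull'] at h1
  obtain ⟨c, -, hc1, hcz⟩ := h1
  by_contra hpt
  have := hind.eq_of_sum_eq_sum_subtype (w₁ := fun p => if p ∈ s ∩ t then c p else 0)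
    (w₂ := fun _ => (s.card : ℝ)⁻¹) (by
      rw [hsum, Finset.sum_ite_mem, Finset.inter_eq_right.2 Finset.inter_subset_left, hc1]) (by
      simp only [ite_smul, zero_smul]
      rw [Finset.sum_ite_mem, Finset.inter_eq_right.2 Finset.inter_subset_left, hcz]) p hp
  simp only [Finset.mem_inter, hpt, and_false, if_false] at this
  exact (inv_pos.2 hc).ne this

/-- The vertex sets `Y`, described by a predicate on sets of labels, of the full-dimensional
simplices of a `j`-stacked triangulation of a simplicial `m`-polytope. -/
structure IsStackedSystem (V : ℕ → E) (n m j : ℕ) (P : Finset ℕ → Prop) : Prop where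
  simplicial : IsSimplicialHull V n
  subset_range : ∀ Y, P Y → Y ⊆ Finset.range n
  indep : ∀ Y, P Y → LinearIndepOn ℝ (fun i => ((1 : ℝ), V i)) (Y : Set ℕ)
  card_eq : ∀ Y, P Y → Y.card = m + 1
  supported : ∀ Y, P Y → ∀ F ⊆ Y, F.card + j < m + 1 → IsSupported V n F
  exists_mem : ∀ i ∈ Finset.range n, ∃ Y, P Y ∧ i ∈ Y
  exists_mem_convexHull : ∀ z ∈ hullOf V n, ∃ Y, P Y ∧ z ∈ convexHull ℝ (V '' (Y : Set ℕ))

namespace IsStackedSystem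

variable {P : Finset ℕ → Prop}

theorem interior_nonempty [FiniteDimensional ℝ E] (h : IsStackedSystem V n m j P)
    (hm : Module.finrank ℝ E = m) (hn : 0 < n) : (interior (hullOf V n)).Nonempty := by
  classical
  obtain ⟨Y, hY, -⟩ := h.exists_mem 0 (by simpa using hn)
  have hind := (h.indep Y hY).affineIndependent_image
  have htop := hind.affineSpan_eq_top_iff_card_eq_finrank_add_one.2 (by
    rw [Fintype.card_coe, Finset.card_image_of_injOn (h.indep Y hY).injOn_of_one_prod,
      h.card_eq Y hY, hm])
  have hsub : ((Y.image V : Finset E) : Set E) ⊆ hullOf V n := fun x hx => by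
    obtain ⟨i, hi, rfl⟩ := Finset.mem_image.1 (Finset.mem_coe.1 hx)
    exact mem_hullOf (h.subset_range Y hY hi)
  have h1 : (interior (convexHull ℝ ((Y.image V : Finset E) : Set E))).Nonempty := by
    rw [interior_convexHull_nonempty_iff_affineSpan_eq_top, ← htop]
    congr 1
    ext x
    simp
  exact h1.mono (interior_mono (convexHull_min hsub (convex_convexHull ℝ _)))

theorem isSupported_singleton (h : IsStackedSystem V n m j P) (hj : 2 * j < m) {i : ℕ}
    (hi : i ∈ Finset.range n) : IsSupported V n {i} := by
  obtain ⟨Y, hY, hiY⟩ := h.exists_mem i hi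
  exact h.supported Y hY {i} (by simpa using hiY) (by rw [Finset.card_singleton]; omega)

theorem injOn (h : IsStackedSystem V n m j P) (hj : 2 * j < m) :
    Set.InjOn V (Finset.range n : Finset ℕ) := by
  intro i hi i' hi' heq
  obtain ⟨L, r, h1, h2, h3⟩ := h.isSupported_singleton hj hi
  have hr := h3 i (by simp)
  have hind := h.simplicial {i, i'} (by
    intro x hx
    rcases Finset.mem_insert.1 hx with rfl | hx
    · exact hi
    · rw [Finset.mem_singleton.1 hx]; exact hi') ⟨L, r, h1, h2, fun x hx => by
      rcases Finset.mem_insert.1 hx with rfl | hx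
      · exact hr
      · rw [Finset.mem_singleton.1 hx, ← heq]; exact hr⟩
  exact hind.injOn_of_one_prod (by simp) (by simp) heq

theorem isStackedSimplex [DecidableEq E] (h : IsStackedSystem V n m j P) {Y : Finset ℕ} (hY : P Y)
    {s : Finset E} (hs : s ⊆ Y.image V) : IsStackedSimplex V n m j s := by
  refine ⟨AffineIndependent.mono (h.indep Y hY).affineIndependent_image (by exact_mod_cast hs),
    fun x hx => ?_, fun t hts _ htf => ?_⟩
  · obtain ⟨i, hi, rfl⟩ := Finset.mem_image.1 (hs hx)
    exact ⟨i, h.subset_range Y hY hi, rfl⟩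
  · obtain ⟨F, hFY, rfl⟩ := Finset.subset_image_iff.1 (hts.trans hs)
    by_contra hlt
    refine htf ?_
    rw [Finset.coe_image]
    refine IsSupported.convexHull_subset_frontier (hFY.trans (h.subset_range Y hY))
      (h.supported Y hY F hFY ?_)
    rw [Finset.card_image_of_injOn ((h.indep Y hY).injOn_of_one_prod.mono
      (by exact_mod_cast hFY))] at hlt
    omega

/-- The simplicial complex generated by the sets of a stacked system. -/
noncomputable def complex [DecidableEq E] [FiniteDimensional ℝ E] (h : IsStackedSystem V n m j P)
    (hm : Module.finrank ℝ E = m) (hj : 2 * j < m) : Geometry.SimplicialComplex ℝ E where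
  faces := {s | s.Nonempty ∧ ∃ Y, P Y ∧ s ⊆ Y.image V}
  isRelLowerSet_faces := by
    rintro s ⟨hs, Y, hY, hsY⟩
    exact ⟨hs, fun t hts ht => ⟨ht, Y, hY, hts.trans hsY⟩⟩
  indep := by
    rintro s ⟨-, Y, hY, hsY⟩
    exact (h.isStackedSimplex hY hsY).1
  inter_subset_convexHull := by
    rintro s t ⟨-, Y, hY, hsY⟩ ⟨-, Y', hY', htY'⟩
    have hn : 0 < n := by
      have h1 : 0 < Y.card := by rw [h.card_eq Y hY]; omega
      obtain ⟨i, hi⟩ := Finset.card_pos.1 h1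
      have := h.subset_range Y hY hi
      simp at this
      omega
    exact IsStackedSimplex.inter_subset_convexHull h.simplicial (h.interior_nonempty hm hn) hm hj
      (h.isStackedSimplex hY hsY) (h.isStackedSimplex hY' htY')

variable [DecidableEq E] [FiniteDimensional ℝ E]

theorem isStackedTriangulation_complex (h : IsStackedSystem V n m j P)
    (hm : Module.finrank ℝ E = m) (hj : 2 * j < m) :
    IsStackedTriangulation m j (hullOf V n) (h.complex hm hj) := by
  refine ⟨⟨?_, ?_⟩, ?_⟩
  · ext z
    rw [Geometry.SimplicialComplex.mem_space_iff]
    constructor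
    · rintro ⟨s, ⟨-, Y, hY, hsY⟩, hz⟩
      refine convexHull_subset_hullOf (h.subset_range Y hY) (convexHull_mono ?_ hz)
      rw [← Finset.coe_image]
      exact_mod_cast hsY
    · intro hz
      obtain ⟨Y, hY, hzY⟩ := h.exists_mem_convexHull z hz
      refine ⟨Y.image V, ⟨?_, Y, hY, subset_rfl⟩, by rwa [Finset.coe_image]⟩
      have h1 : 0 < Y.card := by rw [h.card_eq Y hY]; omega
      exact (Finset.card_pos.1 h1).image V
  · rintro x ⟨-, Y, hY, hxY⟩
    obtain ⟨i, hi, rfl⟩ := Finset.mem_image.1 (hxY (Finset.mem_singleton_self x))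
    exact (h.isSupported_singleton hj (h.subset_range Y hY hi)).mem_extremePoints h.simplicial
      (h.subset_range Y hY hi)
  · rintro s ⟨hs, Y, hY, hsY⟩ hfr
    exact (h.isStackedSimplex hY hsY).2.2 s subset_rfl hs hfr

/-- The complex of a stacked system is the only stacked triangulation of the polytope: any two
stacked triangulations have simplices that intersect in common faces. -/
theorem eq_complex (h : IsStackedSystem V n m j P) (hm : Module.finrank ℝ E = m) (hj : 2 * j < m)
    (hn : 0 < n) {S : Geometry.SimplicialComplex ℝ E}
    (hS : IsStackedTriangulation m j (hullOf V n) S) : S = h.complex hm hj := by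
  have hne := h.interior_nonempty hm hn
  obtain ⟨⟨hspace, hvert⟩, hstack⟩ := hS
  have hgood : ∀ s ∈ S.faces, IsStackedSimplex V n m j s := fun s hs => by
    refine ⟨S.indep hs, fun x hx => ?_, fun t hts ht hfr => hstack t (S.down_closed hs hts ht) hfr⟩
    have h1 : x ∈ S.vertices := S.down_closed hs (Finset.singleton_subset_iff.2 hx) (by simp)
    have h2 := hvert h1
    rw [hullOf_eq] at h2
    exact extremePoints_convexHull_subset h2
  obtain ⟨⟨hspace', -⟩, -⟩ := h.isStackedTriangulation_complex hm hj
  have hgood' : ∀ s ∈ (h.complex hm hj).faces, IsStackedSimplex V n m j s := by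
    rintro s ⟨-, Y, hY, hsY⟩
    exact h.isStackedSimplex hY hsY
  have key : ∀ S₁ S₂ : Geometry.SimplicialComplex ℝ E, S₁.space = hullOf V n →
      S₂.space = hullOf V n → (∀ s ∈ S₁.faces, IsStackedSimplex V n m j s) →
      (∀ s ∈ S₂.faces, IsStackedSimplex V n m j s) → S₁.faces ⊆ S₂.faces := by
    intro S₁ S₂ h1 h2 hg1 hg2 s hs
    have hsne := S₁.nonempty_of_mem_faces hs
    obtain ⟨t, ht, hst⟩ := exists_superset_of_inter_subset_convexHull hsne (S₁.indep hs)
      (T := S₂.faces) (fun z hz => by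
        have : z ∈ S₂.space := by
          rw [h2, ← h1]; exact S₁.convexHull_subset_space hs hz
        exact Geometry.SimplicialComplex.mem_space_iff.1 this)
      fun t ht => IsStackedSimplex.inter_subset_convexHull h.simplicial hne hm hj (hg1 s hs)
        (hg2 t ht)
    exact S₂.down_closed ht hst hsne
  ext s
  exact ⟨fun hs => key _ _ hspace hspace' hgood hgood' hs,
    fun hs => key _ _ hspace' hspace hgood' hgood hs⟩

theorem mem_faces_complex_iff (h : IsStackedSystem V n m j P) (hm : Module.finrank ℝ E = m)
    (hj : 2 * j < m) {Y : Finset ℕ} :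
    (Y ⊆ Finset.range n ∧ Y.card = m + 1 ∧
      ∃ s ∈ (h.complex hm hj).faces, (s : Set E) = V '' (Y : Set ℕ)) ↔ P Y := by
  constructor
  · rintro ⟨hYn, hc, s, ⟨-, Y', hY', hsY'⟩, hs⟩
    have hsub : Y ⊆ Y' := fun i hi => by
      have h1 : V i ∈ (s : Set E) := hs ▸ ⟨i, hi, rfl⟩
      obtain ⟨i', hi', heq⟩ := Finset.mem_image.1 (hsY' h1)
      rwa [← h.injOn hj (h.subset_range Y' hY' hi') (hYn hi) heq]
    rwa [Finset.eq_of_subset_of_card_le hsub (by rw [hc, h.card_eq Y' hY'])]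
  · intro hY
    refine ⟨h.subset_range Y hY, h.card_eq Y hY, Y.image V, ⟨?_, Y, hY, subset_rfl⟩, by simp⟩
    have h1 : 0 < Y.card := by rw [h.card_eq Y hY]; omega
    exact (Finset.card_pos.1 h1).image V

end IsStackedSystem

end StackedTriangulations

/-! ### Coverings and missing faces -/

section MissingFaces

variable {E : Type*} [NormedAddCommGroup E] [NormedSpace ℝ E] {V : ℕ → E} {n m j : ℕ}

/-- Among the convex combinations representing a given point there is one with the largest total
weight on the labels in `T`. -/
theorem exists_maximal_weight {T : Finset ℕ} (hT : T ⊆ Finset.range n) {z : E}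
    (hz : z ∈ hullOf V n) :
    ∃ c : ℕ → ℝ, (∀ i ∈ Finset.range n, 0 ≤ c i) ∧ ∑ i ∈ Finset.range n, c i = 1 ∧
      ∑ i ∈ Finset.range n, c i • V i = z ∧
      ∀ e : ℕ → ℝ, (∀ i ∈ Finset.range n, 0 ≤ e i) → ∑ i ∈ Finset.range n, e i = 1 →
        ∑ i ∈ Finset.range n, e i • V i = z → ∑ i ∈ T, e i ≤ ∑ i ∈ T, c i := by
  set K : Set (Fin n → ℝ) := stdSimplex ℝ (Fin n) ∩ {c | ∑ i, c i • V i = z} with hK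
  have hcomp : IsCompact K := (isCompact_stdSimplex ℝ (Fin n)).inter_right
    (isClosed_eq (by fun_prop) continuous_const)
  have hmem : ∀ e : ℕ → ℝ, (∀ i ∈ Finset.range n, 0 ≤ e i) → ∑ i ∈ Finset.range n, e i = 1 →
      ∑ i ∈ Finset.range n, e i • V i = z → (fun i : Fin n => e i) ∈ K := fun e h0 h1 h2 =>
    ⟨⟨fun i => h0 i (by simp), by rw [← h1, Finset.sum_range]⟩, by
      rw [Set.mem_ofPred_eq, ← h2, Finset.sum_range]⟩
  have hT' : ∀ e : ℕ → ℝ, ∑ i ∈ T, e i = ∑ i : Fin n, if (i : ℕ) ∈ T then e i else 0 := fun e => by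
    rw [← Finset.sum_range (fun i => if i ∈ T then e i else 0), Finset.sum_ite_mem,
      Finset.inter_eq_right.2 hT]
  rw [hullOf_eq] at hz
  obtain ⟨e₀, h0, h1, h2⟩ := mem_convexHull_image_finset_iff.1 hz
  obtain ⟨c, hc, hmax⟩ := hcomp.exists_isMaxOn ⟨_, hmem e₀ h0 h1 h2⟩
    (f := fun c : Fin n → ℝ => ∑ i : Fin n, if (i : ℕ) ∈ T then c i else 0)
    (Continuous.continuousOn (continuous_finsetSum _ fun i _ => by
      split_ifs
      · exact continuous_apply i
      · exact continuous_const))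
  set c' : ℕ → ℝ := fun i => if h : i < n then c ⟨i, h⟩ else 0 with hc'
  have hcc : ∀ i : Fin n, c' i = c i := fun i => by simp [hc']
  refine ⟨c', fun i hi => ?_, ?_, ?_, fun e e0 e1 e2 => ?_⟩
  · simp only [Finset.mem_range] at hi
    simp only [hc', hi, dif_pos]
    exact hc.1.1 _
  · rw [Finset.sum_range, Finset.sum_congr rfl fun i _ => hcc i]
    exact hc.1.2
  · rw [Finset.sum_range, Finset.sum_congr rfl fun i _ => by rw [hcc i]]
    exact hc.2
  · rw [hT', hT']
    have h : (∑ i : Fin n, if (i : ℕ) ∈ T then e i else 0) ≤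
        ∑ i : Fin n, if (i : ℕ) ∈ T then c i else 0 := hmax (hmem e e0 e1 e2)
    simpa only [hcc] using h

/-- If every set of labels in `Q` contains the negative part of a dependence that is positive on a
nonempty set `T`, then every point of the polytope is a convex combination of vertices whose labels
contain no set in `Q`: the dependence could be used to increase the total weight on `T`. -/
theorem exists_mem_convexHull_of_dependence {Q : Finset ℕ → Prop} {T : Finset ℕ}
    (hT : T ⊆ Finset.range n) (hTne : T.Nonempty)
    (hQ : ∀ F, Q F → ∃ δ : ℕ → ℝ, ∑ i ∈ Finset.range n, δ i = 0 ∧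
      ∑ i ∈ Finset.range n, δ i • V i = 0 ∧ (∀ i ∈ Finset.range n, δ i < 0 → i ∈ F) ∧
      ∀ j ∈ T, 0 < δ j) {z : E} (hz : z ∈ hullOf V n) :
    ∃ H ⊆ Finset.range n, (∀ F ⊆ H, ¬ Q F) ∧ z ∈ convexHull ℝ (V '' (H : Set ℕ)) := by
  obtain ⟨c, hc0, hc1, hc2, hmax⟩ := exists_maximal_weight hT hz
  have hH : ∀ i ∈ Finset.range n, i ∉ (Finset.range n).filter (fun i => 0 < c i) → c i = 0 :=
    fun i hi hi' => le_antisymm (by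
      by_contra hlt
      exact hi' (Finset.mem_filter.2 ⟨hi, not_le.1 hlt⟩)) (hc0 i hi)
  refine ⟨(Finset.range n).filter (fun i => 0 < c i), Finset.filter_subset _ _, fun F hF hQF => ?_,
    mem_convexHull_image_finset_iff.2 ⟨c, fun i hi => (Finset.mem_filter.1 hi).2.le, ?_, ?_⟩⟩
  · obtain ⟨δ, h1, h2, h3, h4⟩ := hQ F hQF
    have hev : ∀ᶠ ε : ℝ in nhdsWithin 0 (Set.Ioi 0), ∀ i ∈ Finset.range n, 0 ≤ c i + ε * δ i := by
      rw [Filter.eventually_all_finset]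
      intro i hi
      by_cases hδ : δ i < 0
      · have hci : 0 < c i := (Finset.mem_filter.1 (hF (h3 i hi hδ))).2
        have hcont : Continuous (fun ε : ℝ => c i + ε * δ i) := by fun_prop
        have := (hcont.continuousAt (x := (0 : ℝ))).eventually
          (isOpen_Ioi.mem_nhds (show c i + 0 * δ i ∈ Set.Ioi 0 by
            rw [Set.mem_Ioi]; linarith))
        exact (this.filter_mono nhdsWithin_le_nhds).mono fun ε hε => (Set.mem_Ioi.1 hε).le
      · filter_upwards [self_mem_nhdsWithin] with ε hε
        exact add_nonneg (hc0 i hi) (mul_nonneg (Set.mem_Ioi.1 hε).le (not_lt.1 hδ))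
    obtain ⟨ε, hε, hε0⟩ := (hev.and self_mem_nhdsWithin).exists
    have := hmax (fun i => c i + ε * δ i) hε
      (by rw [Finset.sum_add_distrib, ← Finset.mul_sum, h1, hc1]; simp)
      (by simp only [add_smul, mul_smul, Finset.sum_add_distrib, ← Finset.smul_sum, h2, hc2]; simp)
    rw [Finset.sum_add_distrib, ← Finset.mul_sum] at this
    have hpos : 0 < ε * ∑ i ∈ T, δ i := mul_pos hε0 (Finset.sum_pos h4 hTne)
    linarith
  · rw [← hc1]
    exact Finset.sum_subset (Finset.filter_subset _ _) hH
  · rw [← hc2]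
    exact Finset.sum_subset (Finset.filter_subset _ _) fun i hi hi' => by
      rw [hH i hi hi', zero_smul]

theorem IsSupported.mono {F G : Finset ℕ} (h : IsSupported V n F) (hG : G ⊆ F) :
    IsSupported V n G := by
  obtain ⟨L, r, h1, h2, h3⟩ := h
  exact ⟨L, r, h1, h2, fun i hi => h3 i (hG hi)⟩

/-- In a simplicial polytope, the negative part of a nontrivial dependence does not lie in a
supporting hyperplane, as this would contain the positive part, too. -/
theorem not_isSupported_of_dependence (hsimp : IsSimplicialHull V n) {F : Finset ℕ} {δ : ℕ → ℝ}
    (h1 : ∑ i ∈ Finset.range n, δ i = 0) (h2 : ∑ i ∈ Finset.range n, δ i • V i = 0)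
    (h3 : ∀ i ∈ Finset.range n, δ i < 0 → i ∈ F) (hne : ∃ i ∈ Finset.range n, 0 < δ i) :
    ¬ IsSupported V n F := by
  rintro ⟨L, r, hL1, hL2, hL3⟩
  have h0 : ∑ i ∈ Finset.range n, δ i * (L (V i) - r) = 0 := by
    have := congrArg L h2
    rw [map_sum, map_zero] at this
    simp only [map_smul, smul_eq_mul] at this
    simp only [mul_sub, Finset.sum_sub_distrib, this, ← Finset.sum_mul, h1]
    simp
  have hnn : ∀ i ∈ Finset.range n, 0 ≤ δ i * (L (V i) - r) := fun i hi => by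
    by_cases hδ : δ i < 0
    · rw [hL3 i (h3 i hi hδ), sub_self, mul_zero]
    · exact mul_nonneg (not_lt.1 hδ) (sub_nonneg.2 (hL1 i hi))
  have hzero := (Finset.sum_eq_zero_iff_of_nonneg hnn).1 h0
  set Z := (Finset.range n).filter (fun i => L (V i) = r) with hZ
  have hδZ : ∀ i ∈ Finset.range n, i ∉ Z → δ i = 0 := fun i hi hiZ => by
    refine (mul_eq_zero.1 (hzero i hi)).resolve_right fun h => hiZ ?_
    exact Finset.mem_filter.2 ⟨hi, sub_eq_zero.1 h⟩
  have hind := hsimp Z (Finset.filter_subset _ _)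
    ⟨L, r, hL1, hL2, fun i hi => (Finset.mem_filter.1 hi).2⟩
  obtain ⟨i, hi, hi'⟩ := hne
  have hiZ : i ∈ Z := by
    by_contra h
    exact hi'.ne' (hδZ i hi h)
  refine hi'.ne' (hind.eq_zero_of_sum (c := δ) ?_ ?_ i hiZ)
  · rw [Finset.sum_subset (Finset.filter_subset _ _) hδZ, h1]
  · rw [Finset.sum_subset (Finset.filter_subset _ _)
      (fun i hi hi' => by rw [hδZ i hi hi', zero_smul]), h2]

/-- In the range of dimensions in which the boundary of the polytope and its stacked triangulation
have the same faces, they have the same missing faces. -/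
theorem IsStackedSystem.isMissingFace_iff [FiniteDimensional ℝ E] {P Q : Finset ℕ → Prop}
    (h : IsStackedSystem V n m j P)
    (hQ : ∀ F, Q F → F ⊆ Finset.range n ∧ F.Nonempty ∧ ¬ IsSupported V n F)
    (hP : ∀ H ⊆ Finset.range n, (∀ F ⊆ H, ¬ Q F) → ∃ Y, P Y ∧ H ⊆ Y)
    (hanti : ∀ F F', Q F → Q F' → F ⊆ F' → F = F') {F : Finset ℕ} (hF : F.card + j < m + 1) :
    IsMissingFace V n F ↔ Q F := by
  have hface : ∀ G ⊆ Finset.range n, G.card + j < m + 1 → (∀ H ⊆ G, ¬ Q H) →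
      IsBoundaryFace V n G := fun G hG hc hGQ => by
    obtain ⟨Y, hY, hGY⟩ := hP G hG hGQ
    exact (h.supported Y hY G hGY hc).isBoundaryFace h.simplicial hG
  have hnot : ∀ G, Q G → ¬ IsBoundaryFace V n G := fun G hG hb =>
    (hQ G hG).2.2 (hb.isSupported (hQ G hG).2.1)
  constructor
  · rintro ⟨hFn, hb, hmin⟩
    have : ∃ H ⊆ F, Q H := by
      by_contra hno
      push Not at hno
      exact hb (hface F hFn hF hno)
    obtain ⟨H, hHF, hH⟩ := this
    rcases hHF.eq_or_ssubset with rfl | hss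
    · exact hH
    · exact absurd (hmin H hss) (hnot H hH)
  · intro hFQ
    refine ⟨(hQ F hFQ).1, hnot F hFQ, fun G hG => ?_⟩
    refine hface G (hG.1.trans (hQ F hFQ).1)
      (lt_of_le_of_lt (Nat.add_le_add_right (Finset.card_le_card hG.1) j) hF) fun H hH hHQ => ?_
    exact hG.2 (hanti H F hHQ hFQ (hH.trans hG.1) ▸ hH)

end MissingFaces

/-! ### The diamond -/

section Diamond

variable {E : Type*} [NormedAddCommGroup E] [NormedSpace ℝ E] {w : ℕ → ℝ} {q : E} {v : ℕ → E}
  {n : ℕ}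

theorem linearIndepOn_one_diamondPoint {Z : Finset ℕ}
    (h : LinearIndepOn ℝ (fun i => (w i, ((1 : ℝ), if i = 0 then q else v i))) (Z : Set ℕ)) :
    LinearIndepOn ℝ (fun i => ((1 : ℝ), diamondPoint w q v i)) (Z : Set ℕ) := by
  set g : ℝ × (ℝ × E) →ₗ[ℝ] ℝ × (ℝ × E) :=
    ((LinearMap.fst ℝ ℝ E) ∘ₗ (LinearMap.snd ℝ ℝ (ℝ × E))).prod
      ((LinearMap.fst ℝ ℝ (ℝ × E)).prod
        ((LinearMap.snd ℝ ℝ E) ∘ₗ (LinearMap.snd ℝ ℝ (ℝ × E)))) with hg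
  exact LinearIndependent.of_comp g h

theorem isSupported_diamondPoint_iff {F : Finset ℕ} : IsSupported (diamondPoint w q v) n F ↔
    ∃ (c : ℝ) (f : ℝ × E →ₗ[ℝ] ℝ),
      (∀ i ∈ Finset.range n, 0 ≤ c * w i + f (1, if i = 0 then q else v i)) ∧
      (∃ i ∈ Finset.range n, 0 < c * w i + f (1, if i = 0 then q else v i)) ∧
      ∀ i ∈ F, c * w i + f (1, if i = 0 then q else v i) = 0 := by
  have hsplit : ∀ (f : ℝ × E →ₗ[ℝ] ℝ) (x : E), f (1, x) = f (1, 0) + f (0, x) := fun f x => by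
    rw [← map_add]; simp
  constructor
  · rintro ⟨L, r, h1, h2, h3⟩
    have hL : ∀ i, L (diamondPoint w q v i)
        = L (1, 0) * w i + L (0, if i = 0 then q else v i) := fun i => by
      have : diamondPoint w q v i = w i • ((1 : ℝ), (0 : E)) + (0, if i = 0 then q else v i) := by
        simp [diamondPoint]
      rw [this, map_add, map_smul, smul_eq_mul, mul_comm]
    have hf : ∀ x : E, (L ∘ₗ (LinearMap.inr ℝ ℝ E) ∘ₗ (LinearMap.snd ℝ ℝ E)
        - r • LinearMap.fst ℝ ℝ E) (1, x) = L (0, x) - r := fun x => by simp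
    refine ⟨L (1, 0), L ∘ₗ (LinearMap.inr ℝ ℝ E) ∘ₗ (LinearMap.snd ℝ ℝ E)
      - r • LinearMap.fst ℝ ℝ E, fun i hi => ?_, ?_, fun i hi => ?_⟩
    · have := h1 i hi
      rw [hL] at this
      rw [hf]; linarith
    · obtain ⟨i, hi, this⟩ := h2
      rw [hL] at this
      exact ⟨i, hi, by rw [hf]; linarith⟩
    · have := h3 i hi
      rw [hL] at this
      rw [hf]; linarith
  · rintro ⟨c, f, h1, h2, h3⟩
    have hL : ∀ i, (c • LinearMap.fst ℝ ℝ E + f ∘ₗ (LinearMap.inr ℝ ℝ E) ∘ₗ (LinearMap.snd ℝ ℝ E))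
        (diamondPoint w q v i) = c * w i + f (0, if i = 0 then q else v i) := fun i => by
      simp [diamondPoint]
    refine ⟨c • LinearMap.fst ℝ ℝ E + f ∘ₗ (LinearMap.inr ℝ ℝ E) ∘ₗ (LinearMap.snd ℝ ℝ E),
      -f (1, 0), fun i hi => ?_, ?_, fun i hi => ?_⟩
    · have := h1 i hi
      rw [hsplit] at this
      rw [hL]; linarith
    · obtain ⟨i, hi, this⟩ := h2
      rw [hsplit] at this
      exact ⟨i, hi, by rw [hL]; linarith⟩
    · have := h3 i hi
      rw [hsplit] at this
      rw [hL]; linarith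

end Diamond

theorem proposition6p3 (k d n : ℕ) (hk : 1 ≤ k) (hd : 2 * k + 4 ≤ d) (hn : d ≤ n)
    (v : ℕ → EuclideanSpace ℝ (Fin (d - 2)))
    (hv : IsMWVertices (2 * k) (d - 2) (n - 1) v)
    (q : EuclideanSpace ℝ (Fin (d - 2)))
    (a : ℕ) (ha : 1 ≤ a) (han : a ≤ n - d + 1) :
    ∃ R : ℝ, ∀ w : ℕ → ℝ, IsLexHeights R n a w →
      -- the missing faces of size `k + 1` or `k + 2` of the diamond
      (∀ F : Finset ℕ,
        (IsMissingFace (diamondPoint w q v) n F ∧ (F.card = k + 1 ∨ F.card = k + 2)) ↔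
          ((∃ F' : Finset ℕ, F = insert 0 F' ∧ F' ⊆ Finset.Icc 1 (n - d + 2 * k) ∧
              F'.card = k + 1 ∧ IsIsolated F' ∧ IsLeast (F' : Set ℕ) a) ∨
            (F ⊆ Finset.Icc 1 (n - d + 2 * k) ∧
              F.card = k + 1 ∧ IsIsolated F ∧ ¬ IsLeast (F : Set ℕ) a))) ∧
      -- the diamond has exactly one `(k + 1)`-stacked triangulation
      (∃! S : Geometry.SimplicialComplex ℝ (ℝ × EuclideanSpace ℝ (Fin (d - 2))),
        IsStackedTriangulation (d - 1) (k + 1) (hullOf (diamondPoint w q v) n) S) ∧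
      -- the `(d - 1)`-simplices of that triangulation
      (∀ S : Geometry.SimplicialComplex ℝ (ℝ × EuclideanSpace ℝ (Fin (d - 2))),
        IsStackedTriangulation (d - 1) (k + 1) (hullOf (diamondPoint w q v) n) S →
        ∀ Y : Finset ℕ,
          (Y ⊆ Finset.range n ∧ Y.card = d ∧
            ∃ s ∈ S.faces, (s : Set (ℝ × EuclideanSpace ℝ (Fin (d - 2)))) =
              diamondPoint w q v '' (Y : Set ℕ)) ↔
          ∃ G : Finset ℕ, G ⊆ Finset.Icc 1 (n - d + 2 * k) ∧ G.card = 2 * k ∧ HasEvenBlocks G ∧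
            (Y = insert 0 (G ∪ Finset.Icc (n - d + 2 * k + 1) (n - 1)) ∨
              ((∀ i ∈ G, a < i) ∧
                Y = insert a (G ∪ Finset.Icc (n - d + 2 * k + 1) (n - 1))))) := by
  classical
  set M := n - d + 2 * k with hM
  obtain ⟨N, rfl⟩ : ∃ N, n = N + 1 := ⟨n - 1, by omega⟩
  rw [Nat.add_sub_cancel] at hv ⊢
  have hMN : M + 1 ≤ N := by omega
  have hM2 : 2 * k ≤ M := by omega
  have haM : a ≤ M := by omega
  obtain ⟨t, l, hconf⟩ := hv.exists_isMomentConfig (M := M) (by omega) (by omega) (by omega) q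
  obtain ⟨R, h1, h2, h3, h4⟩ :=
    (((hconf.eventually_linearIndepOn_of_nonneg hM2 (by omega) ha haM).and
    ((hconf.eventually_linearIndepOn_of_isStackedFacet (by omega) haM).and
    ((hconf.eventually_exists_supporting hk hM2 (by omega) ha haM).and
    (hconf.eventually_exists_dependence (a := a) (by omega)))))).exists
  refine ⟨R, fun w hw => ?_⟩
  set V := diamondPoint w q v with hV
  have hT : Finset.Icc (M + 1) N ⊆ Finset.range (N + 1) := fun i hi => by
    simp at hi ⊢; omega
  have hTne : (Finset.Icc (M + 1) N).Nonempty := ⟨M + 1, by simp; omega⟩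
  have hdep : ∀ F, IsSmallMissingFace k a M F → ∃ δ : ℕ → ℝ,
      ∑ i ∈ Finset.range (N + 1), δ i = 0 ∧ ∑ i ∈ Finset.range (N + 1), δ i • V i = 0 ∧
      (∀ i ∈ Finset.range (N + 1), δ i < 0 → i ∈ F) ∧
      ∀ j ∈ Finset.Icc (M + 1) N, 0 < δ j := fun F hF => by
    obtain ⟨δ, e1, e2, e3, e4⟩ := h4 w ha hw F hF
    have e5 := congrArg Prod.fst e1
    have e6 := congrArg Prod.snd e1
    simp only [Prod.fst_sum, Prod.snd_sum, Prod.smul_fst, Prod.smul_snd, Prod.fst_zero,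
      Prod.snd_zero, smul_eq_mul, mul_one] at e5 e6
    refine ⟨δ, e5, ?_, e3, e4⟩
    ext1
    · simpa [Prod.fst_sum, hV, diamondPoint] using e2
    · simpa [Prod.snd_sum, hV, diamondPoint] using e6
  have hcover : ∀ H ⊆ Finset.range (N + 1), (∀ F ⊆ H, ¬ IsSmallMissingFace k a M F) →
      ∃ Y, IsStackedFacet k a M N Y ∧ H ⊆ Y := fun H hH hHF =>
    exists_isStackedFacet_superset ha (by omega) hH hHF
  have hsys : IsStackedSystem V (N + 1) (d - 1) (k + 1) (IsStackedFacet k a M N) := by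
    refine ⟨fun Z hZ hsupp => ?_, fun Y hY => ?_, fun Y hY => ?_, fun Y hY => ?_,
      fun Y hY F hFY hc => ?_, fun i hi => ?_, fun z hz => ?_⟩
    · obtain ⟨c, f, e1, ⟨i, hi, e2⟩, e3⟩ := isSupported_diamondPoint_iff.1 hsupp
      exact linearIndepOn_one_diamondPoint (h1 w hw c f e1 ⟨i, hi, e2.ne'⟩ Z hZ e3)
    · obtain ⟨G, hG, -, -, hY⟩ := hY
      have hsub : G ∪ Finset.Icc (M + 1) N ⊆ Finset.range (N + 1) :=
        Finset.union_subset (fun i hi => by have := hG hi; simp at this ⊢; omega) hT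
      rcases hY with rfl | ⟨-, rfl⟩
      · exact Finset.insert_subset (by simp) hsub
      · exact Finset.insert_subset (by simp; omega) hsub
    · exact linearIndepOn_one_diamondPoint (h2 w hw Y hY)
    · obtain ⟨G, hG, hc, -, hY⟩ := hY
      have hdisj : Disjoint G (Finset.Icc (M + 1) N) := by
        rw [Finset.disjoint_left]
        intro i e1 e2
        have := hG e1
        simp at this e2
        omega
      have hcard : (G ∪ Finset.Icc (M + 1) N).card = d - 1 := by
        rw [Finset.card_union_of_disjoint hdisj, hc, Nat.card_Icc]; omega
      rcases hY with rfl | ⟨hGa, rfl⟩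
      · rw [Finset.card_insert_of_notMem, hcard]
        intro h'
        rcases Finset.mem_union.1 h' with h' | h'
        · have := hG h'; simp at this
        · simp at h'
      · rw [Finset.card_insert_of_notMem, hcard]
        intro h'
        rcases Finset.mem_union.1 h' with h' | h'
        · exact lt_irrefl _ (hGa a h')
        · simp at h'; omega
    · exact isSupported_diamondPoint_iff.2 (h3 w hw Y hY F hFY (by omega))
    · obtain ⟨Y, hY, hiY⟩ := hcover {i} (by simpa using hi) fun F hF hF' => by
        have e1 := Finset.card_le_card hF
        rw [Finset.card_singleton] at e1
        have := hF'.card_eq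
        omega
      exact ⟨Y, hY, by simpa using hiY⟩
    · obtain ⟨H, hH, hHF, hzH⟩ := exists_mem_convexHull_of_dependence hT hTne hdep hz
      obtain ⟨Y, hY, hHY⟩ := hcover H hH hHF
      exact ⟨Y, hY, convexHull_mono (Set.image_mono (by exact_mod_cast hHY)) hzH⟩
  have hfin : Module.finrank ℝ (ℝ × EuclideanSpace ℝ (Fin (d - 2))) = d - 1 := by
    rw [Module.finrank_prod, finrank_euclideanSpace_fin, Module.finrank_self]
    omega
  have hj : 2 * (k + 1) < d - 1 := by omega
  have hmiss : ∀ F : Finset ℕ, F.card = k + 1 ∨ F.card = k + 2 →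
      (IsMissingFace V (N + 1) F ↔ IsSmallMissingFace k a M F) := fun F hF => by
    refine hsys.isMissingFace_iff (fun F hF => ⟨hF.subset_range (by omega), ?_, ?_⟩) hcover
      (fun F F' e1 e2 e3 => e1.eq_of_subset e2 e3) (by omega)
    · have := hF.card_eq
      exact Finset.card_pos.1 (by omega)
    · obtain ⟨δ, e1, e2, e3, e4⟩ := hdep F hF
      exact not_isSupported_of_dependence hsys.simplicial e1 e2 e3
        ⟨M + 1, hT (by simp; omega), e4 _ (by simp; omega)⟩
  refine ⟨fun F => ⟨fun hF => (hmiss F hF.2).1 hF.1, fun hF => ?_⟩,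
    ⟨_, hsys.isStackedTriangulation_complex hfin hj,
      fun S hS => hsys.eq_complex hfin hj (by omega) hS⟩, fun S hS Y => ?_⟩
  · have hF' : IsSmallMissingFace k a M F := hF
    exact ⟨(hmiss F hF'.card_eq).2 hF', hF'.card_eq⟩
  · rw [hsys.eq_complex hfin hj (by omega) hS]
    have := hsys.mem_faces_complex_iff hfin hj (Y := Y)
    rw [show d - 1 + 1 = d by omega] at this
    exact this
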